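/- Call a function $\xi:\mathbb{Z}\to\{0,1\}$ a scenery, and call two sceneries $\xi,\tilde\xi$ equivalent, written $\xi\approx\tilde\xi$, if there are $a\in\mathbb{Z}$ and $b\in\{-1,1\}$ such that $\xi(x)=\tilde\xi(a+bx)$ for all $x\in\mathbb{Z}$. **Theorem 1.** Let $\{S(k)\}_{k\ge 0}$ and $\{\xi(k)\}_{k\in\mathbb{Z}}$ be two processes, defined on a common probability space with probability measure $P$ and independent of each other, such that $\{S(k)\}_{k\ge0}$ is a simple random walk on $\mathbb{Z}$ starting at the origin and the $\xi(k)$ are i.i.d. Bernoulli variables with parameter $\tfrac12$. Let $\chi(k):=\xi(S(k))$ for $k\in\mathbb{N}=\{0,1,2,\dots\}$. Then almost surely $\chi$ determines $\xi$ up to equivalence; that is, there exists a function $\mathcal{A}:\{0,1\}^{\mathbb{N}}\to\{0,1\}^{\mathbb{Z}}$, measurable with respect to the $\sigma$-algebras induced by the canonical coordinates on $\{0,1\}^{\mathbb{N}}$ and $\{0,1\}^{\mathbb{Z}}$, such that $$P\big(\mathcal{A}(\chi)\approx\xi\big)=1.$$ -/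

import Mathlib

open MeasureTheory ProbabilityTheory

/-- A two-color scenery: a coloring of the integers with the colors `0` and `1`. -/
abbrev Scenery : Type := ℤ → Fin 2

/-- Two sceneries are equivalent if they agree up to a translation and a reflection. -/
def Scenery.Equivalent (ξ η : Scenery) : Prop :=
  ∃ a b : ℤ, (b = 1 ∨ b = -1) ∧ ∀ x : ℤ, ξ x = η (a + b * x)

/-- `S` is a simple random walk on `ℤ` started at the origin: the increments are independent and
each of them is `1` or `-1` with probability `1/2`. -/
structure IsSimpleRandomWalk {Ω : Type*} [MeasurableSpace Ω] (P : Measure Ω)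
    (S : ℕ → Ω → ℤ) : Prop where
  measurable : ∀ k, Measurable (S k)
  start : ∀ᵐ ω ∂P, S 0 ω = 0
  indep : iIndepFun (fun k ω => S (k + 1) ω - S k ω) P
  up : ∀ k, P {ω | S (k + 1) ω - S k ω = 1} = 1 / 2
  down : ∀ k, P {ω | S (k + 1) ω - S k ω = -1} = 1 / 2

/-- The colors `ξ k`, `k ∈ ℤ`, are i.i.d. Bernoulli variables with parameter `1/2`. -/
structure IsBernoulliHalfScenery {Ω : Type*} [MeasurableSpace Ω] (P : Measure Ω)
    (ξ : ℤ → Ω → Fin 2) : Prop where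
  measurable : ∀ k, Measurable (ξ k)
  indep : iIndepFun ξ P
  prob_one : ∀ k, P {ω | ξ k ω = 1} = 1 / 2

/-- The color record `χ(k) = ξ(S(k))` obtained by observing `ξ` along the path of `S`. -/
def colorRecord {Ω : Type*} (ξ : ℤ → Ω → Fin 2) (S : ℕ → Ω → ℤ) (ω : Ω) : ℕ → Fin 2 :=
  fun k => ξ (S k ω) ω

/-! The position of the walk has the parity of the time, so the record χ shows more than colours.
Give each edge of ℤ a sign computed from the parity of one end and the colours of both (`edgeBit`),
reversed when the edge is crossed the other way, and let `level` be the two-sided walk with these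
steps. The level of the current site is then a function of χ alone (`pos_edgeBits_record`), while
for fair colours the level is itself a simple random walk (`Ex_edgeBits`). A turn of the path would
undo the last level step, so g consecutive rises in the record come from a straight passage over a
run of the scenery (`straight_of_run`).

At each scale this makes the neighbourhood of the origin recognisable. Up to the time `T₀` the
record collects the levels of the runs met near the origin. A later block of time passes `Test` if
all its runs occur, relative to the level at its start, at collected levels. A loop near the origin
passes (`test_of_loop`). Far away the scenery is independent of the collected levels, has runs at
other levels, and the walk very probably reads one of them (`Pr_test_far_le`). So the selected
blocks end near the origin, yet loops make the origin the end of exponentially many of them, and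
after a much visited site every continuation of a given length follows with at least half its
expected frequency (`Frequent`).

Now let two typical pairs of a scenery and a walk have the same record, hence the same selected
blocks. Probe the first scenery by a path that goes straight over two distinctive words with a gap
between them. Whenever one of the walks is bent over the gap, a straight shortcut reads the same
words with a shorter gap; it occurs at another selected time, chosen by pigeonhole so that the other
walk is again at a much visited site (`exists_continuation`, `Reading.shorten`). In the end both
walks are straight over the gap, and the distinctive words force the passage to cover `[-l, l]`, so
the sceneries agree there up to an isometry (`agree_of_same_record`). Words do not repeat, so the
isometries of consecutive scales coincide and the sceneries are equivalent
(`equivalent_of_typical`).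

At scale m typicality fails with probability at most 9 · 2^(-m) (`LargeScale.typical`), so
Borel–Cantelli applies. Pairs typical from some scale on form a compact set, so a typical scenery
with the given record can be chosen measurably (`exists_measurable_selection`); by uniqueness any
such choice is right. -/

/-! ### Finite probability: averages over lists of bits -/

/-- The real-valued indicator of a proposition. -/
noncomputable def ind (p : Prop) : ℝ := by
  classical exact if p then 1 else 0

theorem ind_of_true {p : Prop} (h : p) : ind p = 1 := by simp [ind, h]

theorem ind_of_false {p : Prop} (h : ¬p) : ind p = 0 := by simp [ind, h]

theorem ind_nonneg (p : Prop) : 0 ≤ ind p := by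
  unfold ind; split_ifs <;> norm_num

theorem ind_le_one (p : Prop) : ind p ≤ 1 := by
  unfold ind; split_ifs <;> norm_num

theorem ind_mono {p q : Prop} (h : p → q) : ind p ≤ ind q := by
  by_cases hp : p
  · rw [ind_of_true hp, ind_of_true (h hp)]
  · rw [ind_of_false hp]; exact ind_nonneg q

theorem ind_congr {p q : Prop} (h : p ↔ q) : ind p = ind q := by rw [propext h]

theorem ind_and (p q : Prop) : ind (p ∧ q) = ind p * ind q := by
  by_cases hp : p <;> by_cases hq : q <;> simp [ind, hp, hq]

theorem ind_or_le (p q : Prop) : ind (p ∨ q) ≤ ind p + ind q := by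
  by_cases hp : p <;> by_cases hq : q <;> simp [ind, hp, hq]

theorem ind_exists_le {ι : Type*} (s : Finset ι) (p : ι → Prop) :
    ind (∃ i ∈ s, p i) ≤ ∑ i ∈ s, ind (p i) := by
  by_cases h : ∃ i ∈ s, p i
  · obtain ⟨i, hi, hp⟩ := h
    rw [ind_of_true ⟨i, hi, hp⟩]
    calc (1 : ℝ) = ind (p i) := (ind_of_true hp).symm
      _ ≤ _ := Finset.single_le_sum (f := fun i => ind (p i)) (fun j _ => ind_nonneg _) hi
  · rw [ind_of_false h]; exact Finset.sum_nonneg fun j _ => ind_nonneg _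

/-- The average of `f` over all lists of `n` bits. -/
noncomputable def Ex : ℕ → (List Bool → ℝ) → ℝ
  | 0, f => f []
  | n + 1, f => (Ex n (fun u => f (true :: u)) + Ex n (fun u => f (false :: u))) / 2

theorem Ex_mono : ∀ (n : ℕ) {f g : List Bool → ℝ}, (∀ u, u.length = n → f u ≤ g u) →
    Ex n f ≤ Ex n g
  | 0, f, g, h => h [] rfl
  | n + 1, f, g, h => by
    have h1 := Ex_mono n (f := fun u => f (true :: u)) (g := fun u => g (true :: u))
      (fun u hu => h _ (by simp [hu]))
    have h2 := Ex_mono n (f := fun u => f (false :: u)) (g := fun u => g (false :: u))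
      (fun u hu => h _ (by simp [hu]))
    simp only [Ex]; linarith

theorem Ex_congr (n : ℕ) {f g : List Bool → ℝ} (h : ∀ u, u.length = n → f u = g u) :
    Ex n f = Ex n g :=
  le_antisymm (Ex_mono n fun u hu => (h u hu).le) (Ex_mono n fun u hu => (h u hu).ge)

theorem Ex_const : ∀ (n : ℕ) (c : ℝ), Ex n (fun _ => c) = c
  | 0, c => rfl
  | n + 1, c => by simp only [Ex, Ex_const n c]; ring

theorem Ex_add : ∀ (n : ℕ) (f g : List Bool → ℝ), Ex n (fun u => f u + g u) = Ex n f + Ex n g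
  | 0, f, g => rfl
  | n + 1, f, g => by
    simp only [Ex]
    rw [Ex_add n (fun u => f (true :: u)), Ex_add n (fun u => f (false :: u))]; ring

theorem Ex_mul_left : ∀ (n : ℕ) (c : ℝ) (f : List Bool → ℝ),
    Ex n (fun u => c * f u) = c * Ex n f
  | 0, c, f => rfl
  | n + 1, c, f => by
    simp only [Ex]
    rw [Ex_mul_left n c (fun u => f (true :: u)), Ex_mul_left n c (fun u => f (false :: u))]; ring

theorem Ex_nonneg (n : ℕ) {f : List Bool → ℝ} (h : ∀ u, u.length = n → 0 ≤ f u) : 0 ≤ Ex n f := by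
  rw [← Ex_const n 0]; exact Ex_mono n h

theorem Ex_le_const (n : ℕ) {f : List Bool → ℝ} {c : ℝ} (h : ∀ u, u.length = n → f u ≤ c) :
    Ex n f ≤ c := by
  rw [← Ex_const n c]; exact Ex_mono n h

theorem Ex_sum {ι : Type*} (n : ℕ) (s : Finset ι) (f : ι → List Bool → ℝ) :
    Ex n (fun u => ∑ i ∈ s, f i u) = ∑ i ∈ s, Ex n (f i) := by
  classical
  induction s using Finset.induction_on with
  | empty => simp [Ex_const]
  | insert a s ha ih =>
    simp only [Finset.sum_insert ha]
    rw [Ex_add n (f a) (fun u => ∑ i ∈ s, f i u), ih]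

theorem Ex_append : ∀ (a b : ℕ) (f : List Bool → ℝ),
    Ex (a + b) f = Ex a (fun u => Ex b (fun v => f (u ++ v)))
  | 0, b, f => by simp [Ex]
  | a + 1, b, f => by
    rw [show a + 1 + b = (a + b) + 1 by omega]
    simp only [Ex, List.cons_append]
    rw [Ex_append a b (fun u => f (true :: u)), Ex_append a b (fun u => f (false :: u))]

theorem Ex_comm : ∀ (a b : ℕ) (f : List Bool → List Bool → ℝ),
    Ex a (fun u => Ex b (fun v => f u v)) = Ex b (fun v => Ex a (fun u => f u v))
  | 0, b, f => rfl
  | a + 1, b, f => by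
    simp only [Ex]
    rw [Ex_comm a b (fun u => f (true :: u)), Ex_comm a b (fun u => f (false :: u)), ← Ex_add]
    have := Ex_mul_left b (1 / 2) (fun v => Ex a (fun u => f (true :: u) v) +
      Ex a (fun u => f (false :: u) v))
    rw [div_eq_inv_mul, ← one_div, ← this]
    congr 1; funext v; ring

/-- Flipping all bits does not change the average. -/
theorem Ex_flip : ∀ (n : ℕ) (f : List Bool → ℝ), Ex n (fun u => f (u.map not)) = Ex n f
  | 0, f => rfl
  | n + 1, f => by
    simp only [Ex, List.map_cons, Bool.not_true, Bool.not_false]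
    rw [Ex_flip n (fun u => f (false :: u)), Ex_flip n (fun u => f (true :: u))]; ring

/-- The proportion of lists of `n` bits with the property `p`. -/
noncomputable def Pr (n : ℕ) (p : List Bool → Prop) : ℝ := Ex n (fun u => ind (p u))

theorem Pr_mono (n : ℕ) {p q : List Bool → Prop} (h : ∀ u, u.length = n → p u → q u) :
    Pr n p ≤ Pr n q := Ex_mono n fun u hu => ind_mono (h u hu)

theorem Pr_congr (n : ℕ) {p q : List Bool → Prop} (h : ∀ u, u.length = n → (p u ↔ q u)) :
    Pr n p = Pr n q := Ex_congr n fun u hu => ind_congr (h u hu)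

theorem Pr_nonneg (n : ℕ) (p : List Bool → Prop) : 0 ≤ Pr n p :=
  Ex_nonneg n fun _ _ => ind_nonneg _

theorem Pr_le_one (n : ℕ) (p : List Bool → Prop) : Pr n p ≤ 1 :=
  Ex_le_const n fun _ _ => ind_le_one _

theorem Pr_or_le (n : ℕ) (p q : List Bool → Prop) :
    Pr n (fun u => p u ∨ q u) ≤ Pr n p + Pr n q := by
  unfold Pr; rw [← Ex_add]; exact Ex_mono n fun u _ => ind_or_le _ _

theorem Pr_le_add (n : ℕ) {p q r : List Bool → Prop} (h : ∀ u, u.length = n → p u → q u ∨ r u) :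
    Pr n p ≤ Pr n q + Pr n r := (Pr_mono n h).trans (Pr_or_le n q r)

theorem Pr_exists_le {ι : Type*} (n : ℕ) (s : Finset ι) (p : ι → List Bool → Prop) :
    Pr n (fun u => ∃ i ∈ s, p i u) ≤ ∑ i ∈ s, Pr n (p i) := by
  unfold Pr; rw [← Ex_sum]; exact Ex_mono n fun u _ => ind_exists_le _ _

theorem Pr_const_and (n : ℕ) (p : Prop) (q : List Bool → Prop) :
    Pr n (fun u => p ∧ q u) = ind p * Pr n q := by
  unfold Pr; rw [← Ex_mul_left]; exact Ex_congr n fun u _ => ind_and _ _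

theorem Pr_append (a b : ℕ) (p : List Bool → Prop) :
    Pr (a + b) p = Ex a (fun u => Pr b (fun v => p (u ++ v))) := Ex_append a b _

theorem Pr_succ (n : ℕ) (p : List Bool → Prop) :
    Pr (n + 1) p = (Pr n (fun u => p (true :: u)) + Pr n (fun u => p (false :: u))) / 2 := rfl

theorem Pr_flip (n : ℕ) (p : List Bool → Prop) : Pr n (fun u => p (u.map not)) = Pr n p :=
  Ex_flip n (fun u => ind (p u))

/-- Independence of the initial segment and the rest of a random list. -/
theorem Pr_append_and (a b : ℕ) (p q : List Bool → Prop) :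
    Pr (a + b) (fun u => p (u.take a) ∧ q (u.drop a)) = Pr a p * Pr b q := by
  rw [Pr_append]
  have : ∀ u : List Bool, u.length = a →
      Pr b (fun v => p ((u ++ v).take a) ∧ q ((u ++ v).drop a)) = Pr b q * ind (p u) := by
    intro u hu
    rw [mul_comm, ← Pr_const_and]
    refine Pr_congr b fun v _ => ?_
    rw [List.take_left' hu, List.drop_left' hu]
  rw [Ex_congr a this, Ex_mul_left, mul_comm]; rfl

theorem Pr_prefix (a b : ℕ) (p : List Bool → Prop) :
    Pr (a + b) (fun u => p (u.take a)) = Pr a p := by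
  rw [Pr_append]
  refine Ex_congr a fun u hu => ?_
  have : Pr b (fun v => p ((u ++ v).take a)) = Pr b (fun _ => p u) :=
    Pr_congr b fun v _ => by rw [List.take_left' hu]
  rw [this]; exact Ex_const b _

theorem Pr_suffix (a b : ℕ) (p : List Bool → Prop) :
    Pr (a + b) (fun u => p (u.drop a)) = Pr b p := by
  rw [Pr_append, ← Ex_const a (Pr b p)]
  exact Ex_congr a fun u hu => Pr_congr b fun v _ => by rw [List.drop_left' hu]

/-- A list is equal to a given one with the uniform probability. -/
theorem Pr_eq : ∀ (n : ℕ) (w : List Bool), w.length = n → Pr n (fun u => u = w) = (1 / 2) ^ n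
  | 0, w, h => by
    rw [List.length_eq_zero_iff] at h
    subst h
    simp [Pr, Ex, ind]
  | n + 1, [], h => by simp at h
  | n + 1, c :: w, h => by
    have ih := Pr_eq n w (by simpa using h)
    have h0 : Pr n (fun _ => False) = 0 := by
      unfold Pr; simp [ind, Ex_const]
    rw [Pr_succ]
    cases c <;> simp [ih, h0, pow_succ] <;> ring

theorem Pr_not (n : ℕ) (p : List Bool → Prop) : Pr n (fun u => ¬p u) = 1 - Pr n p := by
  have : Pr n p + Pr n (fun u => ¬p u) = 1 := by
    unfold Pr; rw [← Ex_add, ← Ex_const n 1]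
    refine Ex_congr n fun u _ => ?_
    by_cases h : p u <;> simp [ind, h]
  linarith

/-- Markov's inequality. -/
theorem Pr_ge_le (n : ℕ) (f : List Bool → ℝ) (hf : ∀ u, u.length = n → 0 ≤ f u) {c : ℝ}
    (hc : 0 < c) (p : List Bool → Prop) (hp : ∀ u, u.length = n → p u → c ≤ f u) :
    Pr n p ≤ Ex n f / c := by
  rw [le_div_iff₀ hc, mul_comm]
  unfold Pr
  rw [← Ex_mul_left]
  refine Ex_mono n fun u hu => ?_
  by_cases h : p u
  · rw [ind_of_true h, mul_one]; exact hp u hu h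
  · rw [ind_of_false h, mul_zero]; exact hf u hu

/-- A product of weights of mean at most one, applied to those blocks of a random list that are
selected by their past, has mean at most one. -/
theorem Ex_prod_blocks_le_one (T : ℕ) (tr : List Bool → Prop) (φ : List Bool → ℝ)
    (h0 : ∀ w, 0 ≤ φ w) (h1 : Ex T φ ≤ 1) :
    ∀ N : ℕ, Ex (N * T) (fun u => ∏ i ∈ Finset.range N,
      (ind (tr (u.take (i * T))) * φ ((u.drop (i * T)).take T) +
        (1 - ind (tr (u.take (i * T)))))) ≤ 1
  | 0 => by simp [Ex]
  | N + 1 => by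
    rw [show (N + 1) * T = N * T + T by ring, Ex_append]
    refine le_trans (Ex_mono _ fun u hu => ?_) (Ex_prod_blocks_le_one T tr φ h0 h1 N)
    have key : ∀ v : List Bool, v.length = T →
        (∏ i ∈ Finset.range (N + 1), (ind (tr ((u ++ v).take (i * T))) *
          φ (((u ++ v).drop (i * T)).take T) + (1 - ind (tr ((u ++ v).take (i * T)))))) =
        (∏ i ∈ Finset.range N, (ind (tr (u.take (i * T))) * φ ((u.drop (i * T)).take T) +
          (1 - ind (tr (u.take (i * T)))))) * (ind (tr u) * φ v + (1 - ind (tr u))) := by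
      intro v hv
      rw [Finset.prod_range_succ]
      congr 1
      · refine Finset.prod_congr rfl fun i hi => ?_
        have hi' : i + 1 ≤ N := Finset.mem_range.1 hi
        have hle : i * T + T ≤ N * T := by nlinarith
        rw [List.take_append_of_le_length (by omega), List.drop_append_of_le_length (by omega),
          List.take_append_of_le_length (by simp; omega)]
      · rw [List.take_left' hu, List.drop_left' hu, List.take_of_length_le hv.le]
    -- With the first `N` blocks fixed, only the last factor is random, and its mean is at most one
    -- whether or not its block is selected.
    rw [Ex_congr T key, Ex_mul_left, Ex_add, Ex_mul_left, Ex_const]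
    have hp : 0 ≤ ∏ i ∈ Finset.range N, (ind (tr (u.take (i * T))) *
        φ ((u.drop (i * T)).take T) + (1 - ind (tr (u.take (i * T))))) :=
      Finset.prod_nonneg fun i _ => add_nonneg (mul_nonneg (ind_nonneg _) (h0 _))
        (sub_nonneg.2 (ind_le_one _))
    refine mul_le_of_le_one_right hp ?_
    have := ind_nonneg (tr u)
    nlinarith

/-! ### Simple random walk: local bounds and hitting times -/

/-- `true` is a step to the right and `false` a step to the left. -/
def sg (c : Bool) : ℤ := if c then 1 else -1

/-- The end point of the walk started at `0` with the given steps. -/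
def pos (u : List Bool) : ℤ := (u.map sg).sum

@[simp] theorem pos_nil : pos [] = 0 := rfl

@[simp] theorem pos_cons (c : Bool) (u : List Bool) : pos (c :: u) = sg c + pos u := by
  simp [pos]

@[simp] theorem pos_append (u v : List Bool) : pos (u ++ v) = pos u + pos v := by
  simp [pos]

theorem sg_not (c : Bool) : sg (!c) = -sg c := by cases c <;> rfl

theorem pos_map_not (u : List Bool) : pos (u.map not) = -pos u := by
  induction u with
  | nil => rfl
  | cons c u ih => simp only [List.map_cons, pos_cons, ih, sg_not]; ring

theorem sg_abs (c : Bool) : |sg c| = 1 := by cases c <;> rfl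

theorem abs_pos_le (u : List Bool) : |pos u| ≤ u.length := by
  induction u with
  | nil => simp
  | cons c u ih =>
    rw [pos_cons]
    have := abs_add_le (sg c) (pos u)
    rw [sg_abs] at this
    push_cast [List.length_cons]; linarith

theorem pos_replicate_true (n : ℕ) : pos (List.replicate n true) = n := by
  simp [pos, sg]

theorem pos_parity (u : List Bool) : Even (pos u) ↔ Even u.length := by
  induction u with
  | nil => simp
  | cons c u ih =>
    rw [pos_cons, List.length_cons, Nat.even_add_one, ← ih, Int.even_add]
    cases c <;> simp [sg]

theorem sum_ind_eq_card {ι : Type*} (s : Finset ι) (p : ι → Prop) [DecidablePred p] :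
    ∑ i ∈ s, ind (p i) = ((s.filter p).card : ℝ) := by
  rw [Finset.card_filter]; push_cast
  refine Finset.sum_congr rfl fun i _ => ?_
  by_cases h : p i <;> simp [ind, h]

theorem Pr_false (n : ℕ) {p : List Bool → Prop} (h : ∀ u, u.length = n → ¬p u) : Pr n p = 0 := by
  unfold Pr; rw [← Ex_const n 0]
  exact Ex_congr n fun u hu => ind_of_false (h u hu)

theorem Pr_true (n : ℕ) {p : List Bool → Prop} (h : ∀ u, u.length = n → p u) : Pr n p = 1 := by
  unfold Pr; rw [← Ex_const n 1]
  exact Ex_congr n fun u hu => ind_of_true (h u hu)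

theorem Pr_pos_eq_zero (n : ℕ) (h : ℤ) (hh : ∀ k : ℕ, h ≠ 2 * k - n) :
    Pr n (fun u => pos u = h) = 0 := by
  refine Pr_false n fun u hu hp => ?_
  have h1 := pos_parity u
  have h2 := abs_le.1 (abs_pos_le u)
  have h3 : Even (pos u + u.length) := by
    rw [Int.even_add, h1]; simp
  obtain ⟨k, hk⟩ := h3
  refine hh k.toNat ?_
  rw [← hp]
  rw [hu] at h2 hk
  omega

theorem Pr_pos_eq_choose : ∀ (n k : ℕ),
    Pr n (fun u => pos u = 2 * k - n) = (n.choose k : ℝ) / 2 ^ n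
  | 0, 0 => by simp [Pr, Ex, ind]
  | 0, k + 1 => by
    rw [Pr_false]
    · simp
    · intro u hu; rw [List.length_eq_zero_iff] at hu; subst hu; simp; omega
  | n + 1, k => by
    have e1 : Pr n (fun u => pos (true :: u) = 2 * k - ((n + 1 : ℕ) : ℤ)) =
        Pr n (fun u => pos u = 2 * (k - 1 : ℤ) - n) :=
      Pr_congr n fun u _ => by 
        simp only [pos_cons, sg]; push_cast; constructor <;> intro h <;> omega
    have e2 : Pr n (fun u => pos (false :: u) = 2 * k - ((n + 1 : ℕ) : ℤ)) =
        Pr n (fun u => pos u = 2 * (k : ℤ) - n) :=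
      Pr_congr n fun u _ => by 
        simp only [pos_cons, sg]; push_cast; constructor <;> intro h <;> omega
    rw [Pr_succ, e1, e2, Pr_pos_eq_choose n k]
    cases k with
    | zero =>
      rw [Pr_pos_eq_zero]
      · simp [pow_succ]; ring
      · intro k; push_cast; omega
    | succ k =>
      have := Pr_pos_eq_choose n k
      rw [show (2 * (((k + 1 : ℕ) : ℤ) - 1) - n) = 2 * (k : ℤ) - n by push_cast; ring, this,
        Nat.choose_succ_succ, pow_succ]
      push_cast; field_simp

/-- The ratio of consecutive terms is controlled by (2m+1)(2m+3) ≤ (2m+2)², which avoids Stirling's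
formula. -/
theorem centralBinom_sq_mul_le (m : ℕ) : m.centralBinom ^ 2 * (2 * m + 1) ≤ 16 ^ m := by
  induction m with
  | zero => simp
  | succ m ih =>
    have h := Nat.succ_mul_centralBinom_succ m
    have h2 : (m + 1) ^ 2 * ((m + 1).centralBinom ^ 2 * (2 * (m + 1) + 1)) ≤
        (m + 1) ^ 2 * 16 ^ (m + 1) := by
      calc (m + 1) ^ 2 * ((m + 1).centralBinom ^ 2 * (2 * (m + 1) + 1))
          = ((m + 1) * (m + 1).centralBinom) ^ 2 * (2 * m + 3) := by ring
        _ = (2 * (2 * m + 1) * m.centralBinom) ^ 2 * (2 * m + 3) := by rw [h]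
        _ = (m.centralBinom ^ 2 * (2 * m + 1)) * (4 * (2 * m + 1) * (2 * m + 3)) := by ring
        _ ≤ 16 ^ m * (16 * (m + 1) ^ 2) := Nat.mul_le_mul ih (by nlinarith)
        _ = _ := by ring
    exact Nat.le_of_mul_le_mul_left h2 (by positivity)

theorem le_centralBinom_sq_mul (m : ℕ) (hm : 1 ≤ m) : 16 ^ m ≤ m.centralBinom ^ 2 * (4 * m) := by
  induction m, hm using Nat.le_induction with
  | base => simp [Nat.centralBinom, Nat.choose]
  | succ m hm ih =>
    have h := Nat.succ_mul_centralBinom_succ m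
    have h2 : m * (m + 1) * 16 ^ (m + 1) ≤
        m * (m + 1) * ((m + 1).centralBinom ^ 2 * (4 * (m + 1))) := by
      calc m * (m + 1) * 16 ^ (m + 1) = 16 ^ m * (16 * m * (m + 1)) := by ring
        _ ≤ (m.centralBinom ^ 2 * (4 * m)) * (4 * (2 * m + 1) ^ 2) :=
          Nat.mul_le_mul ih (by nlinarith)
        _ = (2 * (2 * m + 1) * m.centralBinom) ^ 2 * (4 * m) := by ring
        _ = ((m + 1) * (m + 1).centralBinom) ^ 2 * (4 * m) := by rw [h]
        _ = _ := by ring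
    exact Nat.le_of_mul_le_mul_left h2 (by positivity)

theorem choose_middle_sq (n : ℕ) : (n.choose (n / 2)) ^ 2 * (n + 1) ≤ 4 ^ n := by
  obtain ⟨m, rfl | rfl⟩ : ∃ m, n = 2 * m ∨ n = 2 * m + 1 := ⟨n / 2, by omega⟩
  · have := centralBinom_sq_mul_le m
    rw [show 2 * m / 2 = m by omega, pow_mul]
    simpa [Nat.centralBinom] using this
  · have h1 := centralBinom_sq_mul_le (m + 1)
    have h2 : (m + 1).centralBinom = 2 * (2 * m + 1).choose m := by
      rw [Nat.centralBinom, show 2 * (m + 1) = (2 * m + 1) + 1 by ring, Nat.choose_succ_succ,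
        Nat.choose_symm_half]; ring
    rw [show (2 * m + 1) / 2 = m by omega]
    rw [h2] at h1
    have h3 : (16 : ℕ) ^ (m + 1) = 4 * 4 ^ (2 * m + 1) := by
      rw [show (16 : ℕ) = 4 ^ 2 by norm_num, ← pow_mul]; ring
    rw [h3] at h1
    nlinarith

theorem Pr_pos_eq_le (n : ℕ) (h : ℤ) :
    Pr n (fun u => pos u = h) ≤ 1 / Real.sqrt (n + 1) := by
  by_cases hh : ∃ k : ℕ, h = 2 * k - n
  · obtain ⟨k, rfl⟩ := hh
    rw [Pr_pos_eq_choose]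
    have h1 : (n.choose k : ℝ) / 2 ^ n ≤ (n.choose (n / 2) : ℝ) / 2 ^ n := by
      gcongr; exact Nat.choose_le_middle k n
    refine h1.trans ?_
    rw [le_div_iff₀ (by positivity)]
    refine (sq_le_sq₀ (by positivity) (by norm_num)).1 ?_
    rw [mul_pow, Real.sq_sqrt (by positivity), div_pow, one_pow, div_mul_eq_mul_div,
      div_le_one (by positivity), ← pow_mul, mul_comm n 2, pow_mul]
    have := choose_middle_sq n
    norm_num
    exact_mod_cast this
  · rw [Pr_pos_eq_zero n h (by simpa using hh)]; positivity

theorem Pr_pos_mem_le (n : ℕ) (H : Finset ℤ) (c : ℤ) :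
    Pr n (fun u => c + pos u ∈ H) ≤ H.card / Real.sqrt (n + 1) := by
  calc Pr n (fun u => c + pos u ∈ H) ≤ Pr n (fun u => ∃ h ∈ H, pos u = h - c) :=
        Pr_mono n fun u _ h => ⟨_, h, by ring⟩
    _ ≤ ∑ h ∈ H, Pr n (fun u => pos u = h - c) := Pr_exists_le n H _
    _ ≤ ∑ h ∈ H, 1 / Real.sqrt (n + 1) := Finset.sum_le_sum fun h _ => Pr_pos_eq_le n _
    _ = _ := by rw [Finset.sum_const, nsmul_eq_mul]; ring

theorem le_Pr_pos_eq_zero (m : ℕ) (hm : 1 ≤ m) :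
    1 / (2 * Real.sqrt m) ≤ Pr (2 * m) (fun u => pos u = 0) := by
  have h := Pr_pos_eq_choose (2 * m) m
  have e : Pr (2 * m) (fun u => pos u = 0) = (m.centralBinom : ℝ) / 4 ^ m := by
    rw [Nat.centralBinom, show (4 : ℝ) ^ m = 2 ^ (2 * m) by rw [pow_mul]; norm_num, ← h]
    refine Pr_congr _ fun u _ => ?_
    push_cast; simp
  have hm' : (0 : ℝ) < m := by exact_mod_cast hm
  have hs : 0 < Real.sqrt m := Real.sqrt_pos.2 hm'
  rw [e, div_le_div_iff₀ (by positivity) (by positivity), one_mul]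
  refine (sq_le_sq₀ (by positivity) (by positivity)).1 ?_
  rw [mul_pow, mul_pow, Real.sq_sqrt hm'.le, ← pow_mul, mul_comm m 2, pow_mul]
  have := le_centralBinom_sq_mul m hm
  norm_num
  exact_mod_cast this

/-- The expected number of visits to 0 is of order √n, which drives the last-exit argument. Odd
times are dropped, and each even time contributes at least 1/(2√n). -/
theorem le_sum_Pr_pos_eq_zero (n : ℕ) :
    Real.sqrt n / 4 ≤ ∑ s ∈ Finset.range (n + 1), Pr s (fun u => pos u = 0) := by
  rcases Nat.eq_zero_or_pos n with rfl | hn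
  · simp [Pr_nonneg]
  have hn' : (1 : ℝ) ≤ n := by exact_mod_cast hn
  have hs : 0 < Real.sqrt n := Real.sqrt_pos.2 (by linarith)
  have h0 : ∑ m ∈ Finset.range (n / 2 + 1), Pr (2 * m) (fun u => pos u = 0) ≤
      ∑ s ∈ Finset.range (n + 1), Pr s (fun u => pos u = 0) := by
    have := Finset.sum_image (s := Finset.range (n / 2 + 1)) (g := fun m => 2 * m)
      (f := fun s => Pr s (fun u => pos u = 0)) (fun a _ b _ h => by simpa using h)
    rw [← this]
    refine Finset.sum_le_sum_of_subset_of_nonneg ?_ fun _ _ _ => Pr_nonneg _ _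
    intro s hs
    simp only [Finset.mem_image, Finset.mem_range] at hs ⊢
    omega
  have h1 : ∀ m ∈ Finset.range (n / 2 + 1),
      1 / (2 * Real.sqrt n) ≤ Pr (2 * m) (fun u => pos u = 0) := by
    intro m hm
    rcases Nat.eq_zero_or_pos m with rfl | hm0
    · rw [Pr_true]
      · rw [div_le_one (by positivity)]
        have : 1 ≤ Real.sqrt n := Real.one_le_sqrt.2 hn'
        linarith
      · intro u hu; simp at hu; simp [hu]
    · refine le_trans ?_ (le_Pr_pos_eq_zero m hm0)
      have : (m : ℝ) ≤ n := by
        have := Finset.mem_range.1 hm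
        exact_mod_cast (by omega : m ≤ n)
      have hm1 : 0 < Real.sqrt m := Real.sqrt_pos.2 (by exact_mod_cast hm0)
      gcongr
  refine le_trans ?_ h0
  refine le_trans ?_ (Finset.sum_le_sum h1)
  rw [Finset.sum_const, Finset.card_range, nsmul_eq_mul, div_le_iff₀ (by norm_num)]
  have h2 : (n : ℝ) ≤ 2 * ((n / 2 + 1 : ℕ) : ℝ) := by exact_mod_cast (by omega)
  have h3 : Real.sqrt n * Real.sqrt n = n := Real.mul_self_sqrt (by linarith)
  rw [show ((n / 2 + 1 : ℕ) : ℝ) * (1 / (2 * Real.sqrt n)) * 4 =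
    2 * ((n / 2 + 1 : ℕ) : ℝ) / Real.sqrt n by field_simp; norm_num, le_div_iff₀ hs]
  linarith

/-- The walk with steps `u` does not visit `z`. -/
def NoHit (z : ℤ) (u : List Bool) : Prop := ∀ t ≤ u.length, pos (u.take t) ≠ z

theorem noHit_cons (z : ℤ) (c : Bool) (u : List Bool) :
    NoHit z (c :: u) ↔ z ≠ 0 ∧ NoHit (z - sg c) u := by
  constructor
  · intro h
    refine ⟨fun hz => h 0 (by simp) (by simp [hz]), fun t ht hp => h (t + 1) (by simp; omega) ?_⟩
    simp [hp]
  · rintro ⟨h0, h⟩ t ht hp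
    cases t with
    | zero => simp at hp; exact h0 hp.symm
    | succ t =>
      simp at hp ht
      exact h t ht (by linarith)

/-- The reflection principle. Conditioning on the first step, both sides obey the same recursion,
with the target moved by one in either direction. -/
theorem Pr_noHit_nat : ∀ (n z : ℕ),
    Pr n (NoHit z) = Pr n (fun u => -(z : ℤ) ≤ pos u ∧ pos u < z)
  | n, 0 => by
    rw [Pr_false, Pr_false]
    · rintro u - ⟨h1, h2⟩; simp at h1 h2; omega
    · intro u _ h; exact h 0 (by simp) (by simp)
  | 0, z + 1 => by
    rw [Pr_true, Pr_true]
    · intro u hu; rw [List.length_eq_zero_iff] at hu; subst hu; rw [pos_nil]; omega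
    · intro u hu; rw [List.length_eq_zero_iff] at hu; subst hu
      intro t _; rw [List.take_nil, pos_nil]; omega
  | n + 1, z + 1 => by
    have e1 : Pr n (fun u => NoHit ((z + 1 : ℕ) : ℤ) (true :: u)) = Pr n (NoHit (z : ℕ)) :=
      Pr_congr n fun u _ => by
        rw [noHit_cons, show ((z + 1 : ℕ) : ℤ) - sg true = (z : ℕ) by simp [sg]]
        exact and_iff_right (by omega)
    have e2 : Pr n (fun u => NoHit ((z + 1 : ℕ) : ℤ) (false :: u)) = Pr n (NoHit (z + 2 : ℕ)) :=
      Pr_congr n fun u _ => by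
        rw [noHit_cons, show ((z + 1 : ℕ) : ℤ) - sg false = (z + 2 : ℕ) by simp [sg]; ring]
        exact and_iff_right (by omega)
    rw [Pr_succ, Pr_succ, e1, e2, Pr_noHit_nat n z, Pr_noHit_nat n (z + 2)]
    congr 1
    unfold Pr
    rw [← Ex_add, ← Ex_add]
    refine Ex_congr n fun u _ => ?_
    simp only [pos_cons, sg]
    generalize pos u = p
    simp only [ind]
    push_cast
    split_ifs <;> first | omega | norm_num

theorem noHit_map_not (z : ℤ) (u : List Bool) : NoHit z (u.map not) ↔ NoHit (-z) u := by
  unfold NoHit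
  simp only [List.length_map, ← List.map_take, pos_map_not]
  refine forall_congr' fun t => forall_congr' fun _ => ?_
  constructor <;> intro h h' <;> apply h <;> linarith

theorem Pr_noHit_le (n : ℕ) (z : ℤ) : Pr n (NoHit z) ≤ 2 * |(z : ℝ)| / Real.sqrt (n + 1) := by
  have key : ∀ k : ℕ, Pr n (NoHit k) ≤ 2 * (k : ℝ) / Real.sqrt (n + 1) := by
    intro k
    rw [Pr_noHit_nat]
    have h := Pr_pos_mem_le n (Finset.Ico (-(k : ℤ)) k) 0
    simp only [zero_add, Finset.mem_Ico] at h
    refine h.trans (le_of_eq ?_)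
    rw [Int.card_Ico]; congr 1
    rw [show ((k : ℤ) - -(k : ℤ)).toNat = 2 * k by omega]; push_cast; ring
  obtain ⟨k, rfl | rfl⟩ := z.eq_nat_or_neg
  · simpa using key k
  · rw [← Pr_flip]
    have : Pr n (fun u => NoHit (-(k : ℤ)) (u.map not)) = Pr n (NoHit k) :=
      Pr_congr n fun u _ => by rw [noHit_map_not, neg_neg]
    rw [this]; simpa using key k

/-! ### Traversing a prescribed interval; large deviations -/

/-- The walk with steps `u` never moves from `z` to `z + g` in `g` steps. -/
def NotRead (z : ℤ) (g : ℕ) (u : List Bool) : Prop :=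
  ∀ t, t + g ≤ u.length → pos (u.take t) = z → (u.drop t).take g ≠ List.replicate g true

theorem NotRead.take {z : ℤ} {g : ℕ} {u : List Bool} (h : NotRead z g u) (n : ℕ) :
    NotRead z g (u.take n) := by
  intro t ht hp hr
  rw [List.length_take] at ht
  refine h t (by omega) ?_ ?_
  · rwa [List.take_take, min_eq_left (by omega)] at hp
  · rwa [List.drop_take, List.take_take, min_eq_left (by omega)] at hr

theorem NotRead.tail {z : ℤ} {g : ℕ} {c : Bool} {u : List Bool} (h : NotRead z g (c :: u)) :
    NotRead (z - sg c) g u := by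
  intro t ht hp
  have := h (t + 1) (by simp; omega) (by simp [hp])
  simpa using this

theorem take_take_add {α : Type*} (u : List α) (s t : ℕ) :
    u.take (s + t) = u.take s ++ (u.drop s).take t := List.take_add

/-- Last-exit decomposition: `A s` says that a traversal starting at 0 begins at time `s` and that
none follows in the `n` steps after it. These events exclude each other, and independence turns each
probability into a product. After the traversal the walk is at `g`, so the interval starts at `-g`
relative to it. -/
theorem Pr_notRead_last_exit (n g : ℕ) :
    (∑ s ∈ Finset.range (n + 1), Pr s (fun u => pos u = 0)) *
      ((1 / 2) ^ g * Pr n (NotRead (-g) g)) ≤ 1 := by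
  classical
  set A : ℕ → List Bool → Prop := fun s u => (pos (u.take s) = 0 ∧
    (u.drop s).take g = List.replicate g true) ∧ NotRead (-g) g ((u.drop (s + g)).take n) with hA
  have h1 : ∀ s ∈ Finset.range (n + 1), Pr (n + g + n) (A s) =
      Pr s (fun u => pos u = 0) * ((1 / 2) ^ g * Pr n (NotRead (-g) g)) := by
    intro s hs
    have hs' : s ≤ n := by have := Finset.mem_range.1 hs; omega
    -- The total length leaves `n` steps after the traversal even for `s = n`.
    rw [show n + g + n = s + (g + (n + (n - s))) by omega]
    have e0 : Pr (n + (n - s)) (fun u => NotRead (-g) g (u.take n)) = Pr n (NotRead (-g) g) :=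
      Pr_prefix n (n - s) _
    have e1 := Pr_append_and g (n + (n - s)) (fun u => u = List.replicate g true)
      (fun u => NotRead (-g) g (u.take n))
    have e2 := Pr_append_and s (g + (n + (n - s))) (fun u => pos u = 0)
      (fun u => u.take g = List.replicate g true ∧ NotRead (-g) g ((u.drop g).take n))
    rw [Pr_eq g _ (by simp), e0] at e1
    rw [← e1, ← e2]
    refine Pr_congr _ fun u _ => ?_
    simp only [hA, List.drop_drop, and_assoc]
  have h2 : ∀ u : List Bool, u.length = n + g + n →
      ∑ s ∈ Finset.range (n + 1), ind (A s u) ≤ 1 := by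
    intro u hu
    rw [sum_ind_eq_card]
    norm_cast
    rw [Finset.card_le_one]
    have aux : ∀ s s', s < s' → s' ≤ n → A s u → A s' u → False := by
      rintro s s' hlt hn ⟨⟨ha, hb⟩, hc⟩ ⟨⟨ha', hb'⟩, -⟩
      rcases Nat.lt_or_ge s' (s + g) with h | h
      -- Overlapping traversals are impossible: at time `s'` the walk would be at `s' - s > 0`.
      · have e := take_take_add u s (s' - s)
        rw [show s + (s' - s) = s' by omega] at e
        have e2 : (u.drop s).take (s' - s) = List.replicate (s' - s) true := by
          have := congrArg (List.take (s' - s)) hb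
          rw [List.take_take, List.take_replicate, min_eq_left (by omega)] at this
          exact this
        rw [e, e2, pos_append, ha, pos_replicate_true] at ha'
        omega
      · refine hc (s' - (s + g)) (by simp; omega) ?_ ?_
        · have e := take_take_add u (s + g) (s' - (s + g))
          rw [show s + g + (s' - (s + g)) = s' by omega, take_take_add u s g, hb] at e
          rw [List.take_take, min_eq_left (by omega)]
          rw [e] at ha'
          simp only [pos_append, ha, pos_replicate_true] at ha'
          linarith
        · rw [List.drop_take, List.take_take, min_eq_left (by omega), List.drop_drop,
            show s + g + (s' - (s + g)) = s' by omega]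
          exact hb'
    intro s hs s' hs'
    simp only [Finset.mem_filter, Finset.mem_range] at hs hs'
    rcases lt_trichotomy s s' with h | h | h
    · exact (aux s s' h (by omega) hs.2 hs'.2).elim
    · exact h
    · exact (aux s' s h (by omega) hs'.2 hs.2).elim
  rw [Finset.sum_mul, ← Finset.sum_congr rfl h1]
  unfold Pr
  rw [← Ex_sum]
  exact Ex_le_const _ h2

/-- The strong Markov property at the first visit to `z + g`, unrolled as an induction over single
steps. From there the start of the interval lies at `-g`. -/
theorem Pr_notRead_first_hit (g n₂ : ℕ) : ∀ (n₁ : ℕ) (z : ℤ),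
    Pr (n₁ + n₂) (NotRead z g) ≤ Pr n₁ (NoHit (z + g)) + Pr n₂ (NotRead (-g) g) := by
  have base : ∀ (n₁ : ℕ) (z : ℤ), z + g = 0 →
      Pr (n₁ + n₂) (NotRead z g) ≤ Pr n₁ (NoHit (z + g)) + Pr n₂ (NotRead (-g) g) := by
    intro n₁ z hz
    have : z = -(g : ℤ) := by linarith
    subst this
    have h1 : Pr (n₁ + n₂) (NotRead (-g) g) ≤ Pr n₂ (NotRead (-g) g) := by
      rw [add_comm, ← Pr_prefix n₂ n₁]
      exact Pr_mono _ fun u _ h => h.take n₂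
    linarith [Pr_nonneg n₁ (NoHit (-(g : ℤ) + g))]
  intro n₁
  induction n₁ with
  | zero =>
    intro z
    by_cases hz : z + g = 0
    · exact base 0 z hz
    · have : Pr 0 (NoHit (z + g)) = 1 := Pr_true 0 fun u hu t ht => by
        rw [List.length_eq_zero_iff] at hu; subst hu; simpa using fun h => hz h.symm
      rw [this]
      linarith [Pr_le_one (0 + n₂) (NotRead z g), Pr_nonneg n₂ (NotRead (-g) g)]
  | succ n₁ ih =>
    intro z
    by_cases hz : z + g = 0
    · exact base _ z hz
    · rw [show n₁ + 1 + n₂ = (n₁ + n₂) + 1 by ring, Pr_succ, Pr_succ]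
      have key : ∀ c : Bool, Pr (n₁ + n₂) (fun u => NotRead z g (c :: u)) ≤
          Pr n₁ (fun u => NoHit (z + g) (c :: u)) + Pr n₂ (NotRead (-g) g) := by
        intro c
        have h1 : Pr (n₁ + n₂) (fun u => NotRead z g (c :: u)) ≤
            Pr (n₁ + n₂) (NotRead (z - sg c) g) := Pr_mono _ fun u _ h => h.tail
        have h2 : Pr n₁ (fun u => NoHit (z + g) (c :: u)) = Pr n₁ (NoHit (z - sg c + g)) :=
          Pr_congr _ fun u _ => by
            rw [noHit_cons, show z + g - sg c = z - sg c + g by ring]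
            simp [hz]
        rw [h2]; exact h1.trans (ih _)
      linarith [key true, key false]

/-- A walk of `2 * n` steps is likely to traverse a given interval of length `g` to the right. -/
theorem Pr_notRead_le (n g : ℕ) (hn : 1 ≤ n) (z : ℤ) :
    Pr (n + n) (NotRead z g) ≤ (2 * |(z : ℝ) + g| + 4 * 2 ^ g) / Real.sqrt n := by
  have hn' : (1 : ℝ) ≤ n := by exact_mod_cast hn
  have hs : 0 < Real.sqrt n := Real.sqrt_pos.2 (by linarith)
  have h1 := Pr_notRead_first_hit g n n z
  have h2 := Pr_noHit_le n (z + g)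
  have h3 : 2 * |((z + g : ℤ) : ℝ)| / Real.sqrt (n + 1) ≤ 2 * |(z : ℝ) + g| / Real.sqrt n := by
    push_cast
    gcongr; linarith
  have h4 : Pr n (NotRead (-g) g) ≤ 4 * 2 ^ g / Real.sqrt n := by
    have e := Pr_notRead_last_exit n g
    have e2 := le_sum_Pr_pos_eq_zero n
    have e3 := Pr_nonneg n (NotRead (-g) g)
    have e4 : Real.sqrt n / 4 * ((1 / 2) ^ g * Pr n (NotRead (-g) g)) ≤ 1 :=
      le_trans (mul_le_mul_of_nonneg_right e2 (by positivity)) e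
    rw [le_div_iff₀ hs]
    rw [one_div, inv_pow] at e4
    have e5 : (0 : ℝ) < 2 ^ g := by positivity
    calc Pr n (NotRead (-g) g) * Real.sqrt n
        = 4 * 2 ^ g * (Real.sqrt n / 4 * ((2 ^ g)⁻¹ * Pr n (NotRead (-g) g))) := by
          field_simp
      _ ≤ 4 * 2 ^ g * 1 := by gcongr
      _ = _ := by ring
  rw [add_div]; linarith

theorem Ex_exp_pos (n : ℕ) (l : ℝ) :
    Ex n (fun u => Real.exp (l * pos u)) = Real.cosh l ^ n := by
  induction n with
  | zero => simp [Ex]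
  | succ n ih =>
    have e : ∀ c : Bool, Ex n (fun u => Real.exp (l * pos (c :: u))) =
        Real.exp (l * sg c) * Real.cosh l ^ n := by
      intro c
      rw [← ih, ← Ex_mul_left]
      refine Ex_congr n fun u _ => ?_
      rw [← Real.exp_add, pos_cons]; push_cast; ring_nf
    simp only [Ex]
    rw [e, e, Real.cosh_eq, pow_succ]
    simp [sg]; ring

/-- Chernoff's bound with exponent parameter `A / n` and cosh λ ≤ exp(λ²/2), followed by a union
over times and signs. -/
theorem Pr_exists_abs_pos_gt_le (n A : ℕ) (hn : 1 ≤ n) :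
    Pr n (fun u => ∃ t ≤ n, (A : ℤ) < |pos (u.take t)|) ≤
      2 * (n + 1) * Real.exp (-((A : ℝ) ^ 2 / (2 * n))) := by
  have hn' : (0 : ℝ) < n := by exact_mod_cast hn
  have key : ∀ t ≤ n, Pr n (fun u => (A : ℤ) < pos (u.take t)) ≤
      Real.exp (-((A : ℝ) ^ 2 / (2 * n))) := by
    intro t ht
    have e := Pr_prefix t (n - t) (fun u => (A : ℤ) < pos u)
    rw [show t + (n - t) = n by omega] at e
    rw [e]
    set l : ℝ := A / n with hl
    have hl0 : 0 ≤ l := by positivity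
    have h1 := Pr_ge_le t (fun u => Real.exp (l * pos u)) (fun _ _ => (Real.exp_pos _).le)
      (Real.exp_pos (l * A)) (fun u => (A : ℤ) < pos u) (fun u _ h => by
        apply Real.exp_le_exp.2
        have : (A : ℝ) < pos u := by exact_mod_cast h
        gcongr)
    rw [Ex_exp_pos] at h1
    refine h1.trans ?_
    have h2 : Real.cosh l ^ t ≤ Real.exp (l ^ 2 / 2 * n) := by
      calc Real.cosh l ^ t ≤ Real.exp (l ^ 2 / 2) ^ t := by
            gcongr; exact Real.cosh_le_exp_half_sq l
        _ ≤ Real.exp (l ^ 2 / 2) ^ n := pow_le_pow_right₀ (Real.one_le_exp (by positivity)) ht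
        _ = _ := by rw [← Real.exp_nat_mul]; ring_nf
    rw [div_le_iff₀ (Real.exp_pos _), ← Real.exp_add]
    refine h2.trans (Real.exp_le_exp.2 (le_of_eq ?_))
    rw [hl]; field_simp; ring
  have key2 : ∀ t ≤ n, Pr n (fun u => (A : ℤ) < -pos (u.take t)) ≤
      Real.exp (-((A : ℝ) ^ 2 / (2 * n))) := by
    intro t ht
    rw [← Pr_flip]
    refine le_trans (le_of_eq (Pr_congr n fun u _ => ?_)) (key t ht)
    rw [← List.map_take, pos_map_not, neg_neg]
  calc Pr n (fun u => ∃ t ≤ n, (A : ℤ) < |pos (u.take t)|)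
      ≤ Pr n (fun u => ∃ t ∈ Finset.range (n + 1),
          ((A : ℤ) < pos (u.take t) ∨ (A : ℤ) < -pos (u.take t))) :=
        Pr_mono n fun u _ ⟨t, ht, h⟩ => ⟨t, by simp; omega, lt_abs.1 h⟩
    _ ≤ ∑ t ∈ Finset.range (n + 1), Pr n (fun u =>
          ((A : ℤ) < pos (u.take t) ∨ (A : ℤ) < -pos (u.take t))) := Pr_exists_le n _ _
    _ ≤ ∑ t ∈ Finset.range (n + 1), 2 * Real.exp (-((A : ℝ) ^ 2 / (2 * n))) := by
        refine Finset.sum_le_sum fun t ht => ?_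
        have ht' : t ≤ n := by have := Finset.mem_range.1 ht; omega
        linarith [Pr_or_le n (fun u => (A : ℤ) < pos (u.take t))
          (fun u => (A : ℤ) < -pos (u.take t)), key t ht', key2 t ht']
    _ = _ := by rw [Finset.sum_const, Finset.card_range, nsmul_eq_mul]; push_cast; ring

/-! ### Runs in random words -/

/-- Every run of `g` steps to the right starts in `H`. -/
def RunsIn (g : ℕ) (H : Finset ℤ) (c : ℤ) (w : List Bool) : Prop :=
  ∀ j, j + g ≤ w.length → (w.drop j).take g = List.replicate g true → c + pos (w.take j) ∈ H

theorem RunsIn.left {g : ℕ} {H : Finset ℤ} {c : ℤ} {u v : List Bool}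
    (h : RunsIn g H c (u ++ v)) : RunsIn g H c u := by
  intro j hj hr
  have := h j (by simp; omega)
  rw [List.drop_append_of_le_length (by omega), List.take_append_of_le_length (by simp; omega),
    List.take_append_of_le_length (by omega)] at this
  exact this hr

theorem RunsIn.right {g : ℕ} {H : Finset ℤ} {c : ℤ} {u v : List Bool}
    (h : RunsIn g H c (u ++ v)) : RunsIn g H (c + pos u) v := by
  intro j hj hr
  have := h (u.length + j) (by simp; omega)
  rw [List.drop_length_add_append, List.take_length_add_append, pos_append, ← add_assoc] at this
  exact this hr

theorem sum_inv_sqrt_le (n : ℕ) :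
    ∑ i ∈ Finset.range n, 1 / Real.sqrt (i + 1) ≤ 2 * Real.sqrt n := by
  induction n with
  | zero => simp
  | succ n ih =>
    rw [Finset.sum_range_succ]
    have h1 : 0 < Real.sqrt (n + 1) := Real.sqrt_pos.2 (by positivity)
    have h2 : Real.sqrt n ≤ Real.sqrt (n + 1) := Real.sqrt_le_sqrt (by linarith)
    have h3 : Real.sqrt n * Real.sqrt n = n := Real.mul_self_sqrt (by positivity)
    have h4 : Real.sqrt (n + 1) * Real.sqrt (n + 1) = n + 1 := Real.mul_self_sqrt (by positivity)
    have h5 : 1 / Real.sqrt (n + 1) ≤ 2 * (Real.sqrt (n + 1) - Real.sqrt n) := by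
      rw [div_le_iff₀ h1]; nlinarith [Real.sqrt_nonneg (n : ℝ)]
    push_cast; linarith

/-- The walk is too spread out to start half of its blocks in `H`: the expected number of such
starts is at most 2 |H| √nb, and Markov's inequality applies. -/
theorem Pr_sum_pos_mem_ge_le (g nb : ℕ) (hg : 1 ≤ g) (hnb : 1 ≤ nb) (H : Finset ℤ) (c : ℤ) :
    Pr (nb * g) (fun u => (nb : ℝ) / 2 ≤
      ∑ i ∈ Finset.range nb, ind (c + pos (u.take (i * g)) ∈ H)) ≤
      4 * H.card / Real.sqrt nb := by
  have hnb' : (1 : ℝ) ≤ nb := by exact_mod_cast hnb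
  have hs : 0 < Real.sqrt nb := Real.sqrt_pos.2 (by linarith)
  have h := Pr_ge_le (nb * g) (fun u => ∑ i ∈ Finset.range nb, ind (c + pos (u.take (i * g)) ∈ H))
    (fun u _ => Finset.sum_nonneg fun i _ => ind_nonneg _) (c := nb / 2) (by positivity) _
    (fun u _ h => h)
  refine h.trans ?_
  rw [Ex_sum]
  have h2 : ∑ i ∈ Finset.range nb, Ex (nb * g) (fun u => ind (c + pos (u.take (i * g)) ∈ H)) ≤
      H.card * (2 * Real.sqrt nb) := by
    refine le_trans (Finset.sum_le_sum (g := fun i : ℕ => H.card * (1 / Real.sqrt (i + 1))) ?_) ?_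
    · intro i hi
      have hi' : i ≤ nb := (Finset.mem_range.1 hi).le
      have e := Pr_prefix (i * g) (nb * g - i * g) (fun u => c + pos u ∈ H)
      rw [Nat.add_sub_cancel' (Nat.mul_le_mul_right g hi')] at e
      change Pr (nb * g) _ ≤ _
      rw [e]
      refine (Pr_pos_mem_le _ H c).trans ?_
      rw [mul_one_div]
      have : (i : ℝ) ≤ ((i * g : ℕ) : ℝ) := by exact_mod_cast Nat.le_mul_of_pos_right i hg
      gcongr
    · rw [← Finset.mul_sum]
      gcongr; exact sum_inv_sqrt_le nb
  have h3 : Real.sqrt nb * Real.sqrt nb = nb := Real.mul_self_sqrt (by linarith)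
  rw [div_le_div_iff₀ (by positivity) hs]
  calc _ ≤ H.card * (2 * Real.sqrt nb) * Real.sqrt nb := by gcongr
    _ = 4 * H.card * (nb / 2) := by linear_combination (2 * (H.card : ℝ)) * h3

theorem one_sub_half_pow_le (g k nb : ℕ) (hnb : 6 * 2 ^ g ≤ nb) (hk : (nb : ℝ) / 2 ≤ k) :
    (1 - (1 / 2 : ℝ) ^ g) ^ k ≤ 1 / 8 := by
  have hp : (0 : ℝ) < (1 / 2) ^ g := by positivity
  have hp1 : (1 / 2 : ℝ) ^ g ≤ 1 := pow_le_one₀ (by norm_num) (by norm_num)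
  have h1 : (1 - (1 / 2 : ℝ) ^ g) ≤ Real.exp (-(1 / 2 : ℝ) ^ g) := by
    have := Real.add_one_le_exp (-(1 / 2 : ℝ) ^ g); linarith
  have hnb' : (6 : ℝ) * 2 ^ g ≤ nb := by exact_mod_cast hnb
  have h2 : (3 : ℝ) ≤ k * (1 / 2) ^ g := by
    have : (3 : ℝ) * 2 ^ g ≤ k := by linarith
    rw [one_div, inv_pow, ← div_eq_mul_inv, le_div_iff₀ (by positivity)]; exact this
  calc (1 - (1 / 2 : ℝ) ^ g) ^ k ≤ Real.exp (-(1 / 2 : ℝ) ^ g) ^ k := by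
        gcongr
    _ = Real.exp (-(k * (1 / 2 : ℝ) ^ g)) := by rw [← Real.exp_nat_mul]; ring_nf
    _ ≤ Real.exp (-3) := Real.exp_le_exp.2 (by linarith)
    _ ≤ 1 / 8 := by
      rw [Real.exp_neg, ← one_div]
      apply one_div_le_one_div_of_le (by norm_num)
      have := Real.exp_one_gt_d9
      calc (8 : ℝ) = 2 ^ 3 := by norm_num
        _ ≤ Real.exp 1 ^ 3 := by gcongr; linarith
        _ = Real.exp 3 := by rw [← Real.exp_nat_mul]; norm_num

/-- Either at least half of the blocks start in `H`, or more than half start outside it and must all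
differ from a run. Each alternative has probability at most 1/8; for the second, weights (1 - p)⁻¹
on the outside blocks that are no runs have mean one, and their product is at least 8. -/
theorem Pr_runsIn_le_quarter (g nb : ℕ) (hg : 1 ≤ g) (hnb : 6 * 2 ^ g ≤ nb) (H : Finset ℤ)
    (hH : 64 * (H.card : ℝ) ≤ Real.sqrt nb) (c : ℤ) :
    Pr (nb * g) (RunsIn g H c) ≤ 1 / 4 := by
  classical
  have hnb1 : 1 ≤ nb := le_trans (by have := Nat.one_le_two_pow (n := g); omega) hnb
  have hs : 0 < Real.sqrt nb := Real.sqrt_pos.2 (by exact_mod_cast hnb1)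
  set p : ℝ := (1 / 2) ^ g with hp
  have hp0 : 0 < p := by positivity
  have hp1 : p < 1 := pow_lt_one₀ (by norm_num) (by norm_num) (by omega)
  set φ : List Bool → ℝ := fun w => ind (w ≠ List.replicate g true) * (1 - p)⁻¹ with hφ
  set tr : List Bool → Prop := fun u => c + pos u ∉ H with htr
  have hφ1 : Ex g φ ≤ 1 := by
    have : Ex g φ = (1 - p)⁻¹ * Pr g (fun w => ¬ w = List.replicate g true) := by
      unfold Pr; rw [← Ex_mul_left]; exact Ex_congr g fun u _ => mul_comm _ _
    rw [this, Pr_not, Pr_eq g _ (by simp), inv_mul_cancel₀ (by linarith)]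
  have htrial := Ex_prod_blocks_le_one g tr φ
    (fun w => mul_nonneg (ind_nonneg _) (inv_nonneg.2 (by linarith))) hφ1 nb
  have hA : Pr (nb * g) (fun u => RunsIn g H c u ∧ ¬ (nb : ℝ) / 2 ≤
      ∑ i ∈ Finset.range nb, ind (c + pos (u.take (i * g)) ∈ H)) ≤ 1 / 8 := by
    refine (Pr_ge_le (nb * g) _ ?_ (c := 8) (by norm_num) _ ?_).trans
      (div_le_div_of_nonneg_right htrial (by norm_num))
    · intro u _
      exact Finset.prod_nonneg fun i _ => add_nonneg (mul_nonneg (ind_nonneg _)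
        (mul_nonneg (ind_nonneg _) (inv_nonneg.2 (by linarith)))) (sub_nonneg.2 (ind_le_one _))
    · rintro u hu ⟨hr, hc⟩
      have e1 : ∀ i ∈ Finset.range nb, (ind (tr (u.take (i * g))) *
          φ ((u.drop (i * g)).take g) + (1 - ind (tr (u.take (i * g))))) =
          if tr (u.take (i * g)) then (1 - p)⁻¹ else 1 := by
        intro i hi
        split_ifs with h
        · have hne : (u.drop (i * g)).take g ≠ List.replicate g true := by
            intro he
            refine h (hr (i * g) ?_ he)
            have := Nat.mul_le_mul_right g (Finset.mem_range.1 hi)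
            rw [Nat.succ_mul] at this; omega
          simp [hφ, ind_of_true h, ind_of_true hne]
        · simp [ind_of_false h]
      rw [Finset.prod_congr rfl e1, Finset.prod_ite, Finset.prod_const_one, mul_one,
        Finset.prod_const, inv_pow, ← one_div]
      set k := (Finset.filter (fun i => tr (u.take (i * g))) (Finset.range nb)).card with hk
      have hk2 : (nb : ℝ) / 2 ≤ k := by
        rw [sum_ind_eq_card] at hc
        have := Finset.card_filter_add_card_filter_not (s := Finset.range nb)
          (fun i => c + pos (u.take (i * g)) ∈ H)
        rw [Finset.card_range] at this
        have h2 : ((Finset.filter (fun i => c + pos (u.take (i * g)) ∈ H)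
          (Finset.range nb)).card : ℝ) + k = nb := by rw [hk]; exact_mod_cast this
        push Not at hc
        linarith
      have := one_sub_half_pow_le g k nb hnb hk2
      have hpos : 0 < (1 - p) ^ k := pow_pos (by linarith) _
      rw [le_div_iff₀ hpos]; rw [← hp] at this; linarith
  have hB := Pr_sum_pos_mem_ge_le g nb hg hnb1 H c
  have hC : 4 * (H.card : ℝ) / Real.sqrt nb ≤ 1 / 8 := by
    rw [div_le_iff₀ hs]; linarith
  have := Pr_le_add (nb * g) (p := RunsIn g H c) (q := fun u => RunsIn g H c u ∧ ¬ (nb : ℝ) / 2 ≤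
      ∑ i ∈ Finset.range nb, ind (c + pos (u.take (i * g)) ∈ H)) (r := fun u => (nb : ℝ) / 2 ≤
      ∑ i ∈ Finset.range nb, ind (c + pos (u.take (i * g)) ∈ H)) (fun u _ h => by tauto)
  linarith

/-- The bound 1/4 is uniform in the starting height, so the Markov property lets it be iterated over
`r` rounds. -/
theorem Pr_runsIn_le (g nb : ℕ) (hg : 1 ≤ g) (hnb : 6 * 2 ^ g ≤ nb) (H : Finset ℤ)
    (hH : 64 * (H.card : ℝ) ≤ Real.sqrt nb) :
    ∀ (r : ℕ) (c : ℤ), Pr (r * (nb * g)) (RunsIn g H c) ≤ (1 / 4) ^ r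
  | 0, c => by simpa using Pr_le_one _ _
  | r + 1, c => by
    rw [show (r + 1) * (nb * g) = nb * g + r * (nb * g) by ring, Pr_append]
    calc _ ≤ Ex (nb * g) (fun u => (1 / 4) ^ r * ind (RunsIn g H c u)) := by
          refine Ex_mono _ fun u _ => ?_
          by_cases h : RunsIn g H c u
          · rw [ind_of_true h, mul_one]
            refine le_trans (Pr_mono _ fun v _ hv => ?_)
              (Pr_runsIn_le g nb hg hnb H hH r (c + pos u))
            exact RunsIn.right hv
          · rw [Pr_false]
            · exact mul_nonneg (by positivity) (ind_nonneg _)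
            · intro v _ hv; exact h hv.left
      _ = (1 / 4) ^ r * Pr (nb * g) (RunsIn g H c) := Ex_mul_left _ _ _
      _ ≤ (1 / 4) ^ r * (1 / 4) := by
          gcongr; exact Pr_runsIn_le_quarter g nb hg hnb H hH c
      _ = _ := by ring

/-- The number of those blocks of length `g` that are equal to `a`. -/
theorem Pr_count_blocks_ge_le (g N k : ℕ) (a : List Bool) (ha : a.length = g) :
    Pr (N * g) (fun u => (k : ℝ) ≤ ∑ i ∈ Finset.range N, ind ((u.drop (i * g)).take g = a)) ≤
      (1 + (1 / 2) ^ g) ^ N / 2 ^ k := by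
  classical
  set p : ℝ := (1 / 2) ^ g with hp
  have hp0 : 0 < p := by positivity
  -- A block equal to `a` doubles the weight, and (1 + p)⁻¹ normalises the mean to one.
  set φ : List Bool → ℝ := fun w => (1 + ind (w = a)) * (1 + p)⁻¹ with hφ
  have hφ0 : ∀ w, 0 ≤ φ w := fun w =>
    mul_nonneg (add_nonneg zero_le_one (ind_nonneg _)) (inv_nonneg.2 (by linarith))
  have hφ1 : Ex g φ ≤ 1 := by
    have : Ex g φ = (1 + p)⁻¹ * (1 + Pr g (fun w => w = a)) := by
      unfold Pr
      rw [← Ex_const g 1, ← Ex_add, ← Ex_mul_left, Ex_const]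
      exact Ex_congr g fun u _ => mul_comm _ _
    rw [this, Pr_eq g _ ha, inv_mul_cancel₀ (by linarith)]
  have htrial := Ex_prod_blocks_le_one g (fun _ => True) φ hφ0 hφ1 N
  refine (Pr_ge_le (N * g) _ ?_ (c := 2 ^ k / (1 + p) ^ N) (by positivity) _ ?_).trans
    ((div_le_div_of_nonneg_right htrial (by positivity)).trans (by rw [one_div_div]))
  · intro u _
    exact Finset.prod_nonneg fun i _ => add_nonneg (mul_nonneg (ind_nonneg _) (hφ0 _))
      (sub_nonneg.2 (ind_le_one _))
  · intro u hu hk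
    have e1 : ∀ i ∈ Finset.range N, (ind True * φ ((u.drop (i * g)).take g) + (1 - ind True)) =
        (if (u.drop (i * g)).take g = a then 2 else 1) * (1 + p)⁻¹ := by
      intro i _
      rw [ind_of_true trivial]
      simp only [hφ, ind]
      split_ifs <;> norm_num
    rw [Finset.prod_congr rfl e1, Finset.prod_mul_distrib, Finset.prod_const, Finset.card_range,
      Finset.prod_ite, Finset.prod_const, Finset.prod_const_one, mul_one, inv_pow, div_eq_mul_inv]
    rw [sum_ind_eq_card] at hk
    gcongr
    · norm_num
    · exact_mod_cast hk

/-- The walk avoids reading all marked runs if each window of `n` steps is likely to read one. -/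
theorem Pr_notRead_all_le (g n : ℕ) (good : ℤ → Prop) : ∀ (J : ℕ) (x : ℤ),
    (∀ x', |x' - x| ≤ J * n → ∃ z, good z ∧ Pr n (NotRead (z - x') g) ≤ 1 / 2) →
    Pr (J * n) (fun v => ∀ z, good z → NotRead (z - x) g v) ≤ (1 / 2) ^ J
  | 0, x, _ => by simpa using Pr_le_one _ _
  | J + 1, x, h => by
    obtain ⟨z, hz, hp⟩ := h x (by rw [sub_self, abs_zero]; positivity)
    rw [show (J + 1) * n = n + J * n by ring, Pr_append]
    calc _ ≤ Ex n (fun u => (1 / 2) ^ J * ind (NotRead (z - x) g u)) := by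
          refine Ex_mono _ fun u hu => ?_
          by_cases hr : NotRead (z - x) g u
          · rw [ind_of_true hr, mul_one]
            have ih := Pr_notRead_all_le g n good J (x + pos u) (fun x' hx' => h x' ?_)
            · refine le_trans (Pr_mono _ fun v _ hv z hz => ?_) ih
              intro t ht hpz hrun
              refine hv z hz (u.length + t) (by simp; omega) ?_ ?_
              · rw [List.take_length_add_append, pos_append, hpz]; ring
              · rw [List.drop_length_add_append]; exact hrun
            · have h1 := abs_pos_le u
              have h2 := abs_add_le (x' - (x + pos u)) (pos u)
              rw [show x' - (x + pos u) + pos u = x' - x by ring] at h2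
              rw [hu] at h1
              push_cast; linarith
          · rw [Pr_false]
            · exact mul_nonneg (by positivity) (ind_nonneg _)
            · intro v _ hv
              apply hr
              have := (hv z hz).take n
              rwa [List.take_left' hu] at this
      _ = (1 / 2) ^ J * Pr n (NotRead (z - x) g) := Ex_mul_left _ _ _
      _ ≤ (1 / 2) ^ J * (1 / 2) := by gcongr
      _ = _ := by ring

/-! ### The level function and its runs -/

theorem sg_eq_one {c : Bool} : sg c = 1 ↔ c = true := by cases c <;> simp [sg]

/-- Whether the colors at the ends of the edge to the right of a site of the parity of `p` are
compatible with an upward step of the level. -/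
def edgeBit (p : ℤ) (c c' : Bool) : Bool := decide (Even p) == (c == c')

theorem edgeBit_congr {p q : ℤ} (h : Even p ↔ Even q) (c c' : Bool) :
    edgeBit p c c' = edgeBit q c c' := by simp [edgeBit, h]

/-- This antisymmetry makes the level a function of the site and not of the path: an edge crossed
backwards, from an end of the other parity, gives the opposite step. -/
theorem edgeBit_sub_one (p : ℤ) (c c' : Bool) : edgeBit (p - 1) c' c = !edgeBit p c c' := by
  unfold edgeBit
  have : Even (p - 1) ↔ ¬ Even p := by rw [Int.even_sub]; simp
  by_cases h : Even p <;> cases c <;> cases c' <;> simp [this, h]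

theorem edgeBit_not (p : ℤ) (c c' : Bool) : edgeBit p c (!c') = !edgeBit p c c' := by
  unfold edgeBit; cases decide (Even p) <;> cases c <;> cases c' <;> rfl

/-- The edge bits of a word of colors, the first site having the parity of `q`. -/
def edgeBits (q : ℤ) (w : ℕ → Bool) (n : ℕ) : List Bool :=
  (List.range n).map fun k : ℕ => edgeBit (q + k) (w k) (w (k + 1))

@[simp] theorem length_edgeBits (q : ℤ) (w : ℕ → Bool) (n : ℕ) : (edgeBits q w n).length = n := by
  simp [edgeBits]

theorem edgeBits_zero (q : ℤ) (w : ℕ → Bool) : edgeBits q w 0 = [] := rfl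

theorem edgeBits_succ (q : ℤ) (w : ℕ → Bool) (n : ℕ) :
    edgeBits q w (n + 1) = edgeBits q w n ++ [edgeBit (q + n) (w n) (w (n + 1))] := by
  simp [edgeBits, List.range_succ]

theorem edgeBits_cons (q : ℤ) (w : ℕ → Bool) (n : ℕ) :
    edgeBits q w (n + 1) = edgeBit q (w 0) (w 1) :: edgeBits (q + 1) (fun k => w (k + 1)) n := by
  simp only [edgeBits, List.range_succ_eq_map, List.map_cons, List.map_map]
  congr 1
  · simp
  · refine List.map_congr_left fun k _ => ?_
    simp only [Function.comp]
    push_cast; congr 1; ring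

theorem edgeBits_congr {q : ℤ} {w w' : ℕ → Bool} {n : ℕ} (h : ∀ k ≤ n, w k = w' k) :
    edgeBits q w n = edgeBits q w' n := by
  refine List.map_congr_left fun k hk => ?_
  have hk' := List.mem_range.1 hk
  rw [h k (by omega), h (k + 1) (by omega)]

theorem take_edgeBits (q : ℤ) (w : ℕ → Bool) {j n : ℕ} (h : j ≤ n) :
    (edgeBits q w n).take j = edgeBits q w j := by
  unfold edgeBits
  rw [← List.map_take, List.take_range, min_eq_left h]

theorem take_drop_edgeBits (q : ℤ) (w : ℕ → Bool) {s g n : ℕ} (h : s + g ≤ n) :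
    ((edgeBits q w n).drop s).take g = edgeBits (q + s) (fun k => w (s + k)) g := by
  apply List.ext_getElem
  · simp; omega
  · intro k h1 h2
    simp [edgeBits, add_assoc]

theorem edgeBits_eq_replicate {q : ℤ} {w : ℕ → Bool} {g : ℕ} {b : Bool} :
    edgeBits q w g = List.replicate g b ↔ ∀ k < g, edgeBit (q + k) (w k) (w (k + 1)) = b := by
  rw [List.eq_replicate_iff]; simp [edgeBits]

/-- Once the first colour is fixed, each new colour and its edge bit determine each other, so
colours and edge bits are in bijection. -/
theorem Ex_edgeBits_aux : ∀ (n : ℕ) (q : ℤ) (c : Bool) (f : List Bool → ℝ),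
    Ex n (fun v => f (edgeBits q (fun k => (c :: v).getD k false) n)) = Ex n f
  | 0, q, c, f => rfl
  | n + 1, q, c, f => by
    have key : ∀ d : Bool, Ex n (fun v => f (edgeBits q (fun k => (c :: d :: v).getD k false)
        (n + 1))) = Ex n (fun v => f (edgeBit q c d :: v)) := by
      intro d
      rw [← Ex_edgeBits_aux n (q + 1) d (fun v => f (edgeBit q c d :: v))]
      refine Ex_congr n fun v _ => ?_
      rw [edgeBits_cons]; simp
    simp only [Ex]
    rw [key, key]
    have : edgeBit q c true = !edgeBit q c false := edgeBit_not q c false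
    rw [this]
    cases edgeBit q c false
    · rfl
    · rw [add_comm]; rfl

/-- The edge bits of random colors are random bits. -/
theorem Ex_edgeBits (n : ℕ) (q : ℤ) (f : List Bool → ℝ) :
    Ex (n + 1) (fun v => f (edgeBits q (fun k => v.getD k false) n)) = Ex n f := by
  simp only [Ex]
  rw [Ex_edgeBits_aux, Ex_edgeBits_aux]; ring

/-- The level function of a scenery: a two-sided walk whose steps are the edge bits. -/
noncomputable def level (ξ : ℤ → Bool) (x : ℤ) : ℤ :=
  ∑ i ∈ Finset.Ico 0 x, sg (edgeBit i (ξ i) (ξ (i + 1))) -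
    ∑ i ∈ Finset.Ico x 0, sg (edgeBit i (ξ i) (ξ (i + 1)))

@[simp] theorem level_zero (ξ : ℤ → Bool) : level ξ 0 = 0 := by simp [level]

theorem level_add_one (ξ : ℤ → Bool) (x : ℤ) :
    level ξ (x + 1) = level ξ x + sg (edgeBit x (ξ x) (ξ (x + 1))) := by
  unfold level
  rcases le_or_gt 0 x with h | h
  · rw [← Finset.sum_Ico_add_eq_sum_Ico_add_one h, Finset.Ico_eq_empty_of_le h,
      Finset.Ico_eq_empty_of_le (by omega : (0 : ℤ) ≤ x + 1)]
    simp
  · rw [← Finset.insert_Ico_add_one_left_eq_Ico h, Finset.sum_insert (by simp),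
      Finset.Ico_eq_empty_of_le h.le, Finset.Ico_eq_empty_of_le (by omega : x + 1 ≤ (0 : ℤ))]
    simp

theorem level_add_sg (ξ : ℤ → Bool) (x : ℤ) (c : Bool) :
    level ξ (x + sg c) = level ξ x + sg (edgeBit x (ξ x) (ξ (x + sg c))) := by
  cases c
  · have h := level_add_one ξ (x - 1)
    rw [sub_add_cancel, edgeBit_sub_one, sg_not] at h
    simp only [sg, Bool.false_eq_true, if_false, ← sub_eq_add_neg] at h ⊢
    linarith
  · exact level_add_one ξ x

/-- The position after `t` steps. -/
abbrev stp (u : List Bool) (t : ℕ) : ℤ := pos (u.take t)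

theorem stp_succ (u : List Bool) (t : ℕ) (h : t < u.length) :
    stp u (t + 1) = stp u t + sg u[t] := by
  unfold stp
  rw [List.take_succ_eq_append_getElem h, pos_append]; simp

theorem stp_add (u : List Bool) (s t : ℕ) : stp u (s + t) = stp u s + stp (u.drop s) t := by
  unfold stp
  rw [take_take_add, pos_append]

theorem stp_parity (u : List Bool) (t : ℕ) (h : t ≤ u.length) : Even (stp u t) ↔ Even (t : ℤ) := by
  unfold stp
  rw [pos_parity, List.length_take, min_eq_left h]; simp

theorem abs_stp_le (u : List Bool) (t : ℕ) : |stp u t| ≤ t := by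
  refine (abs_pos_le _).trans ?_
  rw [List.length_take]; exact_mod_cast min_le_left _ _

/-- Parity enters here: after `t` steps from `y` the site has the parity of `y + t`, so the level
step depends only on the time and on two consecutive observed colours. -/
theorem level_stp_succ (ξ : ℤ → Bool) (u : List Bool) (y : ℤ) (t : ℕ) (h : t < u.length) :
    level ξ (y + stp u (t + 1)) = level ξ (y + stp u t) +
      sg (edgeBit (y + t) (ξ (y + stp u t)) (ξ (y + stp u (t + 1)))) := by
  rw [stp_succ u t h, ← add_assoc, level_add_sg]
  congr 2
  refine edgeBit_congr ?_ _ _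
  rw [Int.even_add, Int.even_add, stp_parity u t h.le]

theorem level_stp (ξ : ℤ → Bool) (u : List Bool) (y : ℤ) (t : ℕ) (h : t ≤ u.length) :
    level ξ (y + stp u t) = level ξ y + pos (edgeBits y (fun k => ξ (y + stp u k)) t) := by
  induction t with
  | zero => simp [edgeBits_zero, stp]
  | succ t ih =>
    rw [level_stp_succ ξ u y t h, ih (by omega), edgeBits_succ]
    simp; ring

theorem level_add_nat (ξ : ℤ → Bool) (p : ℤ) (n : ℕ) :
    level ξ (p + n) = level ξ p + pos (edgeBits p (fun k => ξ (p + k)) n) := by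
  induction n with
  | zero => simp [edgeBits_zero]
  | succ n ih =>
    rw [edgeBits_succ, pos_append]
    push_cast
    rw [← add_assoc, level_add_one, ih]
    simp [add_assoc]

theorem abs_level_sub_le (ξ : ℤ → Bool) (x y : ℤ) : |level ξ x - level ξ y| ≤ |x - y| := by
  have key : ∀ (p : ℤ) (n : ℕ), |level ξ (p + n) - level ξ p| ≤ n := by
    intro p n
    rw [level_add_nat, add_sub_cancel_left]
    have := abs_pos_le (edgeBits p (fun k => ξ (p + k)) n)
    rwa [length_edgeBits] at this
  rcases le_total y x with h | h
  · have := key y (x - y).toNat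
    rw [Int.toNat_of_nonneg (by omega), add_sub_cancel] at this
    rwa [abs_of_nonneg (by omega : 0 ≤ x - y)]
  · have := key x (y - x).toNat
    rw [Int.toNat_of_nonneg (by omega), add_sub_cancel] at this
    rw [abs_sub_comm, abs_sub_comm x, abs_of_nonneg (by omega : 0 ≤ y - x)]
    exact this

/-- The level increases by one with each of `g` steps from `z` in the direction `β`. -/
def SiteRun (g : ℕ) (ξ : ℤ → Bool) (z : ℤ) (β : Bool) : Prop :=
  ∀ k : ℕ, k ≤ g → level ξ (z + sg β * k) = level ξ z + k

theorem stp_replicate (n : ℕ) (β : Bool) (k : ℕ) (h : k ≤ n) :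
    stp (List.replicate n β) k = sg β * k := by
  unfold stp
  rw [List.take_replicate, min_eq_left h, pos, List.map_replicate, List.sum_replicate]
  simp [mul_comm]

theorem stp_take (u : List Bool) (g k : ℕ) (h : k ≤ g) : stp (u.take g) k = stp u k := by
  unfold stp; rw [List.take_take, min_eq_left h]

/-- An upward run of the levels along a path forces the path to be straight. -/
theorem straight_of_run (g : ℕ) (ξ : ℤ → Bool) (u : List Bool) (z : ℤ) (hu : g ≤ u.length)
    (h : ∀ k ≤ g, level ξ (z + stp u k) = level ξ z + k) :
    ∃ β, u.take g = List.replicate g β := by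
  rcases Nat.eq_zero_or_pos g with rfl | hg
  · exact ⟨true, by simp⟩
  refine ⟨u[0], ?_⟩
  have key : ∀ k (hk : k < g), u[k]'(by omega) = u[0] := by
    intro k
    induction k with
    | zero => intro _; rfl
    | succ k ih =>
      intro hk
      rw [← ih (by omega)]
      -- If the path turned here it would be back at the same site two steps later, where the level
      -- should have risen by two.
      by_contra hne
      have e1 := stp_succ u k (by omega)
      have e2 := stp_succ u (k + 1) (by omega)
      have h3 : stp u (k + 1 + 1) = stp u k := by
        rw [e2, e1]
        have : sg (u[k + 1]'(by omega)) = - sg (u[k]'(by omega)) := by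
          rw [← sg_not]; congr 1
          cases h1 : u[k + 1]'(by omega) <;> cases h2 : u[k]'(by omega) <;> simp_all
        rw [this]; ring
      have h4 := h k (by omega)
      have h5 := h (k + 1 + 1) (by omega)
      rw [h3, h4] at h5
      push_cast at h5; omega
  apply List.ext_getElem
  · simp; omega
  · intro k h1 h2
    simp at h1 h2 ⊢
    exact key k h2

/-- The levels of the word `χ` (with the parity of `q` at time `0`) go up for `g` steps after
time `s`. -/
def UpRun (q : ℤ) (g : ℕ) (χ : ℕ → Bool) (s : ℕ) : Prop :=
  ∀ k < g, edgeBit (q + (s + k : ℕ)) (χ (s + k)) (χ (s + k + 1)) = true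

theorem upRun_iff_edgeBits (q : ℤ) (g : ℕ) (χ : ℕ → Bool) (s n : ℕ) (h : s + g ≤ n) :
    UpRun q g χ s ↔ ((edgeBits q χ n).drop s).take g = List.replicate g true := by
  rw [take_drop_edgeBits q χ h, edgeBits_eq_replicate]
  unfold UpRun
  refine forall_congr' fun k => forall_congr' fun _ => ?_
  push_cast; rw [← add_assoc, add_assoc s k 1]

theorem level_of_upRun (g : ℕ) (ξ : ℤ → Bool) (u : List Bool) (y : ℤ) (s : ℕ)
    (hs : s + g ≤ u.length) :
    UpRun y g (fun k => ξ (y + stp u k)) s ↔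
      ∀ k ≤ g, level ξ (y + stp u (s + k)) = level ξ (y + stp u s) + k := by
  constructor
  · intro h k
    induction k with
    | zero => simp
    | succ k ih =>
      intro hk
      have := level_stp_succ ξ u y (s + k) (by omega)
      rw [← add_assoc, this, ih (by omega), sg_eq_one.2 (h k (by omega))]
      push_cast; ring
  · intro h k hk
    have h1 := level_stp_succ ξ u y (s + k) (by omega)
    have h2 := h k (by omega)
    have h3 := h (k + 1) (by omega)
    rw [← add_assoc, h1, h2] at h3
    push_cast at h3
    apply sg_eq_one.1
    push_cast; linarith

/-- An upward run of the color record comes from a straight passage over a run of the scenery. -/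
theorem siteRun_of_upRun (g : ℕ) (ξ : ℤ → Bool) (u : List Bool) (y : ℤ) (s : ℕ)
    (hs : s + g ≤ u.length) (h : UpRun y g (fun k => ξ (y + stp u k)) s) :
    ∃ β, (u.drop s).take g = List.replicate g β ∧ SiteRun g ξ (y + stp u s) β := by
  rw [level_of_upRun g ξ u y s hs] at h
  have h' : ∀ k ≤ g, level ξ (y + stp u s + stp (u.drop s) k) = level ξ (y + stp u s) + k := by
    intro k hk
    rw [← h k hk, stp_add, add_assoc]
  obtain ⟨β, hβ⟩ := straight_of_run g ξ (u.drop s) (y + stp u s) (by simp; omega) h'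
  refine ⟨β, hβ, fun k hk => ?_⟩
  rw [← h' k hk, ← stp_take _ g k hk, hβ, stp_replicate g β k hk]

theorem upRun_of_siteRun (g : ℕ) (ξ : ℤ → Bool) (u : List Bool) (y : ℤ) (s : ℕ) (β : Bool)
    (hs : s + g ≤ u.length) (hβ : (u.drop s).take g = List.replicate g β)
    (h : SiteRun g ξ (y + stp u s) β) : UpRun y g (fun k => ξ (y + stp u k)) s := by
  rw [level_of_upRun g ξ u y s hs]
  intro k hk
  rw [← h k hk, stp_add, ← stp_take _ g k hk, hβ, stp_replicate g β k hk, add_assoc]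

/-! ### Finite sceneries and resampling of a window -/

/-- The scenery `ξ` with the colors from `p` on replaced by `w`. -/
def overwrite (ξ : ℤ → Bool) (p : ℤ) (w : List Bool) (x : ℤ) : Bool :=
  if p ≤ x ∧ x < p + w.length then w.getD (x - p).toNat false else ξ x

theorem overwrite_of_not {ξ : ℤ → Bool} {p : ℤ} {w : List Bool} {x : ℤ}
    (h : ¬ (p ≤ x ∧ x < p + w.length)) : overwrite ξ p w x = ξ x := if_neg h

theorem overwrite_add {ξ : ℤ → Bool} {p : ℤ} {w : List Bool} {k : ℕ} (h : k < w.length) :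
    overwrite ξ p w (p + k) = w.getD k false := by
  unfold overwrite
  rw [if_pos ⟨by omega, by omega⟩, add_sub_cancel_left, Int.toNat_natCast]

theorem overwrite_overwrite (ξ : ℤ → Bool) (p : ℤ) (u v v' w : List Bool)
    (h : v.length = v'.length) :
    overwrite (overwrite ξ p (u ++ (v' ++ w))) (p + u.length) v =
      overwrite ξ p (u ++ (v ++ w)) := by
  funext x
  unfold overwrite
  simp only [List.length_append, Nat.cast_add, h]
  by_cases h1 : p ≤ x ∧ x < p + (u.length + (v'.length + w.length))
  · obtain ⟨k, rfl⟩ : ∃ k : ℕ, x = p + k := ⟨(x - p).toNat, by omega⟩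
    simp only [if_pos h1, add_sub_cancel_left, Int.toNat_natCast]
    split_ifs with h2
    · have : (p + (k : ℤ) - (p + u.length)).toNat = k - u.length := by omega
      rw [this, List.getD_append_right _ _ _ _ (by omega),
        List.getD_append _ _ _ _ (by omega)]
    · rcases Nat.lt_or_ge k u.length with h3 | h3
      · rw [List.getD_append _ _ _ _ h3, List.getD_append _ _ _ _ h3]
      · rw [List.getD_append_right _ _ _ _ h3, List.getD_append_right _ _ _ _ h3,
          List.getD_append_right _ _ _ _ (by omega), List.getD_append_right _ _ _ _ (by omega), h]
  · rw [if_neg h1, if_neg h1, if_neg (by omega)]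

/-- The scenery with the colors `w` on `[-N, N]`. -/
def colorOf (N : ℕ) (w : List Bool) : ℤ → Bool := overwrite (fun _ => false) (-N) w

/-- The average over all colorings of `[-N, N]`. -/
noncomputable def ExS (N : ℕ) (F : (ℤ → Bool) → ℝ) : ℝ := Ex (2 * N + 1) fun w => F (colorOf N w)

theorem ExS_mono (N : ℕ) {F G : (ℤ → Bool) → ℝ} (h : ∀ ξ, F ξ ≤ G ξ) : ExS N F ≤ ExS N G :=
  Ex_mono _ fun _ _ => h _

theorem ExS_add (N : ℕ) (F G : (ℤ → Bool) → ℝ) :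
    ExS N (fun ξ => F ξ + G ξ) = ExS N F + ExS N G := Ex_add _ _ _

theorem ExS_mul_left (N : ℕ) (c : ℝ) (F : (ℤ → Bool) → ℝ) :
    ExS N (fun ξ => c * F ξ) = c * ExS N F := Ex_mul_left _ _ _

theorem ExS_sum {ι : Type*} (N : ℕ) (s : Finset ι) (F : ι → (ℤ → Bool) → ℝ) :
    ExS N (fun ξ => ∑ i ∈ s, F i ξ) = ∑ i ∈ s, ExS N (F i) :=
  Ex_sum _ s (fun i w => F i (colorOf N w))

theorem ExS_le_const (N : ℕ) {F : (ℤ → Bool) → ℝ} {c : ℝ} (h : ∀ ξ, F ξ ≤ c) : ExS N F ≤ c :=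
  Ex_le_const _ fun _ _ => h _

theorem ExS_Ex_comm (N n : ℕ) (F : (ℤ → Bool) → List Bool → ℝ) :
    ExS N (fun ξ => Ex n (F ξ)) = Ex n (fun u => ExS N (fun ξ => F ξ u)) :=
  Ex_comm _ _ _

/-- It is enough to average over the colors in a window, for all colors outside. -/
theorem ExS_le_of_window (N n : ℕ) (p : ℤ) (h1 : -(N : ℤ) ≤ p) (h2 : p + n ≤ N + 1)
    (F : (ℤ → Bool) → ℝ) (c : ℝ) (h : ∀ ξ, Ex n (fun w => F (overwrite ξ p w)) ≤ c) :
    ExS N F ≤ c := by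
  unfold ExS
  obtain ⟨a, ha⟩ : ∃ a : ℕ, p = -(N : ℤ) + a := ⟨(p + N).toNat, by omega⟩
  rw [show 2 * N + 1 = a + (n + (2 * N + 1 - a - n)) by omega, Ex_append]
  refine Ex_le_const _ fun u hu => ?_
  rw [Ex_append, Ex_comm]
  refine Ex_le_const _ fun v hv => ?_
  refine le_trans (le_of_eq (Ex_congr n fun w hw => ?_))
    (h (colorOf N (u ++ (List.replicate n false ++ v))))
  unfold colorOf
  rw [ha, ← hu, overwrite_overwrite _ _ u w (List.replicate n false) v (by simp [hw])]

/-- Averaging over the edge bits of a window of `n + 1` colors. -/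
theorem Pr_overwrite_edgeBits_le (n : ℕ) (q p : ℤ) (ξ : ℤ → Bool) (bad : (ℤ → Bool) → Prop)
    (R : List Bool → Prop) (c : ℝ) (hR : Pr n R ≤ c)
    (h : ∀ w : List Bool, w.length = n + 1 → bad (overwrite ξ p w) →
      R (edgeBits q (fun k => overwrite ξ p w (p + k)) n)) :
    Ex (n + 1) (fun w => ind (bad (overwrite ξ p w))) ≤ c := by
  refine le_trans ?_ hR
  unfold Pr
  rw [← Ex_edgeBits n q]
  refine Ex_mono _ fun w hw => ind_mono fun hb => ?_
  have := h w hw hb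
  rwa [edgeBits_congr (w' := fun k => w.getD k false)] at this
  intro k hk
  exact overwrite_add (by omega)

/-! ### Two walks with the same record -/

/-- The number of times `(i + 1) * T`, `i ∈ A`, that the walk spends at `y`. -/
noncomputable def visits (A : Finset ℕ) (T : ℕ) (u : List Bool) (y : ℤ) : ℕ :=
  (A.filter fun i => stp u ((i + 1) * T) = y).card

/-- The number of times `(i + 1) * T`, `i ∈ A`, at which the walk is in `y` and then makes the
steps `τ`. -/
noncomputable def visitsThen (A : Finset ℕ) (T : ℕ) (u : List Bool) (y : ℤ) (τ : List Bool) : ℕ :=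
  (A.filter fun i => stp u ((i + 1) * T) = y ∧ (u.drop ((i + 1) * T)).take τ.length = τ).card

/-- Block `i` ends at time `(i + 1) * T`, when its record is complete; the steps after that time are
still fresh. -/
def Localized (A : Finset ℕ) (T M : ℕ) (u : List Bool) : Prop :=
  ∀ i ∈ A, |stp u ((i + 1) * T)| ≤ M

/-- After the visits to a site visited at least `Q` times all continuations of length `W` have a
frequency of at least half of the expected one. -/
def Frequent (A : Finset ℕ) (T W M Q : ℕ) (u : List Bool) : Prop :=
  ∀ y : ℤ, |y| ≤ M → Q ≤ visits A T u y → ∀ τ : List Bool, τ.length = W →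
    visits A T u y ≤ 2 ^ (W + 1) * visitsThen A T u y τ

theorem visits_abs_le {A : Finset ℕ} {T M : ℕ} {u : List Bool} (h : Localized A T M u) {y : ℤ}
    (hy : 0 < visits A T u y) : |y| ≤ M := by
  obtain ⟨i, hi⟩ := Finset.card_pos.1 hy
  rw [Finset.mem_filter] at hi
  rw [← hi.2]; exact h i hi.1

/-- At least a fraction 2^(-(W+1)) of the visits to `y` is followed by `τ`, hence at least (2M+1)
Q^k of them. At those times the other walk has only 2M+1 possible positions, so by pigeonhole it
takes one of them at least Q^k times. -/
theorem exists_continuation {A : Finset ℕ} {T W M Q k : ℕ} {u u' : List Bool}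
    (hQ : 2 ^ (W + 1) * (2 * M + 1) ≤ Q)
    (hl : Localized A T M u) (hf : Frequent A T W M Q u) (hl' : Localized A T M u') {y : ℤ}
    (hy : Q ^ (k + 1) ≤ visits A T u y) (τ : List Bool) (hτ : τ.length = W) :
    ∃ i ∈ A, stp u ((i + 1) * T) = y ∧ (u.drop ((i + 1) * T)).take W = τ ∧
      Q ^ k ≤ visits A T u' (stp u' ((i + 1) * T)) := by
  have hQ0 : 0 < Q := lt_of_lt_of_le (by positivity) hQ
  have hQk : 0 < Q ^ k := pow_pos hQ0 k
  have hQQ : Q ≤ Q ^ (k + 1) := Nat.le_self_pow (by omega) Q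
  have hf' := hf y (visits_abs_le hl (by omega)) (by omega) τ hτ
  have h1 : (2 * M + 1) * Q ^ k ≤ visitsThen A T u y τ := by
    have : 2 ^ (W + 1) * ((2 * M + 1) * Q ^ k) ≤ 2 ^ (W + 1) * visitsThen A T u y τ :=
      calc 2 ^ (W + 1) * ((2 * M + 1) * Q ^ k) = 2 ^ (W + 1) * (2 * M + 1) * Q ^ k := by ring
        _ ≤ Q * Q ^ k := Nat.mul_le_mul_right _ hQ
        _ = Q ^ (k + 1) := by ring
        _ ≤ _ := hy.trans hf'
    exact Nat.le_of_mul_le_mul_left this (by positivity)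
  set B := A.filter fun i => stp u ((i + 1) * T) = y ∧ (u.drop ((i + 1) * T)).take τ.length = τ
    with hB
  have hmaps : ∀ i ∈ B, stp u' ((i + 1) * T) ∈ Finset.Icc (-(M : ℤ)) M := by
    intro i hi
    rw [hB, Finset.mem_filter] at hi
    rw [Finset.mem_Icc]; exact abs_le.1 (hl' i hi.1)
  have hcard : (Finset.Icc (-(M : ℤ)) M).card * Q ^ k ≤ B.card := by
    rw [Int.card_Icc, show ((M : ℤ) + 1 - -(M : ℤ)).toNat = 2 * M + 1 by omega]; exact h1
  obtain ⟨y', -, hy'⟩ := Finset.exists_le_card_fiber_of_mul_le_card_of_maps_to hmaps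
    ⟨0, by simp⟩ hcard
  obtain ⟨i, hi⟩ := Finset.card_pos.1 (lt_of_lt_of_le hQk hy')
  rw [Finset.mem_filter, hB, Finset.mem_filter] at hi
  obtain ⟨⟨hiA, hiy, hiτ⟩, hi'⟩ := hi
  refine ⟨i, hiA, hiy, by rwa [hτ] at hiτ, ?_⟩
  rw [hi']
  refine hy'.trans (Finset.card_le_card ?_)
  intro j hj
  rw [Finset.mem_filter, hB, Finset.mem_filter] at hj
  rw [Finset.mem_filter]; exact ⟨hj.1.1, hj.2⟩

/-- At some selected time the color record continues with the word `ω`, a gap of length `d`, and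
the word `v`, and both walks visit their current positions often at selected times. -/
def Reading (A : Finset ℕ) (T Q n l : ℕ) (u u' : List Bool) (χ ω v : ℕ → Bool) (k d : ℕ) : Prop :=
  ∃ i ∈ A, Q ^ k ≤ visits A T u (stp u ((i + 1) * T)) ∧
    Q ^ k ≤ visits A T u' (stp u' ((i + 1) * T)) ∧
    (∀ j ≤ n, χ ((i + 1) * T + j) = ω j) ∧ ∀ j ≤ l, χ ((i + 1) * T + n + d + j) = v j

theorem Reading.symm {A : Finset ℕ} {T Q n l : ℕ} {u u' : List Bool} {χ ω v : ℕ → Bool} {k d : ℕ}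
    (h : Reading A T Q n l u u' χ ω v k d) : Reading A T Q n l u' u χ ω v k d := by
  obtain ⟨i, h0, h1, h2, h3⟩ := h
  exact ⟨i, h0, h2, h1, h3⟩

theorem stp_drop (u : List Bool) (s t : ℕ) : stp (u.drop s) t = stp u (s + t) - stp u s := by
  rw [stp_add]; ring

/-- A bent passage over the gap can be replaced by a straight one. -/
theorem Reading.shorten {A : Finset ℕ} {T W M Q N n l : ℕ} {u u' : List Bool} {ξ : ℤ → Bool}
    {χ ω v : ℕ → Bool} {k d : ℕ} (hQ : 2 ^ (W + 1) * (2 * M + 1) ≤ Q)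
    (hl : Localized A T M u) (hf : Frequent A T W M Q u) (hl' : Localized A T M u')
    (hχ : ∀ t ≤ N, χ t = ξ (stp u t)) (hu : u.length = N)
    (hA : ∀ i ∈ A, (i + 1) * T + W ≤ N) (hW : n + d + l ≤ W)
    {i : ℕ} (hi : i ∈ A) (hv1 : Q ^ (k + 1) ≤ visits A T u (stp u ((i + 1) * T)))
    (hω : ∀ j ≤ n, χ ((i + 1) * T + j) = ω j)
    (hv : ∀ j ≤ l, χ ((i + 1) * T + n + d + j) = v j)
    (hbent : |stp u ((i + 1) * T + n + d) - stp u ((i + 1) * T + n)| ≠ d) :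
    ∃ d' < d, Reading A T Q n l u u' χ ω v k d' := by
  have hQ0 : 0 < Q := lt_of_lt_of_le (by positivity) hQ
  set t := (i + 1) * T with ht
  have htW := hA i hi
  rw [← ht] at htW
  -- `d'` is the distance covered over the gap and `β` its direction.
  obtain ⟨d', β, hd'⟩ : ∃ (d' : ℕ) (β : Bool), stp u (t + n + d) - stp u (t + n) = sg β * d' := by
    rcases le_total 0 (stp u (t + n + d) - stp u (t + n)) with h | h
    · exact ⟨(stp u (t + n + d) - stp u (t + n)).toNat, true, by simp [sg]; omega⟩
    · exact ⟨(-(stp u (t + n + d) - stp u (t + n))).toNat, false, by simp [sg]; omega⟩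
  have hdd : d' < d := by
    have h1 := stp_drop u (t + n) d
    have h2 := abs_stp_le (u.drop (t + n)) d
    rw [h1] at h2
    rw [hd', abs_mul, sg_abs, one_mul] at h2 hbent
    rw [abs_of_nonneg (by positivity)] at h2 hbent
    omega
  refine ⟨d', hdd, ?_⟩
  set p1 := (u.drop t).take n with hp1
  set p2 := List.replicate d' β with hp2
  set p3 := (u.drop (t + n + d)).take l with hp3
  -- Padding up to length `W`; these steps are never looked at.
  set p4 := List.replicate (W - (n + d' + l)) true with hp4
  have l1 : p1.length = n := by simp [hp1]; omega
  have l2 : p2.length = d' := by simp [hp2]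
  have l3 : p3.length = l := by simp [hp3]; omega
  have l4 : p4.length = W - (n + d' + l) := by simp [hp4]
  -- The spliced path keeps the steps before and after the gap and joins them straight. It reaches
  -- the same sites as before and so reads the same two words.
  obtain ⟨i', hi', hy, hτ, hv'⟩ := exists_continuation hQ hl hf hl' (k := k) hv1
    (p1 ++ (p2 ++ (p3 ++ p4))) (by simp only [List.length_append, l1, l2, l3, l4]; omega)
  refine ⟨i', hi', ?_, hv', ?_, ?_⟩
  · rw [hy]; exact le_trans (Nat.pow_le_pow_right hQ0 (by omega)) hv1
  · intro j hj
    have h1 := hA i' hi'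
    rw [← hω j hj, hχ _ (by omega), hχ _ (by omega), stp_add, hy, stp_add u t j,
      ← stp_take (u.drop ((i' + 1) * T)) W j (by omega), hτ]
    congr 2
    unfold stp
    rw [List.take_append_of_le_length (by omega), hp1, List.take_take, min_eq_left hj]
  · intro j hj
    have h1 := hA i' hi'
    rw [← hv j hj, hχ _ (by omega), hχ _ (by omega), add_assoc, add_assoc, stp_add, hy,
      stp_add u (t + n + d) j, ← stp_take (u.drop ((i' + 1) * T)) W (n + (d' + j)) (by omega), hτ]
    have e : stp (p1 ++ (p2 ++ (p3 ++ p4))) (n + (d' + j)) =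
        pos p1 + (pos p2 + pos (p3.take j)) := by
      unfold stp
      conv_lhs => rw [← l1, List.take_length_add_append, ← l2, List.take_length_add_append,
        List.take_append_of_le_length (by omega)]
      simp
    have e1 : pos p1 = stp u (t + n) - stp u t := stp_drop u t n
    have e2 : pos p2 = sg β * d' := by
      have := stp_replicate d' β d' le_rfl
      unfold stp at this
      rwa [List.take_of_length_le (by simp)] at this
    have e3 : pos (p3.take j) = stp (u.drop (t + n + d)) j := by
      unfold stp; rw [hp3, List.take_take, min_eq_left hj]
    rw [e, e1, e2, e3, ← hd']
    congr 1; ring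

/-- Induction on the gap: while one of the walks is bent over it, the gap shrinks at the cost of one
power of `Q`. Hence `d ≤ k` powers suffice, and a gap of length 0 is straight for both. -/
theorem exists_straight_reading {A : Finset ℕ} {T W M Q N n l : ℕ} {u u' : List Bool}
    {ξ ξ' : ℤ → Bool} {χ ω v : ℕ → Bool} (hQ : 2 ^ (W + 1) * (2 * M + 1) ≤ Q)
    (hl : Localized A T M u) (hf : Frequent A T W M Q u)
    (hl' : Localized A T M u') (hf' : Frequent A T W M Q u')
    (hχ : ∀ t ≤ N, χ t = ξ (stp u t)) (hχ' : ∀ t ≤ N, χ t = ξ' (stp u' t))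
    (hu : u.length = N) (hu' : u'.length = N) (hA : ∀ i ∈ A, (i + 1) * T + W ≤ N) :
    ∀ (d k : ℕ), d ≤ k → n + d + l ≤ W → Reading A T Q n l u u' χ ω v k d →
      ∃ d' ≤ d, ∃ i ∈ A, (∀ j ≤ n, χ ((i + 1) * T + j) = ω j) ∧
        (∀ j ≤ l, χ ((i + 1) * T + n + d' + j) = v j) ∧
        |stp u ((i + 1) * T + n + d') - stp u ((i + 1) * T + n)| = d' ∧
        |stp u' ((i + 1) * T + n + d') - stp u' ((i + 1) * T + n)| = d' := by
  intro d
  induction d using Nat.strong_induction_on with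
  | _ d ih =>
    intro k hk hW hR
    have hR' := hR
    obtain ⟨i, hi, h1, h2, h3, h4⟩ := hR
    have next : ∀ k', k = k' + 1 → (∃ d' < d, Reading A T Q n l u u' χ ω v k' d') →
        ∃ d' ≤ d, ∃ i ∈ A, (∀ j ≤ n, χ ((i + 1) * T + j) = ω j) ∧
        (∀ j ≤ l, χ ((i + 1) * T + n + d' + j) = v j) ∧
        |stp u ((i + 1) * T + n + d') - stp u ((i + 1) * T + n)| = d' ∧
        |stp u' ((i + 1) * T + n + d') - stp u' ((i + 1) * T + n)| = d' := by
      rintro k' rfl ⟨d', hd', hr⟩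
      obtain ⟨d'', hd'', h⟩ := ih d' hd' k' (by omega) (by omega) hr
      exact ⟨d'', by omega, h⟩
    rcases Nat.eq_zero_or_pos d with rfl | hd
    · exact ⟨0, le_rfl, i, hi, h3, h4, by simp, by simp⟩
    obtain ⟨k', rfl⟩ : ∃ k', k = k' + 1 := ⟨k - 1, by omega⟩
    by_cases hs : |stp u ((i + 1) * T + n + d) - stp u ((i + 1) * T + n)| = d
    · by_cases hs' : |stp u' ((i + 1) * T + n + d) - stp u' ((i + 1) * T + n)| = d
      · exact ⟨d, le_rfl, i, hi, h3, h4, hs, hs'⟩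
      · obtain ⟨d', hd', hr⟩ :=
          Reading.shorten hQ hl' hf' hl hχ' hu' hA hW hi h2 h3 h4 hs'
        exact next k' rfl ⟨d', hd', hr.symm⟩
    · exact next k' rfl (Reading.shorten hQ hl hf hl' hχ hu hA hW hi h1 h3 h4 hs)

theorem stp_of_straight {u : List Bool} {s d : ℕ} (h : |stp u (s + d) - stp u s| = d) :
    ∃ β : ℤ, (β = 1 ∨ β = -1) ∧ ∀ k : ℕ, k ≤ d → stp u (s + k) = stp u s + β * k := by
  have key : ∀ k ≤ d, |stp u (s + k) - stp u s| ≤ k ∧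
      |stp u (s + d) - stp u (s + k)| ≤ d - k := by
    intro k hk
    constructor
    · rw [← stp_drop]; exact abs_stp_le _ _
    · have := abs_stp_le (u.drop (s + k)) (d - k)
      rw [stp_drop, show s + k + (d - k) = s + d by omega] at this
      push_cast [hk] at this; exact this
  rcases le_total 0 (stp u (s + d) - stp u s) with h0 | h0
  · refine ⟨1, Or.inl rfl, fun k hk => ?_⟩
    obtain ⟨h1, h2⟩ := key k hk
    rw [abs_le] at h1 h2
    rw [abs_of_nonneg h0] at h
    linarith
  · refine ⟨-1, Or.inr rfl, fun k hk => ?_⟩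
    obtain ⟨h1, h2⟩ := key k hk
    rw [abs_le] at h1 h2
    rw [abs_of_nonpos h0] at h
    linarith

/-- The word of length `l` at `x` can be read only along paths that start near `x`. -/
def Distinctive (l R : ℕ) (ξ : ℤ → Bool) (x : ℤ) : Prop :=
  ∀ (y : ℤ) (w : List Bool), |y| ≤ R → w.length = l →
    (∀ j : ℕ, j ≤ l → ξ (y + stp w j) = ξ (x + j)) → |y - x| ≤ 3 * l

theorem Distinctive.apply {l R N s : ℕ} {ξ : ℤ → Bool} {x : ℤ} {u : List Bool} {χ : ℕ → Bool}
    (h : Distinctive l R ξ x) (hχ : ∀ t ≤ N, χ t = ξ (stp u t)) (hu : u.length = N)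
    (hs : s + l ≤ N) (hR : |stp u s| ≤ R) (hw : ∀ j : ℕ, j ≤ l → χ (s + j) = ξ (x + j)) :
    |stp u s - x| ≤ 3 * l := by
  refine h (stp u s) ((u.drop s).take l) hR (by simp; omega) fun j hj => ?_
  rw [← hw j hj, hχ _ (by omega), stp_take _ _ _ hj, stp_add]

/-- The probing path goes from 0 left to -5l and then right to 6l. It passes the word at -5l during
the steps 5l to 6l and the word at 5l during the steps 15l to 16l, with a straight gap of 9l between
them. -/
theorem stp_straight_tour (l W : ℕ) (hW : 16 * l = W) :
    let τ := List.replicate (5 * l) false ++ List.replicate (11 * l) true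
    τ.length = W ∧ ∀ j : ℕ, j ≤ 11 * l → stp τ (5 * l + j) = -(5 * l) + j := by
  intro τ
  refine ⟨by simp [τ]; omega, fun j hj => ?_⟩
  rw [stp_add]
  have h1 : stp τ (5 * l) = -(5 * l) := by
    unfold stp
    rw [List.take_left' (by simp)]
    have := stp_replicate (5 * l) false (5 * l) le_rfl
    unfold stp at this
    rw [List.take_of_length_le (by simp)] at this
    rw [this]; simp [sg]
  have h2 : τ.drop (5 * l) = List.replicate (11 * l) true := List.drop_left' (by simp)
  rw [h1, h2, stp_replicate _ _ _ hj]; simp [sg]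

/-- Two typical pairs of a scenery and a walk with the same color record have sceneries that
agree near the origin up to an isometry. -/
theorem agree_of_same_record {A : Finset ℕ} {T M Q N l : ℕ} {u u' : List Bool}
    {ξ ξ' : ℤ → Bool} {χ : ℕ → Bool} (hl0 : 1 ≤ l) (hQ : 2 ^ (16 * l + 1) * (2 * M + 1) ≤ Q)
    (hl : Localized A T M u) (hf : Frequent A T (16 * l) M Q u)
    (hl' : Localized A T M u') (hf' : Frequent A T (16 * l) M Q u')
    (hχ : ∀ t ≤ N, χ t = ξ (stp u t)) (hχ' : ∀ t ≤ N, χ t = ξ' (stp u' t))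
    (hu : u.length = N) (hu' : u'.length = N) (hA : ∀ i ∈ A, (i + 1) * T + 16 * l ≤ N)
    (hz : Q ^ (9 * l + 1) ≤ visits A T u 0)
    (hd1 : Distinctive l (M + 16 * l) ξ (-(5 * l)))
    (hd2 : Distinctive l (M + 16 * l) ξ (5 * l)) :
    ∃ s β : ℤ, (β = 1 ∨ β = -1) ∧ |s| ≤ 2 * (M + 16 * l) ∧
      ∀ x : ℤ, |x| ≤ l → ξ x = ξ' (s + β * x) := by
  obtain ⟨hτ1, hτ2⟩ := stp_straight_tour l (16 * l) rfl
  set τ := List.replicate (5 * l) false ++ List.replicate (11 * l) true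
  obtain ⟨i, hi, hy, hτ, hv⟩ := exists_continuation hQ hl hf hl' (k := 9 * l) hz τ hτ1
  have hQ0 : 0 < Q := lt_of_lt_of_le (by positivity) hQ
  have hread : Reading A T Q (6 * l) l u u' χ (fun j => ξ (stp τ j)) (fun j => ξ (5 * l + j))
      (9 * l) (9 * l) := by
    have hpath : ∀ j ≤ 16 * l, χ ((i + 1) * T + j) = ξ (stp τ j) := by
      intro j hj
      have := hA i hi
      rw [hχ _ (by omega), stp_add, hy, zero_add, ← stp_take _ (16 * l) j hj, hτ]
    refine ⟨i, hi, ?_, hv, fun j hj => hpath j (by omega), fun j hj => ?_⟩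
    · rw [hy]; exact le_trans (Nat.pow_le_pow_right hQ0 (by omega)) hz
    · rw [add_assoc, add_assoc, hpath _ (by omega), show 6 * l + (9 * l + j) =
        5 * l + (10 * l + j) by ring, hτ2 _ (by omega)]
      congr 1; push_cast; ring
  obtain ⟨d, hd, i, hi, h1, h2, h3, h4⟩ := exists_straight_reading hQ hl hf hl' hf' hχ hχ' hu hu'
    hA (9 * l) (9 * l) le_rfl (by omega) hread
  set t := (i + 1) * T with ht
  have htN := hA i hi
  rw [← ht] at htN
  have near : ∀ (v : List Bool), Localized A T M v → ∀ j ≤ 16 * l,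
      |stp v (t + j)| ≤ ((M + 16 * l : ℕ) : ℤ) := by
    intro v hv j hj
    have e1 := hv i hi
    rw [← ht] at e1
    have e2 := abs_stp_le (v.drop t) j
    rw [stp_add]
    refine (abs_add_le _ _).trans ?_
    push_cast; have : (j : ℤ) ≤ 16 * l := by exact_mod_cast hj
    linarith
  -- Reading the word of -5l puts `u` within 3l of that site, so l steps later it is at most at -l.
  -- Reading the word of 5l after the gap puts it at 2l or beyond. The straight passage between them
  -- therefore goes right and covers `[-l, l]`.
  have q1 := hd1.apply hχ hu (s := t + 5 * l) (by omega) (near u hl _ (by omega)) (fun j hj => by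
    rw [add_assoc, h1 _ (by omega), hτ2 j (by omega)])
  have q2 := hd2.apply hχ hu (s := t + 6 * l + d) (by omega)
    (by rw [add_assoc]; exact near u hl _ (by omega)) (fun j hj => by rw [h2 j hj])
  have q3 : |stp u (t + 6 * l) - stp u (t + 5 * l)| ≤ l := by
    have := abs_stp_le (u.drop (t + 5 * l)) l
    rwa [stp_drop, show t + 5 * l + l = t + 6 * l by ring] at this
  rw [abs_le] at q1 q2 q3
  obtain ⟨β, hβ, hs⟩ := stp_of_straight h3
  obtain ⟨β', hβ', hs'⟩ := stp_of_straight h4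
  have hsd := hs d le_rfl
  have hβ1 : β = 1 := by
    rcases hβ with rfl | rfl
    · rfl
    · exfalso; omega
  subst hβ1
  -- The isometry that carries the passage of `u` over the gap to that of `u'`.
  refine ⟨stp u' (t + 6 * l) - β' * stp u (t + 6 * l), β', hβ', ?_, fun x hx => ?_⟩
  · have n1 := near u hl (6 * l) (by omega)
    have n2 := near u' hl' (6 * l) (by omega)
    push_cast at n1 n2
    refine (abs_sub _ _).trans ?_
    have : |β'| = 1 := by rcases hβ' with rfl | rfl <;> rfl
    rw [abs_mul, this]; linarith
  · rw [abs_le] at hx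
    obtain ⟨k, hk⟩ : ∃ k : ℕ, x = stp u (t + 6 * l) + k :=
      ⟨(x - stp u (t + 6 * l)).toNat, by omega⟩
    have hkd : k ≤ d := by omega
    have e1 := hs k hkd
    have e2 := hs' k hkd
    rw [one_mul, ← hk] at e1
    rw [← e1, ← hχ _ (by omega), hχ' _ (by omega), e2, e1, hk]
    congr 1; ring

/-! ### Random sceneries: repetitions, number of runs, distinctive words -/

/-- However a bit is guessed from its predecessors, the guess is right with probability 1/2. This
form covers copies of words that overlap the original. -/
theorem Pr_predictable_le : ∀ (n : ℕ) (f : ℕ → List Bool → Bool),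
    Pr n (fun w => ∀ k < n, w.getD k false = f k (w.take k)) ≤ (1 / 2) ^ n
  | 0, f => by simpa using Pr_le_one _ _
  | n + 1, f => by
    have key : ∀ c : Bool, Pr n (fun w => ∀ k < n + 1, (c :: w).getD k false =
        f k ((c :: w).take k)) ≤ if c = f 0 [] then (1 / 2) ^ n else 0 := by
      intro c
      split_ifs with hc
      · refine le_trans (Pr_mono n fun w _ h k hk => ?_)
          (Pr_predictable_le n (fun k v => f (k + 1) (c :: v)))
        have := h (k + 1) (by omega)
        simpa using this
      · rw [Pr_false]
        intro w _ h
        exact hc (by simpa using h 0 (by omega))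
    rw [Pr_succ]
    have h1 := key true
    have h2 := key false
    rw [pow_succ]
    cases hf : f 0 [] <;> simp [hf] at h1 h2 ⊢ <;> linarith

theorem overwrite_take {ξ : ℤ → Bool} {p x : ℤ} {w : List Bool} {k : ℕ} (h : x < p + k) :
    overwrite ξ p (w.take k) x = overwrite ξ p w x := by
  unfold overwrite
  rw [List.length_take]
  by_cases h1 : p ≤ x ∧ x < p + w.length
  · rw [if_pos h1, if_pos ⟨h1.1, by push_cast; omega⟩]
    rw [List.getD_eq_getElem?_getD, List.getD_eq_getElem?_getD, List.getElem?_take_of_lt (by omega)]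
  · rw [if_neg h1, if_neg (by push_cast; omega)]

/-- Each site copies one to its left, whose colour lies outside the window or was revealed earlier,
so its colour is predicted by the past. -/
theorem ExS_copy_le (N n : ℕ) (p : ℤ) (q : ℕ → ℤ) (h1 : -(N : ℤ) ≤ p) (h2 : p + n ≤ N + 1)
    (hq : ∀ k < n, q k < p + k) :
    ExS N (fun ξ => ind (∀ k : ℕ, k < n → ξ (p + k) = ξ (q k))) ≤ (1 / 2) ^ n := by
  refine ExS_le_of_window N n p h1 h2 _ _ fun ξ => ?_
  refine le_trans (Ex_mono n fun w hw => ind_mono fun h k hk => ?_)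
    (Pr_predictable_le n (fun k v => overwrite ξ p v (q k)))
  rw [overwrite_take (hq k hk), ← h k hk, overwrite_add (by omega)]

theorem ExS_exists_le {ι : Type*} (N : ℕ) (s : Finset ι) (p : ι → (ℤ → Bool) → Prop) {c : ℝ}
    (h : ∀ i ∈ s, ExS N (fun ξ => ind (p i ξ)) ≤ c) :
    ExS N (fun ξ => ind (∃ i ∈ s, p i ξ)) ≤ s.card * c := by
  calc _ ≤ ExS N (fun ξ => ∑ i ∈ s, ind (p i ξ)) := ExS_mono N fun ξ => ind_exists_le _ _
    _ = ∑ i ∈ s, ExS N (fun ξ => ind (p i ξ)) := ExS_sum N s _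
    _ ≤ ∑ i ∈ s, c := Finset.sum_le_sum h
    _ = _ := by rw [Finset.sum_const, nsmul_eq_mul]

theorem mem_Icc_abs {x : ℤ} {R : ℕ} : x ∈ Finset.Icc (-(R : ℤ)) R ↔ |x| ≤ R := by
  rw [Finset.mem_Icc, abs_le]

theorem card_Icc_abs (R : ℕ) : ((Finset.Icc (-(R : ℤ)) R).card : ℝ) = 2 * R + 1 := by
  rw [Int.card_Icc, show ((R : ℤ) + 1 - -(R : ℤ)).toNat = 2 * R + 1 by omega]; push_cast; ring

/-- No long word near the origin occurs twice, neither shifted nor reflected. -/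
structure NonRepetitive (l D : ℕ) (ξ : ℤ → Bool) : Prop where
  shift : ∀ s s' : ℤ, |s| ≤ D → |s'| ≤ D → s < s' → ∃ k : ℕ, k < l ∧ ξ (s' + k) ≠ ξ (s + k)
  reflect : ∀ s s' : ℤ, |s| ≤ D → |s'| ≤ D → s ≤ s' →
    ∃ k : ℕ, k < l ∧ ξ (s' + 1 + k) ≠ ξ (s - 1 - k)

theorem ExS_not_nonRepetitive_le (N l D : ℕ) (hN : D + l + 1 ≤ N) :
    ExS N (fun ξ => ind (¬ NonRepetitive l D ξ)) ≤ 2 * (2 * D + 1) ^ 2 * (1 / 2) ^ l := by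
  set Sq := Finset.Icc (-(D : ℤ)) D ×ˢ Finset.Icc (-(D : ℤ)) D with hSq
  have hcard : (Sq.card : ℝ) = (2 * D + 1) ^ 2 := by
    rw [hSq, Finset.card_product]; push_cast; rw [card_Icc_abs]; ring
  have h1 := ExS_exists_le N Sq (fun i ξ => i.1 < i.2 ∧ ∀ k : ℕ, k < l → ξ (i.2 + k) = ξ (i.1 + k))
    (c := (1 / 2) ^ l) (by
      rintro ⟨s, s'⟩ hs
      rw [hSq, Finset.mem_product, mem_Icc_abs, mem_Icc_abs] at hs
      simp only [abs_le] at hs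
      by_cases hlt : s < s'
      · exact le_trans (ExS_mono N fun ξ => ind_mono fun h => h.2) (ExS_copy_le N l s'
          (fun k => s + k) (by omega) (by omega) (fun k _ => by omega))
      · refine le_trans (ExS_le_const N (c := 0) fun ξ => ?_) (by positivity)
        rw [ind_of_false fun h => hlt h.1])
  have h2 := ExS_exists_le N Sq
    (fun i ξ => i.1 ≤ i.2 ∧ ∀ k : ℕ, k < l → ξ (i.2 + 1 + k) = ξ (i.1 - 1 - k))
    (c := (1 / 2) ^ l) (by
      rintro ⟨s, s'⟩ hs
      rw [hSq, Finset.mem_product, mem_Icc_abs, mem_Icc_abs] at hs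
      simp only [abs_le] at hs
      by_cases hlt : s ≤ s'
      · exact le_trans (ExS_mono N fun ξ => ind_mono fun h => h.2) (ExS_copy_le N l (s' + 1)
          (fun k => s - 1 - k) (by omega) (by omega) (fun k _ => by omega))
      · refine le_trans (ExS_le_const N (c := 0) fun ξ => ?_) (by positivity)
        rw [ind_of_false fun h => hlt h.1])
  rw [hcard] at h1 h2
  calc _ ≤ ExS N (fun ξ => ind (∃ i ∈ Sq, i.1 < i.2 ∧
          ∀ k : ℕ, k < l → ξ (i.2 + k) = ξ (i.1 + k)) +
        ind (∃ i ∈ Sq, i.1 ≤ i.2 ∧ ∀ k : ℕ, k < l → ξ (i.2 + 1 + k) = ξ (i.1 - 1 - k))) := by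
        refine ExS_mono N fun ξ => le_trans (ind_mono fun h => ?_) (ind_or_le _ _)
        by_contra hcon
        push Not at hcon
        refine h ⟨fun s s' hs hs' hlt => ?_, fun s s' hs hs' hlt => ?_⟩
        · exact hcon.1 (s, s') (Finset.mem_product.2 ⟨mem_Icc_abs.2 hs, mem_Icc_abs.2 hs'⟩) hlt
        · exact hcon.2 (s, s') (Finset.mem_product.2 ⟨mem_Icc_abs.2 hs, mem_Icc_abs.2 hs'⟩) hlt
    _ ≤ _ := by rw [ExS_add]; linarith

theorem level_sub_congr {ξ ξ' : ℤ → Bool} {a b : ℤ} (h : ∀ x, a ≤ x → x ≤ b → ξ x = ξ' x)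
    {x y : ℤ} (hx : a ≤ x ∧ x ≤ b) (hy : a ≤ y ∧ y ≤ b) :
    level ξ x - level ξ y = level ξ' x - level ξ' y := by
  have key : ∀ z, a ≤ z → z ≤ b → level ξ z - level ξ a = level ξ' z - level ξ' a := by
    intro z h1 h2
    obtain ⟨n, rfl⟩ : ∃ n : ℕ, z = a + n := ⟨(z - a).toNat, by omega⟩
    rw [level_add_nat, level_add_nat, edgeBits_congr (w' := fun k => ξ' (a + k))]
    · ring
    · intro k hk; exact h _ (by omega) (by omega)
  have h1 := key x hx.1 hx.2
  have h2 := key y hy.1 hy.2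
  linarith

open Classical in
/-- The levels, relative to the one of `y`, of the runs of the scenery in `[y - R, y + R]`. -/
noncomputable def runLevels (g : ℕ) (ξ : ℤ → Bool) (y : ℤ) (R : ℕ) : Finset ℤ :=
  ((Finset.Icc (y - R) (y + R)).filter fun z => ∃ β, |z + sg β * g - y| ≤ R ∧
    SiteRun g ξ z β).image fun z => level ξ z - level ξ y

theorem mem_runLevels {g : ℕ} {ξ : ℤ → Bool} {y : ℤ} {R : ℕ} {z : ℤ} {β : Bool}
    (h1 : |z - y| ≤ R) (h2 : |z + sg β * g - y| ≤ R) (h : SiteRun g ξ z β) :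
    level ξ z - level ξ y ∈ runLevels g ξ y R := by
  classical
  refine Finset.mem_image_of_mem _ ?_
  rw [Finset.mem_filter, Finset.mem_Icc]
  rw [abs_le] at h1
  exact ⟨⟨by linarith, by linarith⟩, β, h2, h⟩

theorem runLevels_congr {g : ℕ} {ξ ξ' : ℤ → Bool} {y : ℤ} {R : ℕ}
    (h : ∀ x, y - R ≤ x → x ≤ y + R → ξ x = ξ' x) : runLevels g ξ y R = runLevels g ξ' y R := by
  have key : ∀ ξ ξ' : ℤ → Bool, (∀ x, y - R ≤ x → x ≤ y + R → ξ x = ξ' x) →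
      runLevels g ξ y R ⊆ runLevels g ξ' y R := by
    classical
    intro ξ ξ' h l hl
    unfold runLevels at hl
    rw [Finset.mem_image] at hl
    obtain ⟨z, hz, rfl⟩ := hl
    rw [Finset.mem_filter, Finset.mem_Icc] at hz
    obtain ⟨hz1, β, hβ, hr⟩ := hz
    rw [abs_le] at hβ
    rw [level_sub_congr h hz1 (by omega)]
    refine mem_runLevels (abs_le.2 (by omega)) (abs_le.2 hβ) (β := β) fun k hk => ?_
    have e := level_sub_congr h (x := z + sg β * k) (y := z)
      (by cases β <;> simp [sg] at hβ ⊢ <;> omega) hz1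
    have := hr k hk
    linarith
  exact Finset.Subset.antisymm (key _ _ h) (key _ _ fun x h1 h2 => (h x h1 h2).symm)

/-- The number of runs of `g` bits `b` that start before `n`. -/
noncomputable def runCount (g n : ℕ) (b : Bool) (E : List Bool) : ℝ :=
  ∑ j ∈ Finset.range n, ind ((E.drop j).take g = List.replicate g b)

theorem siteRun_true_edgeBits {g : ℕ} {ξ : ℤ → Bool} {p : ℤ} {j n : ℕ} (hn : j + g ≤ n)
    (b : Bool) (h : ∀ k : ℕ, k < g → level ξ (p + j + k + 1) = level ξ (p + j + k) + sg b) :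
    ((edgeBits p (fun k => ξ (p + k)) n).drop j).take g = List.replicate g b := by
  rw [take_drop_edgeBits _ _ hn, edgeBits_eq_replicate]
  intro k hk
  have h1 := h k hk
  rw [level_add_one] at h1
  have h2 : sg (edgeBit (p + j + k) (ξ (p + j + k)) (ξ (p + j + k + 1))) = sg b := by linarith
  have hinj : ∀ c d : Bool, sg c = sg d → c = d := by decide
  have := hinj _ _ h2
  push_cast
  rw [← add_assoc, ← add_assoc, ← add_assoc]; exact this

/-- A run to the right shows as `g` ones among the edge bits, and a run to the left, read from left
to right, as `g` zeros. Counting the starts of constant stretches therefore bounds the number of run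
levels. -/
theorem card_runLevels_le (g R n m : ℕ) (ξ : ℤ → Bool) (y : ℤ) (hm : 2 * R + 1 ≤ m)
    (hn : 2 * R ≤ n) :
    ((runLevels g ξ y R).card : ℝ) ≤
      runCount g m true (edgeBits (y - R) (fun k => ξ (y - R + k)) n) +
      runCount g m false (edgeBits (y - R) (fun k => ξ (y - R + k)) n) := by
  classical
  set E := edgeBits (y - R) (fun k => ξ (y - R + k)) n with hE
  set A := fun b : Bool => (Finset.range m).filter
    (fun j => (E.drop j).take g = List.replicate g b) with hA
  unfold runCount
  rw [sum_ind_eq_card, sum_ind_eq_card]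
  have hsub : runLevels g ξ y R ⊆ (A true).image (fun j : ℕ => level ξ (y - R + j) - level ξ y) ∪
      (A false).image (fun j : ℕ => level ξ (y - R + j + g) - level ξ y) := by
    intro l hl
    unfold runLevels at hl
    rw [Finset.mem_image] at hl
    obtain ⟨z, hz, rfl⟩ := hl
    rw [Finset.mem_filter, Finset.mem_Icc] at hz
    obtain ⟨hz1, β, hβ, hr⟩ := hz
    rw [abs_le] at hβ
    rw [Finset.mem_union]
    cases β
    · right
      simp only [sg, Bool.false_eq_true, if_false, neg_one_mul, ← sub_eq_add_neg] at hβ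
      rw [Finset.mem_image]
      -- A run to the left from `z` is found at its left end `z - g`.
      refine ⟨(z - g - (y - R)).toNat, ?_, by congr 2; omega⟩
      simp only [hA, Finset.mem_filter, Finset.mem_range]
      refine ⟨by omega, siteRun_true_edgeBits (by omega) _ fun k hk => ?_⟩
      have h1 := hr (g - k) (by omega)
      have h2 := hr (g - k - 1) (by omega)
      simp only [sg, Bool.false_eq_true, if_false, neg_one_mul] at h1 h2 ⊢
      rw [show y - (R : ℤ) + ((z - g - (y - R)).toNat : ℕ) + k = z + -((g - k : ℕ) : ℤ) by omega,
        h1, show z + -((g - k : ℕ) : ℤ) + 1 = z + -((g - k - 1 : ℕ) : ℤ) by omega, h2]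
      omega
    · left
      simp only [sg, if_true, one_mul] at hβ
      rw [Finset.mem_image]
      refine ⟨(z - (y - R)).toNat, ?_, by congr 2; omega⟩
      simp only [hA, Finset.mem_filter, Finset.mem_range]
      refine ⟨by omega, siteRun_true_edgeBits (by omega) _ fun k hk => ?_⟩
      have h1 := hr k (by omega)
      have h2 := hr (k + 1) (by omega)
      simp only [sg, if_true, one_mul] at h1 h2 ⊢
      rw [show y - (R : ℤ) + ((z - (y - R)).toNat : ℕ) + k = z + k by omega, h1,
        show z + (k : ℤ) + 1 = z + ((k + 1 : ℕ) : ℤ) by push_cast; ring, h2]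
      push_cast; ring
  have h1 := (Finset.card_le_card hsub).trans (Finset.card_union_le _ _)
  have h2 := h1.trans (add_le_add Finset.card_image_le Finset.card_image_le)
  exact_mod_cast h2

/-- Sorting the starts by residue modulo `g` makes the stretches in each class disjoint, hence
independent. -/
theorem runCount_eq_sum (g N : ℕ) (b : Bool) (E : List Bool) :
    runCount g (N * g) b E = ∑ o ∈ Finset.range g, ∑ i ∈ Finset.range N,
      ind ((E.drop (o + i * g)).take g = List.replicate g b) := by
  unfold runCount
  induction N with
  | zero => simp
  | succ N ih =>
    rw [Nat.succ_mul, Finset.sum_range_add, ih, ← Finset.sum_add_distrib]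
    refine Finset.sum_congr rfl fun o _ => ?_
    rw [Finset.sum_range_succ, add_comm o (N * g)]

theorem Pr_runCount_ge_le (g N k : ℕ) (hg : 1 ≤ g) (b : Bool) :
    Pr (N * g + g) (fun E => (g * k : ℝ) ≤ runCount g (N * g) b E) ≤
      g * ((1 + (1 / 2) ^ g) ^ N / 2 ^ k) := by
  have h1 : ∀ o ∈ Finset.range g, Pr (N * g + g) (fun E => (k : ℝ) ≤ ∑ i ∈ Finset.range N,
      ind ((E.drop (o + i * g)).take g = List.replicate g b)) ≤
      (1 + (1 / 2) ^ g) ^ N / 2 ^ k := by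
    intro o ho
    have ho' := Finset.mem_range.1 ho
    have e1 := Pr_count_blocks_ge_le g N k (List.replicate g b) (by simp)
    rw [← Pr_prefix (N * g) (g - o), ← Pr_suffix o] at e1
    rw [show N * g + g = o + (N * g + (g - o)) by omega]
    refine le_trans (Pr_mono _ fun E _ h => ?_) e1
    refine h.trans (le_of_eq (Finset.sum_congr rfl fun i hi => ?_))
    have : i * g + g ≤ N * g := by
      have := Nat.mul_le_mul_right g (Finset.mem_range.1 hi)
      rwa [Nat.succ_mul] at this
    rw [List.drop_take, List.take_take, min_eq_left (by omega), List.drop_drop]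
  calc _ ≤ Pr (N * g + g) (fun E => ∃ o ∈ Finset.range g, (k : ℝ) ≤ ∑ i ∈ Finset.range N,
        ind ((E.drop (o + i * g)).take g = List.replicate g b)) := by
        refine Pr_mono _ fun E _ h => ?_
        by_contra hcon
        push Not at hcon
        rw [runCount_eq_sum] at h
        have := Finset.sum_lt_sum_of_nonempty (s := Finset.range g) (by simp; omega) hcon
        rw [Finset.sum_const, Finset.card_range, nsmul_eq_mul] at this
        linarith
    _ ≤ _ := Pr_exists_le _ _ _
    _ ≤ ∑ o ∈ Finset.range g, (1 + (1 / 2) ^ g) ^ N / 2 ^ k := Finset.sum_le_sum h1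
    _ = _ := by rw [Finset.sum_const, Finset.card_range, nsmul_eq_mul]

/-- An interval contains many runs only with exponentially small probability. -/
theorem ExS_card_runLevels_gt_le (N g nb k R : ℕ) (hg : 1 ≤ g) (hR : 2 * R + 1 ≤ nb * g) (y : ℤ)
    (h1 : -(N : ℤ) ≤ y - R) (h2 : y - R + (nb * g + g : ℕ) ≤ N) :
    ExS N (fun ξ => ind (2 * (g * k : ℝ) < (runLevels g ξ y R).card)) ≤
      2 * (g * ((1 + (1 / 2) ^ g) ^ nb / 2 ^ k)) := by
  refine ExS_le_of_window N (nb * g + g + 1) (y - R) h1 (by push_cast at h2 ⊢; linarith) _ _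
    fun ξ => ?_
  refine Pr_overwrite_edgeBits_le (nb * g + g) (y - R) (y - R) ξ
    (fun ξ => 2 * (g * k : ℝ) < (runLevels g ξ y R).card)
    (fun E => (g * k : ℝ) ≤ runCount g (nb * g) true E ∨
      (g * k : ℝ) ≤ runCount g (nb * g) false E) _ ?_ ?_
  · refine (Pr_or_le _ _ _).trans ?_
    linarith [Pr_runCount_ge_le g nb k hg true, Pr_runCount_ge_le g nb k hg false]
  · intro w _ hw
    by_contra hcon
    push Not at hcon
    have := card_runLevels_le g R (nb * g + g) (nb * g) (overwrite ξ (y - R) w) y hR (by omega)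
    linarith [hcon.1, hcon.2]

/-- A first-moment bound, good enough for one interval around the origin; the exponential bound
`ExS_card_runLevels_gt_le` serves where a union over all positions is taken. -/
theorem ExS_card_runLevels_ge_le (N g R : ℕ) (c : ℝ) (hc : 0 < c) (y : ℤ)
    (h1 : -(N : ℤ) ≤ y - R) (h2 : y - R + (2 * R + 1 + g : ℕ) ≤ N) :
    ExS N (fun ξ => ind (c < (runLevels g ξ y R).card)) ≤
      2 * (2 * R + 1) * (1 / 2) ^ g / c := by
  set n := 2 * R + 1 + g with hn
  have hcount : ∀ b, Ex n (runCount g (2 * R + 1) b) ≤ (2 * R + 1) * (1 / 2) ^ g := by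
    intro b
    unfold runCount
    rw [Ex_sum]
    have : ∀ j ∈ Finset.range (2 * R + 1),
        Ex n (fun E => ind ((E.drop j).take g = List.replicate g b)) = (1 / 2) ^ g := by
      intro j hj
      have hj' := Finset.mem_range.1 hj
      have e := Pr_eq g (List.replicate g b) (by simp)
      rw [← Pr_prefix g (n - j - g), ← Pr_suffix j] at e
      rw [← e, show j + (g + (n - j - g)) = n by omega]; rfl
    rw [Finset.sum_congr rfl this, Finset.sum_const, Finset.card_range, nsmul_eq_mul]
    push_cast; exact le_rfl
  have hnn : ∀ b E, 0 ≤ runCount g (2 * R + 1) b E := fun b E =>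
    Finset.sum_nonneg fun _ _ => ind_nonneg _
  refine ExS_le_of_window N (n + 1) (y - R) h1 (by push_cast at h2 ⊢; linarith) _ _ fun ξ => ?_
  refine Pr_overwrite_edgeBits_le n (y - R) (y - R) ξ
    (fun ξ => c < (runLevels g ξ y R).card)
    (fun E => c ≤ runCount g (2 * R + 1) true E + runCount g (2 * R + 1) false E) _ ?_ ?_
  · refine (Pr_ge_le n (fun E => runCount g (2 * R + 1) true E + runCount g (2 * R + 1) false E)
      (fun u _ => add_nonneg (hnn _ _) (hnn _ _)) hc _ (fun _ _ h => h)).trans ?_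
    rw [Ex_add]
    gcongr
    linarith [hcount true, hcount false]
  · intro w _ hw
    have := card_runLevels_le g R n (2 * R + 1) (overwrite ξ (y - R) w) y le_rfl (by omega)
    linarith

/-- A path from `y` that reads the word of a distant `x` sees upward runs only at levels of runs
near `y`. These levels are few and independent of the word, while a random word has all its runs in
a given small set only with probability (1/4)^r. -/
theorem ExS_not_distinctive_le (N g nb r k R l : ℕ) (hg : 1 ≤ g) (hr : 1 ≤ r)
    (hl : l = r * (nb * g)) (hnb : 6 * 2 ^ g ≤ nb)
    (hk : 64 * (2 * (g * k : ℝ)) ≤ Real.sqrt nb) (x : ℤ) (hx : |x| + l ≤ N)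
    (hN : R + 5 * l ≤ N) :
    ExS N (fun ξ => ind (¬ Distinctive l R ξ x)) ≤
      (2 * R + 1) * (2 * (g * ((1 + (1 / 2) ^ g) ^ (3 * r * nb) / 2 ^ k)) + (1 / 4) ^ r) := by
  have hx1 : -(N : ℤ) ≤ x := by have := neg_abs_le x; omega
  have hx2 : x + l ≤ N := by have := le_abs_self x; omega
  have hnb1 : 1 ≤ nb := le_trans (by have := Nat.one_le_two_pow (n := g); omega) hnb
  have hgl : g ≤ l := by
    rw [hl, ← mul_assoc]; exact Nat.le_mul_of_pos_left g (by positivity)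
  have hl1 : 1 ≤ l := hg.trans hgl
  have main := ExS_exists_le N (Finset.Icc (-(R : ℤ)) R)
    (fun y ξ => 3 * (l : ℤ) < |y - x| ∧ ∃ w : List Bool, w.length = l ∧
      ∀ j : ℕ, j ≤ l → ξ (y + stp w j) = ξ (x + j))
    (c := 2 * (g * ((1 + (1 / 2) ^ g) ^ (3 * r * nb) / 2 ^ k)) + (1 / 4) ^ r) (by
      intro y hy
      rw [mem_Icc_abs, abs_le] at hy
      by_cases hyx : 3 * (l : ℤ) < |y - x|
      swap
      · refine le_trans (ExS_le_const N (c := 0) fun ξ => ?_) (by positivity)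
        rw [ind_of_false fun h => hyx h.1]
      have h3 : 3 * r * nb * g = 3 * l := by rw [hl]; ring
      have c1 := ExS_card_runLevels_gt_le N g (3 * r * nb) k l hg (by rw [h3]; omega) y
        (by omega) (by rw [h3]; push_cast; omega)
      have c2 : ExS N (fun ξ => ind (((runLevels g ξ y l).card : ℝ) ≤ 2 * (g * k : ℝ) ∧
          ∃ w : List Bool, w.length = l ∧ ∀ j : ℕ, j ≤ l → ξ (y + stp w j) = ξ (x + j))) ≤
          (1 / 4) ^ r := by
        refine ExS_le_of_window N (l + 1) x hx1 (by push_cast; linarith) _ _ fun ξ => ?_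
        by_cases hH : ((runLevels g ξ y l).card : ℝ) ≤ 2 * (g * k : ℝ)
        -- The edge bits of the word at `x` are taken with the parity of `y`, where the reading path
        -- starts; they are fair bits for either parity.
        · refine Pr_overwrite_edgeBits_le l y x ξ
            (fun ξ => ((runLevels g ξ y l).card : ℝ) ≤ 2 * (g * k : ℝ) ∧ ∃ w : List Bool,
              w.length = l ∧ ∀ j : ℕ, j ≤ l → ξ (y + stp w j) = ξ (x + j)) (RunsIn g (runLevels g ξ y l) 0) _ ?_ ?_
          · rw [hl]
            exact Pr_runsIn_le g nb hg hnb _ (by rw [← hl]; linarith) r 0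
          · rintro w hw ⟨-, v, hv, hread⟩
            set ξ' := overwrite ξ x w with hξ'
            -- Since |y - x| > 3l, resampling the word does not touch the sites reachable from `y`.
            have hloc : ∀ z, y - l ≤ z → z ≤ y + l → ξ' z = ξ z := by
              intro z hz1 hz2
              refine overwrite_of_not ?_
              rw [hw]; push_cast
              rcases lt_abs.1 hyx with h | h <;> omega
            intro j hj hrun
            rw [length_edgeBits] at hj
            rw [edgeBits_congr (w' := fun k => ξ' (y + stp v k)) (fun k hk => (hread k hk).symm)]
              at hrun ⊢
            rw [← upRun_iff_edgeBits _ _ _ _ _ hj] at hrun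
            obtain ⟨β, hβ, hsite⟩ := siteRun_of_upRun g ξ' v y j (by omega) hrun
            have hlev := level_stp ξ' v y j (by omega)
            rw [zero_add, take_edgeBits _ _ (by omega), ← runLevels_congr hloc]
            rw [show pos (edgeBits y (fun k => ξ' (y + stp v k)) j) =
              level ξ' (y + stp v j) - level ξ' y by linarith]
            have ha := abs_stp_le v j
            refine mem_runLevels (β := β) ?_ ?_ hsite
            · rw [add_sub_cancel_left]; omega
            · rw [show y + stp v j + sg β * g - y = stp v j + sg β * g by ring]
              refine (abs_add_le _ _).trans ?_
              rw [abs_mul, sg_abs, one_mul, Nat.abs_cast]; omega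
        · refine le_trans (Ex_le_const _ (c := 0) fun w hw => ?_) (by positivity)
          rw [ind_of_false]
          rintro ⟨h, -⟩
          rw [runLevels_congr (ξ' := ξ)] at h
          · exact hH h
          · intro z hz1 hz2
            refine overwrite_of_not ?_
            rw [hw]; push_cast
            rcases lt_abs.1 hyx with h | h <;> omega
      refine le_trans ?_ (add_le_add c1 c2)
      rw [← ExS_add]
      refine ExS_mono N fun ξ => le_trans (ind_mono fun h => ?_) (ind_or_le _ _)
      by_cases hH : ((runLevels g ξ y l).card : ℝ) ≤ 2 * (g * k : ℝ)
      · exact Or.inr ⟨hH, h.2⟩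
      · exact Or.inl (not_le.1 hH))
  rw [card_Icc_abs] at main
  refine le_trans (ExS_mono N fun ξ => ind_mono fun h => ?_) main
  unfold Distinctive at h
  push Not at h
  obtain ⟨y, w, h1, h2, h3, h4⟩ := h
  exact ⟨y, mem_Icc_abs.2 h1, h4, w, h2, h3⟩

/-! ### Localization: blocks far from the origin fail the test -/

/-- The colors seen along the path with the steps `u`. -/
def record (ξ : ℤ → Bool) (u : List Bool) (t : ℕ) : Bool := ξ (stp u t)

/-- All upward runs of the `i`-th block of length `T` occur at levels, relative to the beginning
of the block, at which the record has an upward run before time `T₀`. -/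
def Test (T g T₀ : ℕ) (χ : ℕ → Bool) (i : ℕ) : Prop :=
  ∀ s, i * T ≤ s → s + g ≤ i * T + T → UpRun 0 g χ s → ∃ s', s' + g ≤ T₀ ∧ UpRun 0 g χ s' ∧
    pos (edgeBits 0 χ s') = pos (edgeBits 0 χ s) - pos (edgeBits 0 χ (i * T))

theorem upRun_congr {q : ℤ} {g s : ℕ} {χ χ' : ℕ → Bool} (h : ∀ t ≤ s + g, χ t = χ' t) :
    UpRun q g χ s ↔ UpRun q g χ' s := by
  refine forall_congr' fun k => forall_congr' fun hk => ?_
  rw [h (s + k) (by omega), h (s + k + 1) (by omega)]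

theorem test_congr {T g T₀ i : ℕ} {χ χ' : ℕ → Bool} (hT : T₀ ≤ i * T + T)
    (h : ∀ t ≤ i * T + T, χ t = χ' t) : Test T g T₀ χ i ↔ Test T g T₀ χ' i := by
  refine forall_congr' fun s => forall_congr' fun h1 => forall_congr' fun h2 => ?_
  rw [upRun_congr fun t ht => h t (by omega)]
  refine imp_congr Iff.rfl (exists_congr fun s' => and_congr_right fun h3 => ?_)
  rw [upRun_congr fun t ht => h t (by omega),
    edgeBits_congr (n := s') fun t ht => h t (by omega),
    edgeBits_congr (n := s) fun t ht => h t (by omega),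
    edgeBits_congr (n := i * T) fun t ht => h t (by omega)]

/-- The observer knows the level of the walker's site without knowing the site. This is what makes
`Test`, a condition on the record, a statement about the scenery. -/
theorem pos_edgeBits_record (ξ : ℤ → Bool) (u : List Bool) (t : ℕ) (h : t ≤ u.length) :
    pos (edgeBits 0 (record ξ u) t) = level ξ (stp u t) := by
  have := level_stp ξ u 0 t h
  simp only [zero_add, level_zero] at this
  exact this.symm

theorem siteRun_of_upRun_record {g : ℕ} {ξ : ℤ → Bool} {u : List Bool} {s : ℕ}
    (hs : s + g ≤ u.length) (h : UpRun 0 g (record ξ u) s) :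
    ∃ β, (u.drop s).take g = List.replicate g β ∧ SiteRun g ξ (stp u s) β := by
  have := siteRun_of_upRun g ξ u 0 s hs (by simp only [zero_add]; exact h)
  simpa only [zero_add] using this

theorem upRun_record_of_siteRun {g : ℕ} {ξ : ℤ → Bool} {u : List Bool} {s : ℕ} {β : Bool}
    (hs : s + g ≤ u.length) (hβ : (u.drop s).take g = List.replicate g β)
    (h : SiteRun g ξ (stp u s) β) : UpRun 0 g (record ξ u) s := by
  have := upRun_of_siteRun g ξ u 0 s β hs hβ (by simpa only [zero_add] using h)
  simp only [zero_add] at this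
  exact this

/-- Far from the origin most sceneries have many runs at levels outside of those near the
origin. -/
theorem ExS_window_runsIn_le (N T B d g nb r : ℕ) (h₀ : ℝ) (y : ℤ) (hg : 1 ≤ g)
    (hnb : 6 * 2 ^ g ≤ nb) (hh : 64 * h₀ ≤ Real.sqrt nb) (hd : d = r * (nb * g))
    (hy : (B + T + d : ℤ) < |y|) (hN : |y| + T + d ≤ N) :
    ExS N (fun ξ => ind (((runLevels g ξ 0 B).card : ℝ) ≤ h₀ ∧
      ∃ i ∈ Finset.Icc (-(T : ℤ)) T ×ˢ Finset.Icc (-(T : ℤ)) T,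
        RunsIn g (runLevels g ξ 0 B) i.2 (edgeBits (y + i.1) (fun k => ξ (y + i.1 + k)) d))) ≤
      (2 * T + 1) ^ 2 * (1 / 4) ^ r := by
  set Sq := Finset.Icc (-(T : ℤ)) T ×ˢ Finset.Icc (-(T : ℤ)) T with hSq
  have hcard : (Sq.card : ℝ) = (2 * T + 1) ^ 2 := by
    rw [hSq, Finset.card_product]; push_cast; rw [card_Icc_abs]; ring
  have main := ExS_exists_le N Sq (fun i ξ => ((runLevels g ξ 0 B).card : ℝ) ≤ h₀ ∧
      RunsIn g (runLevels g ξ 0 B) i.2 (edgeBits (y + i.1) (fun k => ξ (y + i.1 + k)) d))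
    (c := (1 / 4) ^ r) (by
      -- `x` is the displacement of the walk inside the block and `c` the resulting change of level.
      -- Both are bounded by `T`, as the level is 1-Lipschitz.
      rintro ⟨x, c⟩ hi
      rw [hSq, Finset.mem_product, Finset.mem_Icc, Finset.mem_Icc] at hi
      simp only at hi ⊢
      have hy1 := neg_abs_le y
      have hy2 := le_abs_self y
      refine ExS_le_of_window N (d + 1) (y + x) (by omega) (by push_cast; omega) _ _ fun ξ => ?_
      have hloc : ∀ w : List Bool, w.length = d + 1 →
          runLevels g (overwrite ξ (y + x) w) 0 B = runLevels g ξ 0 B := by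
        intro w hw
        refine runLevels_congr fun z hz1 hz2 => overwrite_of_not ?_
        rw [hw]; push_cast
        rcases lt_abs.1 hy with h | h <;> omega
      by_cases hH : ((runLevels g ξ 0 B).card : ℝ) ≤ h₀
      · refine Pr_overwrite_edgeBits_le d (y + x) (y + x) ξ
          (fun ξ => ((runLevels g ξ 0 B).card : ℝ) ≤ h₀ ∧
            RunsIn g (runLevels g ξ 0 B) c (edgeBits (y + x) (fun k => ξ (y + x + k)) d))
          (RunsIn g (runLevels g ξ 0 B) c) _ ?_ ?_
        · rw [hd]; exact Pr_runsIn_le g nb hg hnb _ (by linarith) r c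
        · rintro w hw ⟨-, h⟩
          rwa [hloc w hw] at h
      · refine le_trans (Ex_le_const _ (c := 0) fun w hw => ?_) (by positivity)
        rw [ind_of_false]
        rintro ⟨h, -⟩
        rw [hloc w hw] at h
        exact hH h)
  rw [hcard] at main
  refine le_trans (ExS_mono N fun ξ => ind_mono ?_) main
  rintro ⟨h, i, hi, hr⟩
  exact ⟨i, hi, h, hr⟩

/-- A block far from the origin passes the test only with small probability. -/
theorem Pr_test_far_le (T g T₀ B d J n i : ℕ) (h₀ : ℝ) (ξ : ℤ → Bool) (u : List Bool)
    (hT : T = J * n) (hT₀ : T₀ ≤ i * T) (hu : u.length = i * T)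
    (hd : ∀ j : ℕ, j ≤ d → Pr n (NotRead j g) ≤ 1 / 2)
    (hB : ∀ t ≤ T₀, |stp u t| ≤ B) :
    Pr T (fun v => ((runLevels g ξ 0 B).card : ℝ) ≤ h₀ ∧ Test T g T₀ (record ξ (u ++ v)) i) ≤
      ind (((runLevels g ξ 0 B).card : ℝ) ≤ h₀ ∧
        ∃ i ∈ Finset.Icc (-(T : ℤ)) T ×ˢ Finset.Icc (-(T : ℤ)) T, RunsIn g (runLevels g ξ 0 B) i.2
          (edgeBits (pos u + i.1) (fun k => ξ (pos u + i.1 + k)) d)) + (1 / 2) ^ J := by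
  set y := pos u with hy
  by_cases hH : ((runLevels g ξ 0 B).card : ℝ) ≤ h₀
  swap
  · rw [Pr_false]
    · exact add_nonneg (ind_nonneg _) (by positivity)
    · rintro v - ⟨h, -⟩; exact hH h
  by_cases hbad : ∃ i ∈ Finset.Icc (-(T : ℤ)) T ×ˢ Finset.Icc (-(T : ℤ)) T,
      RunsIn g (runLevels g ξ 0 B) i.2 (edgeBits (y + i.1) (fun k => ξ (y + i.1 + k)) d)
  · rw [ind_of_true ⟨hH, hbad⟩]
    exact (Pr_le_one _ _).trans (by linarith [show (0 : ℝ) ≤ (1 / 2) ^ J by positivity])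
  push Not at hbad
  refine le_trans ?_ (le_add_of_nonneg_left (ind_nonneg _))
  -- From any site reachable in the block there is, within distance `d` to the right, a run at an
  -- uncollected level. Each of the `J` rounds of `n` steps reads it with probability at least 1/2.
  have hwin := Pr_notRead_all_le g n
    (fun z => SiteRun g ξ z true ∧ level ξ z - level ξ y ∉ runLevels g ξ 0 B) J y (by
      intro x hx
      have hxT : |x - y| ≤ T := by rw [hT]; push_cast; exact hx
      have hlev := (abs_level_sub_le ξ x y).trans hxT
      have hnot := hbad (x - y, level ξ x - level ξ y)
        (Finset.mem_product.2 ⟨mem_Icc_abs.2 hxT, mem_Icc_abs.2 hlev⟩)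
      simp only [add_sub_cancel] at hnot
      unfold RunsIn at hnot
      push Not at hnot
      obtain ⟨j, hj, hrun, hmem⟩ := hnot
      rw [length_edgeBits] at hj
      rw [take_edgeBits _ _ (by omega)] at hmem
      have hl := level_add_nat ξ x j
      refine ⟨x + j, ⟨?_, ?_⟩, ?_⟩
      · rw [take_drop_edgeBits _ _ hj, edgeBits_eq_replicate] at hrun
        intro k
        induction k with
        | zero => simp
        | succ k ih =>
          intro hk
          have h1 := hrun k (by omega)
          have h2 := ih (by omega)
          simp only [sg, if_true, one_mul] at h2 ⊢
          have h3 := level_add_one ξ (x + j + k)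
          push_cast at h1
          rw [← add_assoc, ← add_assoc, ← add_assoc] at h1
          rw [h1, h2] at h3
          push_cast
          rw [← add_assoc, h3]; simp [sg, add_assoc]
      · rw [show level ξ (x + j) - level ξ y = level ξ x - level ξ y +
          pos (edgeBits x (fun k => ξ (x + k)) j) by linarith]
        exact hmem
      · rw [add_sub_cancel_left]; exact hd j (by omega))
  rw [hT]
  refine le_trans (Pr_mono _ fun v hv h z hz => ?_) hwin
  rw [← hT] at hv h
  obtain ⟨-, htest⟩ := h
  obtain ⟨hz1, hz2⟩ := hz
  intro t ht hp hrun
  have hlen : (u ++ v).length = i * T + T := by rw [List.length_append, hu, hv]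
  have hstp : stp (u ++ v) (i * T + t) = z := by
    unfold stp; rw [← hu, List.take_length_add_append, pos_append, hp]; ring
  have hstp0 : stp (u ++ v) (i * T) = y := by
    unfold stp; rw [List.take_left' hu]
  have hup : UpRun 0 g (record ξ (u ++ v)) (i * T + t) := by
    refine upRun_record_of_siteRun (β := true) (by omega) ?_ (by rw [hstp]; exact hz1)
    rw [← hu, List.drop_length_add_append]; exact hrun
  -- A traversed run would, by the test, share its relative level with a run read before `T₀`. That
  -- one lies in `[-B, B]`, so the level would be a collected one.
  obtain ⟨s', hs', hrun', hpos⟩ := htest (i * T + t) (by omega) (by omega) hup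
  rw [pos_edgeBits_record _ _ _ (by omega), pos_edgeBits_record _ _ _ (by omega),
    pos_edgeBits_record _ _ _ (by omega), hstp, hstp0] at hpos
  obtain ⟨β, hβ, hsite⟩ := siteRun_of_upRun_record (by omega) hrun'
  apply hz2
  rw [← hpos]
  have hsB : ∀ t ≤ T₀, |stp (u ++ v) t| ≤ B := by
    intro t ht
    have := hB t ht
    unfold stp at this ⊢
    rwa [List.take_append_of_le_length (by omega)]
  have := mem_runLevels (y := 0) (R := B) (β := β) (by simpa using hsB s' (by omega)) (by
    have h1 := hsB (s' + g) hs'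
    rw [stp_add, ← stp_take _ g g le_rfl, hβ, stp_replicate g β g le_rfl] at h1
    simpa using h1) hsite
  simpa using this

/-- The joint probability of a property of a scenery and of a walk of `n` steps. -/
noncomputable def PrJ (N n : ℕ) (p : (ℤ → Bool) → List Bool → Prop) : ℝ :=
  ExS N fun ξ => Pr n (p ξ)

theorem PrJ_mono (N n : ℕ) {p q : (ℤ → Bool) → List Bool → Prop}
    (h : ∀ ξ u, u.length = n → p ξ u → q ξ u) : PrJ N n p ≤ PrJ N n q :=
  ExS_mono N fun ξ => Pr_mono n (h ξ)

theorem PrJ_or_le (N n : ℕ) (p q : (ℤ → Bool) → List Bool → Prop) :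
    PrJ N n (fun ξ u => p ξ u ∨ q ξ u) ≤ PrJ N n p + PrJ N n q := by
  unfold PrJ; rw [← ExS_add]; exact ExS_mono N fun ξ => Pr_or_le n _ _

theorem PrJ_exists_le {ι : Type*} (N n : ℕ) (s : Finset ι)
    (p : ι → (ℤ → Bool) → List Bool → Prop) {c : ℝ} (h : ∀ i ∈ s, PrJ N n (p i) ≤ c) :
    PrJ N n (fun ξ u => ∃ i ∈ s, p i ξ u) ≤ s.card * c := by
  calc _ ≤ ExS N (fun ξ => ∑ i ∈ s, Pr n (p i ξ)) := ExS_mono N fun ξ => Pr_exists_le n _ _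
    _ = ∑ i ∈ s, PrJ N n (p i) := ExS_sum N s _
    _ ≤ ∑ i ∈ s, c := Finset.sum_le_sum h
    _ = _ := by rw [Finset.sum_const, nsmul_eq_mul]

theorem PrJ_scenery (N n : ℕ) (p : (ℤ → Bool) → Prop) :
    PrJ N n (fun ξ _ => p ξ) = ExS N (fun ξ => ind (p ξ)) := by
  unfold PrJ Pr; simp only [Ex_const]

theorem PrJ_walk_le (N n : ℕ) (p : List Bool → Prop) : PrJ N n (fun _ u => p u) ≤ Pr n p :=
  ExS_le_const N fun _ => le_rfl

/-- The averages are exchanged so that the scenery is still random when the past of the walk is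
fixed. A block that ends beyond `M` starts beyond `B + T + d`, where the scenery around the block is
independent of that in `[-B, B]`. -/
theorem PrJ_test_far_le (N T g T₀ B d J n i M nb r rest : ℕ) (h₀ : ℝ) (hT : T = J * n)
    (hT₀ : T₀ ≤ i * T) (hg : 1 ≤ g) (hnb : 6 * 2 ^ g ≤ nb) (hh : 64 * h₀ ≤ Real.sqrt nb)
    (hd : d = r * (nb * g)) (hread : ∀ j : ℕ, j ≤ d → Pr n (NotRead j g) ≤ 1 / 2)
    (hM : B + 2 * T + d ≤ M) (hN : i * T + T + d ≤ N) :
    PrJ N (i * T + (T + rest)) (fun ξ u => (∀ t ≤ T₀, |stp u t| ≤ B) ∧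
      ((runLevels g ξ 0 B).card : ℝ) ≤ h₀ ∧ Test T g T₀ (record ξ u) i ∧
      (M : ℤ) < |stp u ((i + 1) * T)|) ≤ (2 * T + 1) ^ 2 * (1 / 4) ^ r + (1 / 2) ^ J := by
  unfold PrJ
  simp only [Pr_append (i * T) (T + rest)]
  rw [ExS_Ex_comm]
  refine Ex_le_const _ fun u hu => ?_
  by_cases hgood : (∀ t ≤ T₀, |stp u t| ≤ B) ∧ (M : ℤ) < |pos u| + T
  · obtain ⟨hB, hfar⟩ := hgood
    have hub := abs_pos_le u
    rw [hu] at hub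
    have h1 := ExS_window_runsIn_le N T B d g nb r h₀ (pos u) hg hnb hh hd (by omega) (by
      push_cast at hub; zify at hN; linarith)
    refine le_trans (ExS_mono N fun ξ => ?_) (le_trans (le_of_eq (ExS_add N _ (fun _ =>
      (1 / 2) ^ J))) (add_le_add h1 (ExS_le_const N fun _ => le_rfl)))
    refine le_trans ?_ (Pr_test_far_le T g T₀ B d J n i h₀ ξ u hT hT₀ hu hread hB)
    rw [← Pr_prefix T rest]
    refine Pr_mono _ fun v hv h => ⟨h.2.1, ?_⟩
    refine (test_congr (by omega) fun t ht => ?_).1 h.2.2.1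
    unfold record stp
    congr 2
    rw [List.take_append, List.take_append, List.take_take, min_eq_left (by omega)]
  · refine le_trans (ExS_le_const N (c := 0) fun ξ => ?_) (by positivity)
    rw [Pr_false]
    rintro v hv ⟨h1, -, -, h4⟩
    apply hgood
    constructor
    · intro t ht
      have := h1 t ht
      unfold stp at this ⊢
      rwa [List.take_append_of_le_length (by omega)] at this
    · rw [Nat.succ_mul, stp_add] at h4
      have e1 : stp (u ++ v) (i * T) = pos u := by unfold stp; rw [List.take_left' hu]
      have e2 := abs_stp_le ((u ++ v).drop (i * T)) T
      have e3 := abs_add_le (stp (u ++ v) (i * T)) (stp ((u ++ v).drop (i * T)) T)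
      rw [e1] at h4 e3
      linarith

/-! ### Reading the runs near the origin and returning in loops -/

theorem ExS_siteRun_le (N g : ℕ) (z : ℤ) (β : Bool) (h : |z| + g ≤ N) :
    ExS N (fun ξ => ind (SiteRun g ξ z β)) ≤ (1 / 2) ^ g := by
  have h1 := neg_abs_le z
  have h2 := le_abs_self z
  cases β
  · refine ExS_le_of_window N (g + 1) (z - g) (by omega) (by push_cast; omega) _ _ fun ξ => ?_
    refine Pr_overwrite_edgeBits_le g (z - g) (z - g) ξ (fun ξ => SiteRun g ξ z false)
      (fun E => E = List.replicate g false) _ (Pr_eq g _ (by simp)).le fun w _ hr => ?_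
    have := siteRun_true_edgeBits (g := g) (ξ := overwrite ξ (z - g) w) (p := z - g) (j := 0)
      (n := g) (by omega) false (fun k hk => by
        have h1 := hr (g - k) (by omega)
        have h2 := hr (g - k - 1) (by omega)
        simp only [sg, Bool.false_eq_true, if_false, neg_one_mul] at h1 h2 ⊢
        rw [show z - (g : ℤ) + (0 : ℕ) + k = z + -((g - k : ℕ) : ℤ) by omega,
          h1, show z + -((g - k : ℕ) : ℤ) + 1 = z + -((g - k - 1 : ℕ) : ℤ) by omega, h2]
        omega)
    rwa [List.drop_zero, List.take_of_length_le (by simp)] at this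
  · refine ExS_le_of_window N (g + 1) z (by omega) (by push_cast; omega) _ _ fun ξ => ?_
    refine Pr_overwrite_edgeBits_le g z z ξ (fun ξ => SiteRun g ξ z true)
      (fun E => E = List.replicate g true) _ (Pr_eq g _ (by simp)).le fun w _ hr => ?_
    have := siteRun_true_edgeBits (g := g) (ξ := overwrite ξ z w) (p := z) (j := 0)
      (n := g) (by omega) true (fun k hk => by
        have h1 := hr k (by omega)
        have h2 := hr (k + 1) (by omega)
        simp only [sg, if_true, one_mul] at h1 h2 ⊢
        rw [show z + ((0 : ℕ) : ℤ) + k = z + k by simp, h1,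
          show z + (k : ℤ) + 1 = z + ((k + 1 : ℕ) : ℤ) by push_cast; ring, h2]
        push_cast; ring)
    rwa [List.drop_zero, List.take_of_length_le (by simp)] at this

/-- All runs of the scenery in `[-A, A]` are traversed before time `T₀`. -/
def AllRead (g T₀ A : ℕ) (ξ : ℤ → Bool) (u : List Bool) : Prop :=
  ∀ (z : ℤ) (β : Bool), |z| ≤ A → SiteRun g ξ z β →
    ∃ t, t + g ≤ T₀ ∧ stp u t = z ∧ (u.drop t).take g = List.replicate g β

theorem Pr_not_traversed_le (g n₀ rest : ℕ) (hn : 1 ≤ n₀) (A : ℕ) (z : ℤ) (hz : |z| ≤ A)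
    (β : Bool) :
    Pr (n₀ + n₀ + rest) (fun u => ∀ t, t + g ≤ n₀ + n₀ → stp u t = z →
      (u.drop t).take g ≠ List.replicate g β) ≤
      (2 * (A + g) + 4 * 2 ^ g) / Real.sqrt n₀ := by
  have bound : ∀ z : ℤ, |z| ≤ A → Pr (n₀ + n₀ + rest) (fun u => NotRead z g (u.take (n₀ + n₀))) ≤
      (2 * (A + g) + 4 * 2 ^ g) / Real.sqrt n₀ := by
    intro z hz
    rw [Pr_prefix]
    refine (Pr_notRead_le n₀ g hn z).trans ?_
    have h1 : |(z : ℝ)| ≤ A := by exact_mod_cast hz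
    have h2 : |(z : ℝ) + g| ≤ A + g := by
      refine (abs_add_le _ _).trans ?_
      rw [Nat.abs_cast]; linarith
    gcongr
  cases β
  · rw [← Pr_flip]
    refine le_trans (Pr_mono _ fun u hu h => ?_) (bound (-z) (by rwa [abs_neg]))
    intro t ht hp hr
    rw [List.length_take] at ht
    refine h t (by omega) ?_ ?_
    · rw [List.take_take, min_eq_left (by omega)] at hp
      unfold stp
      rw [← List.map_take, pos_map_not, hp, neg_neg]
    · rw [List.drop_take, List.take_take, min_eq_left (by omega)] at hr
      rw [← List.map_drop, ← List.map_take, hr]; simp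
  · refine le_trans (Pr_mono _ fun u hu h => ?_) (bound z hz)
    intro t ht hp hr
    rw [List.length_take] at ht
    refine h t (by omega) ?_ ?_
    · rwa [List.take_take, min_eq_left (by omega)] at hp
    · rwa [List.drop_take, List.take_take, min_eq_left (by omega)] at hr

/-- Only intervals that carry a run need to be traversed. The density (1/2)^g of runs is what makes
the union bound over all sites affordable. -/
theorem PrJ_not_allRead_le (N g n₀ rest A : ℕ) (hn : 1 ≤ n₀) (hN : A + g ≤ N) :
    PrJ N (n₀ + n₀ + rest) (fun ξ u => ¬ AllRead g (n₀ + n₀) A ξ u) ≤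
      2 * (2 * A + 1) * ((1 / 2) ^ g * ((2 * (A + g) + 4 * 2 ^ g) / Real.sqrt n₀)) := by
  have main := PrJ_exists_le N (n₀ + n₀ + rest)
    (Finset.Icc (-(A : ℤ)) A ×ˢ (Finset.univ : Finset Bool))
    (fun i ξ u => SiteRun g ξ i.1 i.2 ∧ ∀ t, t + g ≤ n₀ + n₀ → stp u t = i.1 →
      (u.drop t).take g ≠ List.replicate g i.2)
    (c := (1 / 2) ^ g * ((2 * (A + g) + 4 * 2 ^ g) / Real.sqrt n₀)) (by
      rintro ⟨z, β⟩ hi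
      rw [Finset.mem_product, mem_Icc_abs] at hi
      have hz : |z| ≤ A := hi.1
      unfold PrJ
      simp only [Pr_const_and]
      have h1 := ExS_siteRun_le N g z β (by omega)
      have h2 := Pr_not_traversed_le g n₀ rest hn A z hz β
      calc _ = ExS N (fun ξ => Pr (n₀ + n₀ + rest) (fun u => ∀ t, t + g ≤ n₀ + n₀ → stp u t = z →
            (u.drop t).take g ≠ List.replicate g β) * ind (SiteRun g ξ z β)) := by
            congr 1; funext ξ; rw [mul_comm]
        _ = _ := ExS_mul_left N _ _
        _ ≤ (2 * (A + g) + 4 * 2 ^ g) / Real.sqrt n₀ * (1 / 2) ^ g := by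
            gcongr
            exact (Ex_nonneg _ fun _ _ => ind_nonneg _)
        _ = _ := mul_comm _ _)
  rw [Finset.card_product] at main
  push_cast at main
  rw [card_Icc_abs] at main
  refine le_trans (PrJ_mono N _ fun ξ u _ h => ?_) (main.trans (le_of_eq ?_))
  · unfold AllRead at h
    push Not at h
    obtain ⟨z, β, hz, hs, ht⟩ := h
    exact ⟨(z, β), Finset.mem_product.2 ⟨mem_Icc_abs.2 hz, Finset.mem_univ _⟩, hs, ht⟩
  · rw [show (Finset.univ : Finset Bool).card = 2 from rfl]; push_cast; ring

/-- A loop at the origin that stays in `[-A, A]`. -/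
def Loop (A : ℕ) (v : List Bool) : Prop := (∀ t ≤ v.length, |stp v t| ≤ A) ∧ pos v = 0

/-- The number of the first `N` blocks of length `T` that are loops at the origin. -/
noncomputable def loopCount (A T N : ℕ) (u : List Bool) : ℝ :=
  ∑ i ∈ Finset.range N, ind (stp u (i * T) = 0 ∧ Loop A ((u.drop (i * T)).take T))

theorem le_Pr_loop (A m : ℕ) (hm : 1 ≤ m) :
    1 / (2 * Real.sqrt m) - 2 * (2 * m + 1) * Real.exp (-((A : ℝ) ^ 2 / (4 * m))) ≤
      Pr (2 * m) (Loop A) := by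
  have h1 := le_Pr_pos_eq_zero m hm
  have h2 := Pr_exists_abs_pos_gt_le (2 * m) A (by omega)
  have h3 := Pr_le_add (2 * m) (p := fun u => pos u = 0) (q := Loop A)
    (r := fun u => ∃ t ≤ 2 * m, (A : ℤ) < |pos (u.take t)|) (fun u hu h => by
      by_cases hc : ∃ t ≤ 2 * m, (A : ℤ) < |pos (u.take t)|
      · exact Or.inr hc
      · push Not at hc
        exact Or.inl ⟨fun t ht => hc t (by omega), h⟩)
  push_cast at h2
  rw [show 2 * (2 * (m : ℝ)) = 4 * m by ring] at h2
  linarith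

/-- A finite set of indices has at most `k` elements with fewer than `k` larger ones. -/
theorem card_few_later_le (G : Finset ℕ) (k : ℕ) :
    (G.filter fun i => (G.filter fun j => i < j).card < k).card ≤ k := by
  by_contra hcon
  push Not at hcon
  set F := G.filter fun i => (G.filter fun j => i < j).card < k with hF
  have hne : F.Nonempty := Finset.card_pos.1 (by omega)
  have hmin := Finset.min'_mem F hne
  have hsub : F.erase (F.min' hne) ⊆ G.filter fun j => F.min' hne < j := by
    intro j hj
    rw [Finset.mem_erase] at hj
    rw [Finset.mem_filter]
    exact ⟨(Finset.mem_filter.1 hj.2).1, lt_of_le_of_ne (Finset.min'_le F j hj.2) (Ne.symm hj.1)⟩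
  have h1 := Finset.card_le_card hsub
  rw [Finset.card_erase_of_mem hmin] at h1
  have h2 := (Finset.mem_filter.1 hmin).2
  omega

/-- `Ev i` marks a loop in block `i` followed by fewer than `k` loops in the next `N` blocks. At
most `k` indices can be marked (`card_few_later_le`), while by the Markov property the expected
number of marks is the left side. -/
theorem Pr_loopCount_lt_mul_le (A T N k : ℕ) :
    Pr (N * T) (fun u => loopCount A T N u < k) *
      (Pr T (Loop A) * ∑ i ∈ Finset.range N, Pr (i * T) (fun u => pos u = 0)) ≤ k := by
  classical
  set Ev : ℕ → List Bool → Prop := fun i u => stp u (i * T) = 0 ∧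
    Loop A ((u.drop (i * T)).take T) ∧
    loopCount A T N (((u.drop (i * T)).drop T).take (N * T)) < k with hEv
  have h1 : ∀ i ∈ Finset.range N, Pr (N * T + N * T) (Ev i) = Pr (i * T) (fun u => pos u = 0) *
      (Pr T (Loop A) * Pr (N * T) (fun u => loopCount A T N u < k)) := by
    intro i hi
    have hi' : i * T + T ≤ N * T := by
      have := Nat.mul_le_mul_right T (Finset.mem_range.1 hi)
      rwa [Nat.succ_mul] at this
    rw [show N * T + N * T = i * T + (T + (N * T + (N * T - (i * T + T)))) by omega]
    have e0 := Pr_prefix (N * T) (N * T - (i * T + T)) (fun u => loopCount A T N u < k)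
    have e1 := Pr_append_and T (N * T + (N * T - (i * T + T))) (Loop A)
      (fun u => loopCount A T N (u.take (N * T)) < k)
    have e2 := Pr_append_and (i * T) (T + (N * T + (N * T - (i * T + T)))) (fun u => pos u = 0)
      (fun u => Loop A (u.take T) ∧ loopCount A T N ((u.drop T).take (N * T)) < k)
    rw [e0] at e1
    rw [← e1, ← e2]
  have h2 : ∀ u : List Bool, u.length = N * T + N * T →
      ∑ i ∈ Finset.range N, ind (Ev i u) ≤ k := by
    intro u hu
    rw [sum_ind_eq_card]
    set G := (Finset.range N).filter fun i => stp u (i * T) = 0 ∧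
      Loop A ((u.drop (i * T)).take T) with hG
    have hle := card_few_later_le G k
    norm_cast
    refine le_trans ?_ hle
    refine Finset.card_le_card fun i hi => ?_
    rw [Finset.mem_filter] at hi
    obtain ⟨hiN, hz, hloop, hcount⟩ := hi
    have hi' : i * T + T ≤ N * T := by
      have := Nat.mul_le_mul_right T (Finset.mem_range.1 hiN)
      rwa [Nat.succ_mul] at this
    rw [Finset.mem_filter, hG, Finset.mem_filter]
    refine ⟨⟨hiN, hz, hloop⟩, ?_⟩
    unfold loopCount at hcount
    rw [sum_ind_eq_card] at hcount
    have hcount' := Nat.cast_lt.1 hcount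
    refine lt_of_le_of_lt ?_ hcount'
    refine Finset.card_le_card_of_injOn (fun j => j - (i + 1)) ?_ ?_
    · intro j hj
      simp only [Finset.coe_filter, Finset.mem_filter, Finset.mem_range, Set.mem_ofPred_eq] at hj ⊢
      obtain ⟨⟨hjN, hj0, hjl⟩, hij⟩ := hj
      obtain ⟨j', rfl⟩ : ∃ j', j = i + 1 + j' := ⟨j - (i + 1), by omega⟩
      rw [Nat.add_sub_cancel_left]
      have hjT : (i + 1 + j') * T = i * T + T + j' * T := by ring
      have hjT' : i * T + T + j' * T + T ≤ N * T := by
        have := Nat.mul_le_mul_right T hjN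
        rwa [Nat.succ_mul, hjT] at this
      rw [hjT] at hj0 hjl
      refine ⟨by omega, ?_, ?_⟩
      · have hback : stp u (i * T + T) = 0 := by
          rw [stp_add, hz, zero_add]; exact hloop.2
        rw [List.drop_drop, stp_take _ _ _ (by omega), stp_drop, hj0, hback]; rfl
      · rw [List.drop_drop, List.drop_take, List.take_take, min_eq_left (by omega),
          List.drop_drop]
        exact hjl
    · intro j hj j' hj' h
      simp only [Finset.coe_filter, Finset.mem_filter, Set.mem_ofPred_eq] at hj hj'
      simp only at h
      omega
  rw [mul_left_comm, mul_comm (Pr (N * T) _), Finset.sum_mul, Finset.mul_sum]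
  calc _ = ∑ i ∈ Finset.range N, Pr (N * T + N * T) (Ev i) := by
        refine Finset.sum_congr rfl fun i hi => ?_
        rw [h1 i hi]; ring
    _ = Ex (N * T + N * T) (fun u => ∑ i ∈ Finset.range N, ind (Ev i u)) := by
        rw [Ex_sum]; rfl
    _ ≤ k := Ex_le_const _ h2

theorem le_sum_Pr_pos_eq_zero_blocks (m N : ℕ) (hm : 1 ≤ m) (hN : 1 ≤ N) :
    Real.sqrt N / (2 * Real.sqrt m) ≤
      ∑ i ∈ Finset.range N, Pr (i * (2 * m)) (fun u => pos u = 0) := by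
  have hm' : (1 : ℝ) ≤ m := by exact_mod_cast hm
  have hN' : (1 : ℝ) ≤ N := by exact_mod_cast hN
  have hsm : 0 < Real.sqrt m := Real.sqrt_pos.2 (by linarith)
  have hsN : 0 < Real.sqrt N := Real.sqrt_pos.2 (by linarith)
  have h1 : ∀ i ∈ Finset.range N, 1 / (2 * (Real.sqrt N * Real.sqrt m)) ≤
      Pr (i * (2 * m)) (fun u => pos u = 0) := by
    intro i hi
    rcases Nat.eq_zero_or_pos i with rfl | hi0
    · rw [Pr_true]
      · rw [div_le_one (by positivity)]
        have : 1 ≤ Real.sqrt N := Real.one_le_sqrt.2 hN'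
        have : 1 ≤ Real.sqrt m := Real.one_le_sqrt.2 hm'
        nlinarith
      · intro u hu; simp at hu; simp [hu]
    · rw [show i * (2 * m) = 2 * (i * m) by ring]
      refine le_trans ?_ (le_Pr_pos_eq_zero (i * m) (Nat.mul_pos hi0 hm))
      have hi' : (i : ℝ) ≤ N := by exact_mod_cast (Finset.mem_range.1 hi).le
      have hi1 : 0 < Real.sqrt i := Real.sqrt_pos.2 (by exact_mod_cast hi0)
      push_cast
      rw [Real.sqrt_mul (by positivity)]
      gcongr
  refine le_trans (le_of_eq ?_) (Finset.sum_le_sum h1)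
  rw [Finset.sum_const, Finset.card_range, nsmul_eq_mul]
  have h3 : Real.sqrt N * Real.sqrt N = N := Real.mul_self_sqrt (by linarith)
  field_simp
  linarith

open Classical in
/-- The blocks from `I₀` to `I` that pass the test. -/
noncomputable def selected (T g T₀ I₀ I : ℕ) (χ : ℕ → Bool) : Finset ℕ :=
  (Finset.Ico I₀ I).filter (Test T g T₀ χ)

theorem mem_selected {T g T₀ I₀ I i : ℕ} {χ : ℕ → Bool} :
    i ∈ selected T g T₀ I₀ I χ ↔ (I₀ ≤ i ∧ i < I) ∧ Test T g T₀ χ i := by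
  classical
  unfold selected; rw [Finset.mem_filter, Finset.mem_Ico]

/-- Runs read during the loop lie in `[-A, A]`, so they were traversed before `T₀` too. The level is
0 at the start of the loop, hence relative and absolute levels agree. -/
theorem test_of_loop {T g T₀ A i : ℕ} {ξ : ℤ → Bool} {u : List Bool} (hr : AllRead g T₀ A ξ u)
    (hT : i * T + T ≤ u.length) (hT₀ : T₀ ≤ i * T) (h0 : stp u (i * T) = 0)
    (hl : Loop A ((u.drop (i * T)).take T)) : Test T g T₀ (record ξ u) i := by
  intro s hs1 hs2 hrun
  obtain ⟨β, hβ, hsite⟩ := siteRun_of_upRun_record (by omega) hrun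
  have hsA : |stp u s| ≤ A := by
    have := hl.1 (s - i * T) (by simp; omega)
    rwa [stp_take _ _ _ (by omega), stp_drop, show i * T + (s - i * T) = s by omega, h0,
      sub_zero] at this
  obtain ⟨t, ht, hz, htβ⟩ := hr (stp u s) β hsA hsite
  refine ⟨t, ht, upRun_record_of_siteRun (by omega) htβ (by rw [hz]; exact hsite), ?_⟩
  rw [pos_edgeBits_record _ _ _ (by omega), pos_edgeBits_record _ _ _ (by omega),
    pos_edgeBits_record _ _ _ (by omega), hz, h0, level_zero, sub_zero]

theorem le_visits_of_loopCount {T g T₀ A I₀ I k : ℕ} {ξ : ℤ → Bool} {u : List Bool}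
    (hr : AllRead g T₀ A ξ u) (hu : I * T ≤ u.length) (hT₀ : T₀ ≤ I₀ * T)
    (hk : ((k + I₀ : ℕ) : ℝ) ≤ loopCount A T I u) :
    k ≤ visits (selected T g T₀ I₀ I (record ξ u)) T u 0 := by
  classical
  unfold loopCount at hk
  rw [sum_ind_eq_card] at hk
  have hk' := Nat.cast_le.1 hk
  set G := (Finset.range I).filter fun i => stp u (i * T) = 0 ∧
      Loop A ((u.drop (i * T)).take T) with hG
  have hsub : G ⊆ Finset.range I₀ ∪
      (selected T g T₀ I₀ I (record ξ u)).filter fun i => stp u ((i + 1) * T) = 0 := by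
    intro i hi
    rw [hG, Finset.mem_filter, Finset.mem_range] at hi
    obtain ⟨hiI, h0, hl⟩ := hi
    rw [Finset.mem_union, Finset.mem_range, Finset.mem_filter, mem_selected]
    rcases Nat.lt_or_ge i I₀ with h | h
    · exact Or.inl h
    · right
      have h1 := Nat.mul_le_mul_right T hiI
      have h2 := Nat.mul_le_mul_right T h
      rw [Nat.succ_mul] at h1
      refine ⟨⟨⟨h, hiI⟩, test_of_loop hr (by omega) (by omega) h0 hl⟩, ?_⟩
      rw [Nat.succ_mul, stp_add, h0, zero_add]; exact hl.2
  have h1 := (Finset.card_le_card hsub).trans (Finset.card_union_le _ _)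
  rw [Finset.card_range] at h1
  unfold visits
  omega

/-! ### Every continuation is frequent -/

/-- All lists of `n` bits. -/
def bitLists (n : ℕ) : Finset (List Bool) :=
  (Finset.univ : Finset (Fin n → Bool)).image List.ofFn

theorem mem_bitLists {n : ℕ} {u : List Bool} (h : u.length = n) : u ∈ bitLists n := by
  subst h
  exact Finset.mem_image.2 ⟨u.get, Finset.mem_univ _, List.ofFn_get u⟩

theorem length_of_mem_bitLists {n : ℕ} {u : List Bool} (h : u ∈ bitLists n) : u.length = n := by
  obtain ⟨f, -, rfl⟩ := Finset.mem_image.1 h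
  simp

theorem card_bitLists_le (n : ℕ) : (bitLists n).card ≤ 2 ^ n :=
  Finset.card_image_le.trans (by simp)

/-- The weight is halved when the block begins with `τ` and normalised to mean one, so a product of
such weights is large when `τ` is rare. -/
theorem mean_half_weight_le_one (T W : ℕ) (hW : W ≤ T) (τ : List Bool) (hτ : τ.length = W) :
    Ex T (fun w => (1 - ind (w.take W = τ) / 2) * (1 - (1 / 2) ^ W / 2)⁻¹) ≤ 1 := by
  have hp1 : (1 / 2 : ℝ) ^ W ≤ 1 := pow_le_one₀ (by norm_num) (by norm_num)
  have e := Pr_prefix W (T - W) (fun w => w = τ)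
  rw [Nat.add_sub_cancel' hW, Pr_eq W τ hτ] at e
  have e2 : Ex T (fun w => (1 - ind (w.take W = τ) / 2) * (1 - (1 / 2) ^ W / 2)⁻¹) =
      (1 - (1 / 2) ^ W / 2)⁻¹ * (1 + -(1 / 2) * Pr T (fun w => w.take W = τ)) := by
    unfold Pr
    rw [← Ex_mul_left, ← Ex_const T 1, ← Ex_add, ← Ex_mul_left, Ex_const]
    exact Ex_congr T fun u _ => by ring
  rw [e2, e]
  apply le_of_eq
  rw [show (1 : ℝ) + -(1 / 2) * (1 / 2) ^ W = 1 - (1 / 2) ^ W / 2 by ring,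
    inv_mul_cancel₀ (by linarith)]

/-- With log 2 < 3/4, the exponent (pc/2)(1 - log 2) exceeds pc/8. -/
theorem exp_le_half_weights (p : ℝ) (hp0 : 0 ≤ p) (hp1 : p ≤ 1) (c c' : ℕ)
    (h : (c' : ℝ) ≤ p * c / 2) :
    Real.exp (p * c / 8) ≤ ((1 - p / 2)⁻¹) ^ c * (1 / 2) ^ c' := by
  have hlog := Real.log_two_lt_d9
  have h1 : Real.exp (p / 2) ≤ (1 - p / 2)⁻¹ := by
    rw [← inv_inv (Real.exp (p / 2)), ← Real.exp_neg]
    apply inv_anti₀ (by linarith)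
    have := Real.add_one_le_exp (-(p / 2)); linarith
  have h2 : (1 / 2 : ℝ) ^ c' = Real.exp (-(c' * Real.log 2)) := by
    rw [Real.exp_neg, Real.exp_nat_mul, Real.exp_log (by norm_num)]; simp
  have h3 : Real.exp (p / 2) ^ c = Real.exp (p * c / 2) := by
    rw [← Real.exp_nat_mul]; ring_nf
  calc Real.exp (p * c / 8) ≤ Real.exp (p * c / 2 + -(c' * Real.log 2)) := by
        apply Real.exp_le_exp.2
        have : (c' : ℝ) * Real.log 2 ≤ p * c / 2 * Real.log 2 :=
          mul_le_mul_of_nonneg_right h (Real.log_nonneg (by norm_num))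
        have h0 : 0 ≤ p * c := by positivity
        nlinarith
    _ = Real.exp (p / 2) ^ c * (1 / 2) ^ c' := by rw [h3, h2, Real.exp_add]
    _ ≤ _ := by gcongr

/-- Whether block `i` passes the test and ends at `y` is decided by its past, so the block after it
is a fresh trial that begins with `τ` with probability 2^(-W). The weights of
`mean_half_weight_le_one` then give an exponential bound. -/
theorem Pr_visitsThen_few_le (T g T₀ I₀ I W Q : ℕ) (hT : 1 ≤ T) (hW : W ≤ T) (hT₀ : T₀ ≤ I₀ * T)
    (ξ : ℤ → Bool) (y : ℤ) (τ : List Bool) (hτ : τ.length = W) :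
    Pr ((I + 1) * T) (fun u => Q ≤ visits (selected T g T₀ I₀ I (record ξ u)) T u y ∧
      2 ^ (W + 1) * visitsThen (selected T g T₀ I₀ I (record ξ u)) T u y τ <
        visits (selected T g T₀ I₀ I (record ξ u)) T u y) ≤
      Real.exp (-((1 / 2) ^ W * Q / 8)) := by
  classical
  set p : ℝ := (1 / 2) ^ W with hp
  have hp0 : 0 < p := by positivity
  have hp1 : p ≤ 1 := pow_le_one₀ (by norm_num) (by norm_num)
  set φ : List Bool → ℝ := fun w => (1 - ind (w.take W = τ) / 2) * (1 - p / 2)⁻¹ with hφ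
  -- The trial condition may use the past only: the index is recovered from the length of the past,
  -- and the test is applied to its record.
  set tr : List Bool → Prop := fun h => ∃ i, h.length = (i + 1) * T ∧ (I₀ ≤ i ∧ i < I) ∧
    Test T g T₀ (record ξ h) i ∧ pos h = y with htr
  have hφ0 : ∀ w, 0 ≤ φ w := fun w => mul_nonneg (by linarith [ind_le_one (w.take W = τ)])
    (inv_nonneg.2 (by linarith))
  have htrial := Ex_prod_blocks_le_one T tr φ hφ0 (mean_half_weight_le_one T W hW τ hτ) (I + 1)
  rw [Real.exp_neg, ← one_div]
  refine (Pr_ge_le ((I + 1) * T) _ ?_ (c := Real.exp (p * Q / 8)) (Real.exp_pos _) _ ?_).trans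
    (div_le_div_of_nonneg_right htrial (Real.exp_pos _).le)
  · intro u _
    exact Finset.prod_nonneg fun i _ => add_nonneg (mul_nonneg (ind_nonneg _) (hφ0 _))
      (sub_nonneg.2 (ind_le_one _))
  rintro u hu ⟨hQ, hfew⟩
  set A := selected T g T₀ I₀ I (record ξ u) with hA
  have htr_iff : ∀ i < I, tr (u.take ((i + 1) * T)) ↔ (i ∈ A ∧ stp u ((i + 1) * T) = y) := by
    intro i hi
    have hle : (i + 1) * T ≤ (I + 1) * T := Nat.mul_le_mul_right T (by omega)
    have hlen : (u.take ((i + 1) * T)).length = (i + 1) * T := by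
      rw [List.length_take, min_eq_left (by omega)]
    rw [hA, mem_selected]
    have htest : I₀ ≤ i → (Test T g T₀ (record ξ (u.take ((i + 1) * T))) i ↔
        Test T g T₀ (record ξ u) i) := by
      intro h0
      refine test_congr ?_ fun t ht => ?_
      · exact hT₀.trans ((Nat.mul_le_mul_right T h0).trans (by omega))
      · unfold record
        rw [stp_take _ _ _ (by rw [Nat.succ_mul]; omega)]
    constructor
    · rintro ⟨i', h1, h2, h3, h4⟩
      rw [hlen] at h1
      have : i = i' := by have := Nat.eq_of_mul_eq_mul_right hT h1; omega
      subst this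
      exact ⟨⟨h2, (htest h2.1).1 h3⟩, h4⟩
    · rintro ⟨⟨h2, h3⟩, h4⟩
      exact ⟨i, hlen, h2, (htest h2.1).2 h3, h4⟩
  -- Factor 0 has an empty past and is no trial; factor `i + 1` is the trial after block `i`.
  have htr0 : ¬ tr (u.take (0 * T)) := by
    rintro ⟨i, h, -⟩
    simp at h; omega
  have hfac : ∀ i ∈ Finset.range I, (ind (tr (u.take ((i + 1) * T))) *
      φ ((u.drop ((i + 1) * T)).take T) + (1 - ind (tr (u.take ((i + 1) * T))))) =
      (if i ∈ A ∧ stp u ((i + 1) * T) = y then (1 - p / 2)⁻¹ else 1) *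
      (if i ∈ A ∧ stp u ((i + 1) * T) = y ∧ (u.drop ((i + 1) * T)).take τ.length = τ
        then 1 / 2 else 1) := by
    intro i hi
    rw [ind_congr (htr_iff i (Finset.mem_range.1 hi))]
    by_cases h1 : i ∈ A ∧ stp u ((i + 1) * T) = y
    · rw [ind_of_true h1, if_pos h1]
      simp only [hφ, List.take_take, min_eq_left hW, hτ]
      by_cases h2 : (u.drop ((i + 1) * T)).take W = τ
      · rw [ind_of_true h2, if_pos ⟨h1.1, h1.2, h2⟩]; ring
      · rw [ind_of_false h2, if_neg (fun h => h2 h.2.2)]; ring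
    · rw [ind_of_false h1, if_neg h1, if_neg (fun h => h1 ⟨h.1, h.2.1⟩)]; ring
  have hsub : ∀ (q : ℕ → Prop) [DecidablePred q] [DecidablePred fun i => i ∈ A ∧ q i],
      (Finset.range I).filter (fun i => i ∈ A ∧ q i) = A.filter q := by
    intro q _ _
    ext i
    rw [Finset.mem_filter, Finset.mem_filter, Finset.mem_range]
    constructor
    · rintro ⟨-, h1, h2⟩; exact ⟨h1, h2⟩
    · rintro ⟨h1, h2⟩; exact ⟨(mem_selected.1 h1).1.2, h1, h2⟩
  rw [Finset.prod_range_succ', ind_of_false htr0, Finset.prod_congr rfl hfac,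
    Finset.prod_mul_distrib, Finset.prod_ite, Finset.prod_ite]
  simp only [Finset.prod_const, one_pow, mul_one, zero_mul, sub_zero, zero_add]
  rw [hsub (fun i => stp u ((i + 1) * T) = y), hsub (fun i => stp u ((i + 1) * T) = y ∧
    (u.drop ((i + 1) * T)).take τ.length = τ)]
  have hfew' : ((visitsThen A T u y τ : ℕ) : ℝ) ≤ p * visits A T u y / 2 := by
    have h1 : (2 : ℝ) ^ (W + 1) * visitsThen A T u y τ ≤ visits A T u y := by
      exact_mod_cast hfew.le
    rw [hp, one_div, inv_pow, pow_succ] at *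
    have h2 : (0 : ℝ) < 2 ^ W := by positivity
    rw [inv_mul_eq_div, div_div, le_div_iff₀ (by positivity)]
    linarith
  have key := exp_le_half_weights p hp0.le hp1 (visits A T u y) (visitsThen A T u y τ) hfew'
  refine le_trans (Real.exp_le_exp.2 ?_) key
  have : (Q : ℝ) ≤ visits A T u y := by exact_mod_cast hQ
  gcongr

theorem Pr_not_frequent_le (T g T₀ I₀ I W M Q : ℕ) (hT : 1 ≤ T) (hW : W ≤ T) (hT₀ : T₀ ≤ I₀ * T)
    (ξ : ℤ → Bool) :
    Pr ((I + 1) * T) (fun u => ¬ Frequent (selected T g T₀ I₀ I (record ξ u)) T W M Q u) ≤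
      (2 * M + 1) * 2 ^ W * Real.exp (-((1 / 2) ^ W * Q / 8)) := by
  set s := Finset.Icc (-(M : ℤ)) M ×ˢ bitLists W with hs
  have hcard : (s.card : ℝ) ≤ (2 * M + 1) * 2 ^ W := by
    rw [hs, Finset.card_product]; push_cast; rw [card_Icc_abs]
    gcongr; exact_mod_cast card_bitLists_le W
  calc _ ≤ Pr ((I + 1) * T) (fun u => ∃ i ∈ s,
        Q ≤ visits (selected T g T₀ I₀ I (record ξ u)) T u i.1 ∧
        2 ^ (W + 1) * visitsThen (selected T g T₀ I₀ I (record ξ u)) T u i.1 i.2 <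
        visits (selected T g T₀ I₀ I (record ξ u)) T u i.1) := by
        refine Pr_mono _ fun u _ h => ?_
        unfold Frequent at h
        push Not at h
        obtain ⟨y, hy, hQ, τ, hτ, hlt⟩ := h
        exact ⟨(y, τ), Finset.mem_product.2 ⟨mem_Icc_abs.2 hy, mem_bitLists hτ⟩, hQ, hlt⟩
    _ ≤ _ := Pr_exists_le _ _ _
    _ ≤ ∑ i ∈ s, Real.exp (-((1 / 2) ^ W * Q / 8)) := by
        refine Finset.sum_le_sum fun i hi => ?_
        exact Pr_visitsThen_few_le T g T₀ I₀ I W Q hT hW hT₀ ξ i.1 i.2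
          (length_of_mem_bitLists (Finset.mem_product.1 hi).2)
    _ ≤ _ := by
        rw [Finset.sum_const, nsmul_eq_mul]
        gcongr

/-! ### One scale: parameters and failure probabilities -/

/-- The parameters of the reconstruction at one scale: block length, length of runs, learning time,
first and last block, localization radius, length of the reconstructed piece, number of visits, and
range of the isometries. -/
structure Scale where
  T : ℕ
  g : ℕ
  T₀ : ℕ
  I₀ : ℕ
  I : ℕ
  M : ℕ
  l : ℕ
  Q : ℕ
  D : ℕ

/-- The blocks selected by the color record `χ` at the scale `σ`. -/
noncomputable def Scale.sel (σ : Scale) (χ : ℕ → Bool) : Finset ℕ :=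
  selected σ.T σ.g σ.T₀ σ.I₀ σ.I χ

/-- The typical behavior, at the scale `σ`, of a scenery and the steps of a walk. -/
structure Typical (σ : Scale) (ξ : ℤ → Bool) (u : List Bool) : Prop where
  localized : Localized (σ.sel (record ξ u)) σ.T σ.M u
  frequent : Frequent (σ.sel (record ξ u)) σ.T (16 * σ.l) σ.M σ.Q u
  le_visits : σ.Q ^ (9 * σ.l + 1) ≤ visits (σ.sel (record ξ u)) σ.T u 0
  distinctive_left : Distinctive σ.l (σ.M + 16 * σ.l) ξ (-(5 * σ.l))
  distinctive_right : Distinctive σ.l (σ.M + 16 * σ.l) ξ (5 * σ.l)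
  nonRepetitive : NonRepetitive σ.l σ.D ξ

/-- Confinement before `T₀` (`h4`), few collected levels (`h5`) and failure of far blocks (`h6`)
give localization. Having read all nearby runs (`h7`) and making many loops (`h8`) gives the visits
to the origin. -/
theorem PrJ_not_typical_le (σ : Scale) (N B A : ℕ) (h₀ ε : ℝ) (hT₀ : σ.T₀ ≤ σ.I₀ * σ.T)
    (h1 : ExS N (fun ξ => ind (¬ NonRepetitive σ.l σ.D ξ)) ≤ ε)
    (h2 : ExS N (fun ξ => ind (¬ Distinctive σ.l (σ.M + 16 * σ.l) ξ (-(5 * σ.l)))) ≤ ε)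
    (h3 : ExS N (fun ξ => ind (¬ Distinctive σ.l (σ.M + 16 * σ.l) ξ (5 * σ.l))) ≤ ε)
    (h4 : Pr ((σ.I + 1) * σ.T) (fun u => ∃ t ≤ σ.T₀, (B : ℤ) < |stp u t|) ≤ ε)
    (h5 : ExS N (fun ξ => ind (h₀ < (runLevels σ.g ξ 0 B).card)) ≤ ε)
    (h6 : PrJ N ((σ.I + 1) * σ.T) (fun ξ u => ∃ i ∈ Finset.Ico σ.I₀ σ.I,
      (∀ t ≤ σ.T₀, |stp u t| ≤ B) ∧ ((runLevels σ.g ξ 0 B).card : ℝ) ≤ h₀ ∧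
      Test σ.T σ.g σ.T₀ (record ξ u) i ∧ (σ.M : ℤ) < |stp u ((i + 1) * σ.T)|) ≤ ε)
    (h7 : PrJ N ((σ.I + 1) * σ.T) (fun ξ u => ¬ AllRead σ.g σ.T₀ A ξ u) ≤ ε)
    (h8 : Pr ((σ.I + 1) * σ.T)
      (fun u => loopCount A σ.T σ.I u < (σ.Q ^ (9 * σ.l + 1) + σ.I₀ : ℕ)) ≤ ε)
    (h9 : ∀ ξ, Pr ((σ.I + 1) * σ.T)
      (fun u => ¬ Frequent (σ.sel (record ξ u)) σ.T (16 * σ.l) σ.M σ.Q u) ≤ ε) :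
    PrJ N ((σ.I + 1) * σ.T) (fun ξ u => ¬ Typical σ ξ u) ≤ 9 * ε := by
  set n := (σ.I + 1) * σ.T with hn
  have g1 := (PrJ_scenery N n _).le.trans h1
  have g2 := (PrJ_scenery N n _).le.trans h2
  have g3 := (PrJ_scenery N n _).le.trans h3
  have g4 := (PrJ_walk_le N n _).trans h4
  have g5 := (PrJ_scenery N n _).le.trans h5
  have g8 := (PrJ_walk_le N n _).trans h8
  have g9 : PrJ N n (fun ξ u => ¬ Frequent (σ.sel (record ξ u)) σ.T (16 * σ.l) σ.M σ.Q u) ≤ ε :=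
    ExS_le_const N h9
  have comb : ∀ {p q : (ℤ → Bool) → List Bool → Prop} {a b : ℝ}, PrJ N n p ≤ a → PrJ N n q ≤ b →
      PrJ N n (fun ξ u => p ξ u ∨ q ξ u) ≤ a + b := fun hp hq =>
    (PrJ_or_le N n _ _).trans (add_le_add hp hq)
  have all := comb g1 (comb g2 (comb g3 (comb g4 (comb g5 (comb h6 (comb h7 (comb g8 g9)))))))
  refine le_trans (PrJ_mono N n fun ξ u hu h => ?_) (all.trans (by linarith))
  by_contra hcon
  push Not at hcon
  obtain ⟨c1, c2, c3, c4, c5, c6, c7, c8, c9⟩ := hcon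
  refine h ⟨fun i hi => ?_, c9, ?_, c2, c3, c1⟩
  · obtain ⟨hiI, htest⟩ := mem_selected.1 hi
    exact c6 i (Finset.mem_Ico.2 hiI) c4 c5 htest
  · exact le_visits_of_loopCount c7 (by rw [hu, hn, Nat.succ_mul]; omega) hT₀ c8

theorem exp_neg_le_half_pow {x : ℝ} {n : ℕ} (h : (n : ℝ) ≤ x) : Real.exp (-x) ≤ (1 / 2) ^ n := by
  have h2 : (2 : ℝ) ≤ Real.exp 1 := by have := Real.exp_one_gt_d9; linarith
  calc Real.exp (-x) ≤ Real.exp (-n) := Real.exp_le_exp.2 (by linarith)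
    _ = (Real.exp 1 ^ n)⁻¹ := by rw [Real.exp_neg, ← Real.exp_nat_mul, mul_one]
    _ ≤ (2 ^ n)⁻¹ := by gcongr
    _ = _ := by rw [one_div, inv_pow]

theorem eventually_pow_le_two_pow (K : ℕ) : ∀ᶠ b : ℕ in Filter.atTop, b ^ K ≤ 2 ^ b := by
  have h := tendsto_pow_const_div_const_pow_of_one_lt K (r := (2 : ℝ)) (by norm_num)
  filter_upwards [h.eventually (gt_mem_nhds (zero_lt_one))] with b hb
  rw [div_lt_one (by positivity)] at hb
  exact_mod_cast hb.le

/-- The length of the piece reconstructed at scale `m`. -/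
def scaleLength (m : ℕ) : ℕ := 2 ^ m * ((2 ^ m) ^ 22 * (20 * m))

/-- The localization radius at scale `m`. -/
def scaleRadius (m : ℕ) : ℕ := (2 ^ m) ^ 1200

/-- The parameters at scale `m`, mostly powers of `2 ^ m`. -/
def scale (m : ℕ) : Scale where
  -- With b = 2^m, the walk spreads over b^488 in time b^976 and over b^585 in time b^1170. Loops
  -- are confined to radius b^489 and the learning phase to b^586, one factor b more.
  T := 2 * (2 ^ m) ^ 976
  -- 2^g = b^400, so the interval of radius b^586 has about b^186 runs, and the one of radius b^489
  -- about b^89.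
  g := 400 * m
  T₀ := 2 * (2 ^ m) ^ 1170
  I₀ := (2 ^ m) ^ 194
  -- Among this many blocks the walk makes about √I = 2^(b^54) loops at the origin, up to powers of
  -- b. That exceeds the 2^(b^53) that suffice, while `I` is small against the reciprocal 4^(b^55)
  -- of the failure probability of one block.
  I := 4 ^ (2 ^ m) ^ 54
  M := scaleRadius m
  l := scaleLength m
  Q := 2 ^ (16 * scaleLength m + 1) * (2 * scaleRadius m + 1)
  -- Large enough for the isometries found at the next scale, so that they can be compared with
  -- those of this one.
  D := 2 * (scaleRadius (m + 1) + 16 * scaleLength (m + 1))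

/-- The half-width of the window of the scenery that matters at scale `m`. -/
def scaleWidth (m : ℕ) : ℕ :=
  ((scale m).I + 1) * (scale m).T + (2 ^ m) ^ 55 * ((2 ^ m) ^ 402 * (400 * m)) + (scale m).D +
    (scale m).M + 21 * (scale m).l + (2 ^ m) ^ 586 + (2 ^ m) ^ 489 + (scale m).g + 1

/-- The scale is large enough for the estimates. -/
structure LargeScale (m b : ℕ) : Prop where
  eq : b = 2 ^ m
  one_le : 1 ≤ m
  le : m ≤ b
  big : 1000000 ≤ b
  pow_le : b ^ 10000 ≤ 2 ^ b

namespace LargeScale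

variable {m b : ℕ}

theorem mul_pow_le (h : LargeScale m b) {c : ℕ} (k : ℕ) (hc : c ≤ 1000000) :
    c * b ^ k ≤ b ^ (k + 1) := by
  rw [pow_succ']; exact Nat.mul_le_mul_right _ (hc.trans h.big)

theorem pow_le_pow (h : LargeScale m b) {j k : ℕ} (hjk : j ≤ k) : b ^ j ≤ b ^ k :=
  Nat.pow_le_pow_right (by have := h.big; omega) hjk

theorem pos (h : LargeScale m b) : (0 : ℝ) < b := by
  have := h.big; exact_mod_cast (by omega : 0 < b)

/-- Absorbs polynomial factors into exponentially small failure probabilities. -/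
theorem mul_half_pow_le (h : LargeScale m b) {c : ℕ} (hc : c ≤ b ^ 9999) :
    (c : ℝ) * (1 / 2) ^ b ≤ 1 / b := by
  have hb := h.pos
  have h1 : c * b ≤ 2 ^ b := by
    calc c * b ≤ b ^ 9999 * b := Nat.mul_le_mul_right _ hc
      _ = b ^ 10000 := (pow_succ _ _).symm
      _ ≤ _ := h.pow_le
  have h2 : (c : ℝ) * b ≤ 2 ^ b := by exact_mod_cast h1
  rw [one_div, inv_pow, ← div_eq_mul_inv, div_le_div_iff₀ (by positivity) hb]
  linarith

theorem half_pow (h : LargeScale m b) (k : ℕ) : (1 / 2 : ℝ) ^ (k * m) = 1 / b ^ k := by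
  rw [h.eq, mul_comm, pow_mul]; push_cast; rw [one_div_pow, one_div_pow]

theorem two_pow (h : LargeScale m b) (k : ℕ) : 2 ^ (k * m) = b ^ k := by
  rw [h.eq, mul_comm, pow_mul]

theorem length_eq (h : LargeScale m b) : scaleLength m = b * (b ^ 22 * (20 * m)) := by
  rw [h.eq]; rfl

theorem le_length (h : LargeScale m b) : b ≤ scaleLength m := by
  rw [h.length_eq]
  have := h.big
  have := h.one_le
  exact Nat.le_mul_of_pos_right b (by positivity)

theorem length_le (h : LargeScale m b) : scaleLength m ≤ b ^ 25 := by
  rw [h.length_eq]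
  calc b * (b ^ 22 * (20 * m)) ≤ b * (b ^ 22 * (20 * b)) := by gcongr; exact h.le
    _ = 20 * b ^ 24 := by ring
    _ ≤ _ := h.mul_pow_le 24 (by norm_num)

theorem radius_eq (h : LargeScale m b) : scaleRadius m = b ^ 1200 := by rw [h.eq]; rfl

theorem range_le (h : LargeScale m b) : (scale m).D ≤ b ^ 2500 := by
  have h2 : 2 ^ (m + 1) ≤ b ^ 2 := by
    rw [pow_succ, ← h.eq, pow_two]; exact Nat.mul_le_mul_left _ (by have := h.big; omega)
  have h1 : scaleRadius (m + 1) ≤ b ^ 2400 := by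
    calc scaleRadius (m + 1) ≤ (b ^ 2) ^ 1200 := Nat.pow_le_pow_left h2 _
      _ = b ^ 2400 := by rw [← pow_mul]
  have h3 : scaleLength (m + 1) ≤ b ^ 50 := by
    unfold scaleLength
    calc 2 ^ (m + 1) * ((2 ^ (m + 1)) ^ 22 * (20 * (m + 1)))
        ≤ b ^ 2 * ((b ^ 2) ^ 22 * (20 * (b + b))) := by
          gcongr
          · exact h.le
          · have := h.big; omega
      _ = 40 * b ^ 47 := by ring
      _ ≤ b ^ 48 := h.mul_pow_le 47 (by norm_num)
      _ ≤ _ := h.pow_le_pow (by norm_num)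
  have h4 : b ^ 50 ≤ b ^ 2400 := h.pow_le_pow (by norm_num)
  have h5 : 34 * b ^ 2400 ≤ b ^ 2401 := h.mul_pow_le 2400 (by norm_num)
  have h6 : b ^ 2401 ≤ b ^ 2500 := h.pow_le_pow (by norm_num)
  change 2 * (scaleRadius (m + 1) + 16 * scaleLength (m + 1)) ≤ _
  linarith

theorem nonRepetitive (h : LargeScale m b) :
    ExS (scaleWidth m) (fun ξ => ind (¬ NonRepetitive (scale m).l (scale m).D ξ)) ≤ 1 / b := by
  have hN : (scale m).D + (scale m).l + 1 ≤ scaleWidth m := by unfold scaleWidth; omega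
  refine (ExS_not_nonRepetitive_le _ _ _ hN).trans ?_
  have h1 : 2 * (2 * (scale m).D + 1) ^ 2 ≤ b ^ 9999 := by
    have hD := h.range_le
    have h1 : 1 ≤ b ^ 2500 := Nat.one_le_pow _ _ (by have := h.big; omega)
    calc 2 * (2 * (scale m).D + 1) ^ 2 ≤ 2 * (2 * b ^ 2500 + b ^ 2500) ^ 2 := by gcongr
      _ = 18 * b ^ 5000 := by ring
      _ ≤ b ^ 5001 := h.mul_pow_le _ (by norm_num)
      _ ≤ _ := h.pow_le_pow (by norm_num)
  refine le_trans ?_ (h.mul_half_pow_le h1)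
  push_cast
  exact mul_le_mul_of_nonneg_left (pow_le_pow_of_le_one (by norm_num) (by norm_num) h.le_length)
    (by positivity)

theorem sqrt_pow (h : LargeScale m b) (k : ℕ) : Real.sqrt ((b ^ (2 * k) : ℕ) : ℝ) = b ^ k := by
  push_cast
  rw [mul_comm, pow_mul]
  exact Real.sqrt_sq (pow_pos h.pos k).le

theorem distinctive (h : LargeScale m b) (x : ℤ) (hx : |x| ≤ 5 * (scale m).l) :
    ExS (scaleWidth m) (fun ξ => ind (¬ Distinctive (scale m).l
      ((scale m).M + 16 * (scale m).l) ξ x)) ≤ 1 / b := by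
  have hm := h.le
  have hm1 := h.one_le
  have hbig := h.big
  have hb := h.pos
  have hl : (scale m).l = b * (b ^ 22 * (20 * m)) := h.length_eq
  -- Shorter runs are used here: length 20m, with 2^(20m) = b^20. The square root b^11 of the number
  -- of blocks dominates the admitted number of levels, about m b^8.
  have main := ExS_not_distinctive_le (scaleWidth m) (20 * m) (b ^ 22) b (b ^ 8)
    ((scale m).M + 16 * (scale m).l) (scale m).l (by omega) (by omega) hl
    (by
      rw [h.two_pow]
      calc 6 * b ^ 20 ≤ b ^ 21 := h.mul_pow_le _ (by norm_num)
        _ ≤ _ := h.pow_le_pow (by norm_num))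
    (by
      rw [show 22 = 2 * 11 by norm_num, h.sqrt_pow]
      have h1 : 2560 * m * b ^ 8 ≤ b ^ 11 := by
        calc 2560 * m * b ^ 8 ≤ 2560 * b * b ^ 8 := by gcongr
          _ = 2560 * b ^ 9 := by ring
          _ ≤ b ^ 10 := h.mul_pow_le _ (by norm_num)
          _ ≤ _ := h.pow_le_pow (by norm_num)
      have h2 : (2560 * m * b ^ 8 : ℝ) ≤ b ^ 11 := by exact_mod_cast h1
      push_cast; linarith)
    x (by unfold scaleWidth; push_cast; have : (0 : ℤ) ≤ (scale m).l := by positivity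
          linarith [show (0 : ℤ) ≤ (((scale m).I : ℤ) + 1) * (scale m).T by positivity,
            show (0 : ℤ) ≤ (2 ^ m) ^ 55 * ((2 ^ m) ^ 402 * (400 * m)) by positivity,
            show (0 : ℤ) ≤ (scale m).D by positivity, show (0 : ℤ) ≤ (scale m).M by positivity,
            show (0 : ℤ) ≤ (2 ^ m) ^ 586 by positivity, show (0 : ℤ) ≤ (2 ^ m) ^ 489 by positivity,
            show (0 : ℤ) ≤ (scale m).g by positivity])
    (by unfold scaleWidth; omega)
  refine main.trans ?_
  rw [h.half_pow]
  have e1 : (1 + 1 / (b : ℝ) ^ 20) ^ (3 * b * b ^ 22) / 2 ^ b ^ 8 ≤ (1 / 2) ^ b := by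
    have h1 : (1 + 1 / (b : ℝ) ^ 20) ^ (3 * b * b ^ 22) ≤ 2 ^ (6 * b ^ 3) := by
      calc (1 + 1 / (b : ℝ) ^ 20) ^ (3 * b * b ^ 22)
          ≤ Real.exp (1 / (b : ℝ) ^ 20) ^ (3 * b * b ^ 22) := by
            gcongr
            have := Real.add_one_le_exp (1 / (b : ℝ) ^ 20); linarith
        _ = Real.exp 1 ^ (3 * b ^ 3) := by
            rw [← Real.exp_nat_mul, ← Real.exp_nat_mul]
            congr 1
            push_cast; field_simp
        _ ≤ 4 ^ (3 * b ^ 3) := by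
            gcongr
            have := Real.exp_one_lt_d9; linarith
        _ = _ := by
            rw [show (4 : ℝ) = 2 ^ 2 by norm_num, ← pow_mul]; congr 1; ring
    have h2 : 6 * b ^ 3 + b ≤ b ^ 8 := by
      have h3 : b ^ 1 ≤ b ^ 3 := h.pow_le_pow (by norm_num)
      have h4 : 7 * b ^ 3 ≤ b ^ 4 := h.mul_pow_le _ (by norm_num)
      have h5 : b ^ 4 ≤ b ^ 8 := h.pow_le_pow (by norm_num)
      linarith
    rw [one_div_pow (2 : ℝ) b, div_le_div_iff₀ (by positivity) (by positivity), one_mul]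
    calc _ ≤ (2 : ℝ) ^ (6 * b ^ 3) * 2 ^ b := by gcongr
      _ = 2 ^ (6 * b ^ 3 + b) := (pow_add _ _ _).symm
      _ ≤ _ := pow_le_pow_right₀ (by norm_num) h2
  have e2 : (1 / 4 : ℝ) ^ b ≤ (1 / 2) ^ b := by gcongr; norm_num
  have h1 : (2 * (b ^ 1200 + 16 * b ^ 25) + 1) * (40 * b + 1) ≤ b ^ 9999 := by
    have i1 : b ^ 25 ≤ b ^ 1200 := h.pow_le_pow (by norm_num)
    have i2 : 1 ≤ b ^ 1200 := Nat.one_le_pow _ _ (by omega)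
    calc _ ≤ (35 * b ^ 1200) * (41 * b) := Nat.mul_le_mul (by linarith) (by omega)
      _ = 1435 * b ^ 1201 := by ring
      _ ≤ b ^ 1202 := h.mul_pow_le _ (by norm_num)
      _ ≤ _ := h.pow_le_pow (by norm_num)
  refine le_trans ?_ (h.mul_half_pow_le h1)
  have hM : ((scale m).M : ℝ) = b ^ 1200 := by exact_mod_cast h.radius_eq
  have hL : ((scale m).l : ℝ) ≤ b ^ 25 := by exact_mod_cast h.length_le
  have hm' : (m : ℝ) ≤ b := by exact_mod_cast hm
  push_cast
  rw [hM]
  calc _ ≤ (2 * ((b : ℝ) ^ 1200 + 16 * b ^ 25) + 1) *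
        (2 * (20 * b * (1 / 2) ^ b) + (1 / 2) ^ b) := by gcongr
    _ = _ := by ring

theorem sel_eq (h : LargeScale m b) : (scale m).T = 2 * b ^ 976 ∧ (scale m).T₀ = 2 * b ^ 1170 ∧
    (scale m).I₀ = b ^ 194 ∧ (scale m).I = 4 ^ b ^ 54 := by
  rw [h.eq]; exact ⟨rfl, rfl, rfl, rfl⟩

theorem first_block (h : LargeScale m b) : (scale m).T₀ = (scale m).I₀ * (scale m).T := by
  obtain ⟨h1, h2, h3, -⟩ := h.sel_eq
  rw [h1, h2, h3]; ring

theorem exp_sq_le (h : LargeScale m b) : Real.exp (-((b : ℝ) ^ 2 / 4)) ≤ (1 / 2) ^ b := by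
  refine exp_neg_le_half_pow ?_
  have : (1000000 : ℝ) ≤ b := by exact_mod_cast h.big
  nlinarith

theorem first_block_lt (h : LargeScale m b) : (scale m).I₀ < (scale m).I := by
  obtain ⟨-, -, h3, h4⟩ := h.sel_eq
  rw [h3, h4]
  calc b ^ 194 ≤ b ^ 10000 := h.pow_le_pow (by norm_num)
    _ ≤ 2 ^ b := h.pow_le
    _ ≤ 2 ^ b ^ 54 := Nat.pow_le_pow_right (by norm_num)
      (by simpa using h.pow_le_pow (show 1 ≤ 54 by norm_num))
    _ < 4 ^ b ^ 54 := Nat.pow_lt_pow_left (by norm_num)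
      (pow_ne_zero _ (by have := h.big; omega))

theorem confined (h : LargeScale m b) : Pr (((scale m).I + 1) * (scale m).T)
    (fun u => ∃ t ≤ (scale m).T₀, ((b ^ 586 : ℕ) : ℤ) < |stp u t|) ≤ 1 / b := by
  have hb := h.pos
  have hbig := h.big
  have hle : (scale m).T₀ ≤ ((scale m).I + 1) * (scale m).T := by
    rw [h.first_block]; exact Nat.mul_le_mul_right _ (by have := h.first_block_lt; omega)
  obtain ⟨-, h2, -, -⟩ := h.sel_eq
  have e := Pr_exists_abs_pos_gt_le (scale m).T₀ (b ^ 586) (by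
    rw [h2]; have := Nat.one_le_pow 1170 b (by omega); omega)
  rw [← Pr_prefix _ (((scale m).I + 1) * (scale m).T - (scale m).T₀), Nat.add_sub_cancel' hle] at e
  have h1 : 2 * (2 * b ^ 1170 + 1) ≤ b ^ 9999 := by
    have i1 : 6 * b ^ 1170 ≤ b ^ 1171 := h.mul_pow_le _ (by norm_num)
    have i2 : 1 ≤ b ^ 1170 := Nat.one_le_pow _ _ (by omega)
    have i3 : b ^ 1171 ≤ b ^ 9999 := h.pow_le_pow (by norm_num)
    linarith
  refine le_trans (le_trans (Pr_mono _ fun u _ ⟨t, ht, hp⟩ => ⟨t, ht, ?_⟩) e) ?_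
  · refine le_trans ?_ (h.mul_half_pow_le h1)
    rw [h2]
    push_cast
    rw [show ((b : ℝ) ^ 586) ^ 2 / (2 * (2 * b ^ 1170)) = b ^ 2 / 4 by field_simp; norm_num]
    gcongr
    exact h.exp_sq_le
  · rw [List.take_take, min_eq_left ht]; exact hp

theorem card_runLevels (h : LargeScale m b) : ExS (scaleWidth m)
    (fun ξ => ind ((b : ℝ) ^ 190 < (runLevels (scale m).g ξ 0 (b ^ 586)).card)) ≤ 1 / b := by
  have hb := h.pos
  have hb1 : (1000000 : ℝ) ≤ b := by exact_mod_cast h.big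
  have hw : b ^ 586 + (scale m).g + 1 ≤ scaleWidth m := by
    unfold scaleWidth; rw [← h.eq]; omega
  refine (ExS_card_runLevels_ge_le _ _ _ _ (by positivity) 0 (by omega)
    (by push_cast at hw ⊢; zify at hw; linarith)).trans ?_
  rw [show (scale m).g = 400 * m from rfl, h.half_pow]
  push_cast
  have i2 : (1 : ℝ) ≤ b ^ 586 := one_le_pow₀ (by linarith)
  calc 2 * (2 * (b : ℝ) ^ 586 + 1) * (1 / (b : ℝ) ^ 400) / (b : ℝ) ^ 190
      ≤ (2 * (3 * (b : ℝ) ^ 586)) * (1 / (b : ℝ) ^ 400) / (b : ℝ) ^ 190 := by gcongr; linarith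
    _ = 6 / (b : ℝ) ^ 4 := by field_simp; norm_num
    _ ≤ 1 / (b : ℝ) := by
      rw [div_le_div_iff₀ (by positivity) hb]
      have : (b : ℝ) * 6 ≤ b * b ^ 3 := by
        gcongr
        calc (6 : ℝ) ≤ b := by linarith
          _ = b ^ 1 := (pow_one _).symm
          _ ≤ b ^ 3 := pow_le_pow_right₀ (by linarith) (by norm_num)
      calc (6 : ℝ) * b ≤ b * b ^ 3 := by linarith
        _ = 1 * b ^ 4 := by ring

end LargeScale

namespace LargeScale

variable {m b : ℕ}

theorem one_le_pow (h : LargeScale m b) (k : ℕ) : 1 ≤ b ^ k :=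
  Nat.one_le_pow _ _ (by have := h.big; omega)

/-- The distance `j` is at most 400 b^458 and 2^g = b^400; both are small against b^460, the spread
of the walk in time b^920. -/
theorem read (h : LargeScale m b) (j : ℕ) (hj : j ≤ b ^ 55 * (b ^ 402 * (400 * m))) :
    Pr (2 * b ^ 920) (NotRead j (scale m).g) ≤ 1 / 2 := by
  have e := Pr_notRead_le (b ^ 920) (scale m).g (h.one_le_pow _) j
  rw [← two_mul] at e
  refine e.trans ?_
  rw [show 920 = 2 * 460 by norm_num, h.sqrt_pow, show (scale m).g = 400 * m from rfl]
  have h1 : 4 * (j + 400 * m) + 8 * 2 ^ (400 * m) ≤ b ^ 460 := by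
    rw [h.two_pow]
    have i1 : j ≤ 400 * b ^ 458 := by
      calc j ≤ b ^ 55 * (b ^ 402 * (400 * m)) := hj
        _ ≤ b ^ 55 * (b ^ 402 * (400 * b)) := by gcongr; exact h.le
        _ = _ := by ring
    have i2 : m ≤ b ^ 458 := h.le.trans (by simpa using h.pow_le_pow (show 1 ≤ 458 by norm_num))
    have i3 : b ^ 400 ≤ b ^ 458 := h.pow_le_pow (by norm_num)
    have i4 : 4000 * b ^ 458 ≤ b ^ 459 := h.mul_pow_le _ (by norm_num)
    have i5 : b ^ 459 ≤ b ^ 460 := h.pow_le_pow (by norm_num)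
    linarith
  have h2 : (4 * ((j : ℝ) + 400 * m) + 8 * 2 ^ (400 * m)) ≤ b ^ 460 := by exact_mod_cast h1
  rw [div_le_div_iff₀ (pow_pos h.pos _) (by norm_num)]
  push_cast
  rw [abs_of_nonneg (by positivity)]
  linarith

/-- Fewer than 4^(b^54) blocks, each failing with probability 4^(-b^55) + 2^(-b^56) up to powers of
b. -/
theorem far (h : LargeScale m b) : PrJ (scaleWidth m) (((scale m).I + 1) * (scale m).T)
    (fun ξ u => ∃ i ∈ Finset.Ico (scale m).I₀ (scale m).I,
      (∀ t ≤ (scale m).T₀, |stp u t| ≤ ((b ^ 586 : ℕ) : ℤ)) ∧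
      ((runLevels (scale m).g ξ 0 (b ^ 586)).card : ℝ) ≤ (b : ℝ) ^ 190 ∧
      Test (scale m).T (scale m).g (scale m).T₀ (record ξ u) i ∧
      ((scale m).M : ℤ) < |stp u ((i + 1) * (scale m).T)|) ≤ 1 / b := by
  have hb := h.pos
  have hbig := h.big
  obtain ⟨hT, hT₀, hI₀, hI⟩ := h.sel_eq
  have each := PrJ_exists_le (scaleWidth m) (((scale m).I + 1) * (scale m).T)
    (Finset.Ico (scale m).I₀ (scale m).I) (fun i ξ u =>
      (∀ t ≤ (scale m).T₀, |stp u t| ≤ ((b ^ 586 : ℕ) : ℤ)) ∧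
      ((runLevels (scale m).g ξ 0 (b ^ 586)).card : ℝ) ≤ (b : ℝ) ^ 190 ∧
      Test (scale m).T (scale m).g (scale m).T₀ (record ξ u) i ∧
      ((scale m).M : ℤ) < |stp u ((i + 1) * (scale m).T)|)
    (c := (2 * ((scale m).T : ℝ) + 1) ^ 2 * (1 / 4) ^ b ^ 55 + (1 / 2) ^ b ^ 56) (by
      intro i hi
      obtain ⟨hi1, hi2⟩ := Finset.mem_Ico.1 hi
      have hlen : ((scale m).I + 1) * (scale m).T =
          i * (scale m).T + ((scale m).T + ((scale m).I - i) * (scale m).T) := by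
        conv_lhs => rw [show (scale m).I + 1 = i + (1 + ((scale m).I - i)) by omega]
        ring
      rw [hlen]
      refine PrJ_test_far_le (scaleWidth m) (scale m).T (scale m).g (scale m).T₀ (b ^ 586)
        (b ^ 55 * (b ^ 402 * (400 * m))) (b ^ 56) (2 * b ^ 920) i (scale m).M (b ^ 402) (b ^ 55)
        _ ((b : ℝ) ^ 190) (by rw [hT]; ring) ?_ ?_ ?_ ?_ rfl h.read ?_ ?_
      · rw [h.first_block]; exact Nat.mul_le_mul_right _ hi1
      · have := h.one_le; change 1 ≤ 400 * m; omega
      · change 6 * 2 ^ (400 * m) ≤ _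
        rw [h.two_pow]
        calc 6 * b ^ 400 ≤ b ^ 401 := h.mul_pow_le _ (by norm_num)
          _ ≤ _ := h.pow_le_pow (by norm_num)
      · rw [show 402 = 2 * 201 by norm_num, h.sqrt_pow]
        have : 64 * b ^ 190 ≤ b ^ 201 := (h.mul_pow_le 190 (by norm_num)).trans
          (h.pow_le_pow (by norm_num))
        exact_mod_cast this
      · rw [hT, show (scale m).M = b ^ 1200 from h.radius_eq]
        have i1 : b ^ 55 * (b ^ 402 * (400 * m)) ≤ 400 * b ^ 976 := by
          calc b ^ 55 * (b ^ 402 * (400 * m)) ≤ b ^ 55 * (b ^ 402 * (400 * b)) := by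
                gcongr; exact h.le
            _ = 400 * b ^ 458 := by ring
            _ ≤ _ := Nat.mul_le_mul_left _ (h.pow_le_pow (by norm_num))
        have i2 : b ^ 586 ≤ b ^ 976 := h.pow_le_pow (by norm_num)
        have i3 : 405 * b ^ 976 ≤ b ^ 977 := h.mul_pow_le _ (by norm_num)
        have i4 : b ^ 977 ≤ b ^ 1200 := h.pow_le_pow (by norm_num)
        linarith
      · have hw : ((scale m).I + 1) * (scale m).T + b ^ 55 * (b ^ 402 * (400 * m)) ≤
            scaleWidth m := by
          unfold scaleWidth; rw [← h.eq]; omega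
        have : i * (scale m).T + (scale m).T ≤ ((scale m).I + 1) * (scale m).T := by
          rw [← Nat.succ_mul]; exact Nat.mul_le_mul_right _ (by omega)
        omega)
  refine each.trans ?_
  rw [Nat.card_Ico]
  have c1 : (((scale m).I - (scale m).I₀ : ℕ) : ℝ) ≤ 4 ^ b ^ 54 := by
    have : (scale m).I - (scale m).I₀ ≤ 4 ^ b ^ 54 := by rw [hI]; omega
    exact_mod_cast this
  have c2 : (4 : ℝ) ^ b ^ 54 * (1 / 4) ^ b ^ 55 ≤ (1 / 2) ^ b := by
    have : b ^ 54 + b ≤ b ^ 55 := by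
      have i1 : b ^ 1 ≤ b ^ 54 := h.pow_le_pow (by norm_num)
      have i2 : 2 * b ^ 54 ≤ b ^ 55 := h.mul_pow_le _ (by norm_num)
      linarith
    calc (4 : ℝ) ^ b ^ 54 * (1 / 4) ^ b ^ 55 ≤ 4 ^ b ^ 54 * (1 / 4) ^ (b ^ 54 + b) := by
          refine mul_le_mul_of_nonneg_left
            (pow_le_pow_of_le_one (by norm_num) (by norm_num) this) (by positivity)
      _ = (1 / 4) ^ b := by
          rw [pow_add, ← mul_assoc, ← mul_pow]; norm_num
      _ ≤ _ := by gcongr; norm_num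
  have c3 : (4 : ℝ) ^ b ^ 54 * (1 / 2) ^ b ^ 56 ≤ (1 / 2) ^ b := by
    have : 2 * b ^ 54 + b ≤ b ^ 56 := by
      have i1 : b ^ 1 ≤ b ^ 54 := h.pow_le_pow (by norm_num)
      have i2 : 3 * b ^ 54 ≤ b ^ 55 := h.mul_pow_le _ (by norm_num)
      have i3 : b ^ 55 ≤ b ^ 56 := h.pow_le_pow (by norm_num)
      linarith
    calc (4 : ℝ) ^ b ^ 54 * (1 / 2) ^ b ^ 56 ≤ 4 ^ b ^ 54 * (1 / 2) ^ (2 * b ^ 54 + b) := by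
          refine mul_le_mul_of_nonneg_left
            (pow_le_pow_of_le_one (by norm_num) (by norm_num) this) (by positivity)
      _ = _ := by
          rw [pow_add, ← mul_assoc, pow_mul, ← mul_pow]; norm_num
  have h1 : (4 * b ^ 976 + 1) ^ 2 + 1 ≤ b ^ 9999 := by
    have i1 := h.one_le_pow 976
    have i2 := h.one_le_pow 1952
    calc (4 * b ^ 976 + 1) ^ 2 + 1 ≤ (4 * b ^ 976 + b ^ 976) ^ 2 + b ^ 1952 := by gcongr
      _ = 26 * b ^ 1952 := by ring
      _ ≤ b ^ 1953 := h.mul_pow_le _ (by norm_num)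
      _ ≤ _ := h.pow_le_pow (by norm_num)
  refine le_trans ?_ (h.mul_half_pow_le h1)
  rw [hT]
  push_cast
  calc _ ≤ (4 : ℝ) ^ b ^ 54 *
        ((2 * (2 * (b : ℝ) ^ 976) + 1) ^ 2 * (1 / 4) ^ b ^ 55 + (1 / 2) ^ b ^ 56) := by gcongr
    _ = (2 * (2 * (b : ℝ) ^ 976) + 1) ^ 2 * (4 ^ b ^ 54 * (1 / 4) ^ b ^ 55) +
        4 ^ b ^ 54 * (1 / 2) ^ b ^ 56 := by
          generalize (4 : ℝ) ^ b ^ 54 = X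
          generalize (1 / 4 : ℝ) ^ b ^ 55 = Y
          generalize (1 / 2 : ℝ) ^ b ^ 56 = Z
          ring
    _ ≤ (2 * (2 * (b : ℝ) ^ 976) + 1) ^ 2 * (1 / 2) ^ b + (1 / 2) ^ b := by gcongr
    _ = _ := by ring

/-- The exponents of b add up to 489 - 400 + (489 - 585) = -7: number of sites, density of runs,
chance of missing one. -/
theorem allRead (h : LargeScale m b) : PrJ (scaleWidth m) (((scale m).I + 1) * (scale m).T)
    (fun ξ u => ¬ AllRead (scale m).g (scale m).T₀ (b ^ 489) ξ u) ≤ 1 / b := by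
  have hb := h.pos
  have hb1 : (1000000 : ℝ) ≤ b := by exact_mod_cast h.big
  have hle : (scale m).T₀ ≤ ((scale m).I + 1) * (scale m).T := by
    rw [h.first_block]; exact Nat.mul_le_mul_right _ (by have := h.first_block_lt; omega)
  obtain ⟨-, hT₀, -, -⟩ := h.sel_eq
  have hT₀' : (scale m).T₀ = b ^ 1170 + b ^ 1170 := by rw [hT₀]; ring
  have hw : b ^ 489 + (scale m).g ≤ scaleWidth m := by
    unfold scaleWidth; rw [← h.eq]; omega
  have e := PrJ_not_allRead_le (scaleWidth m) (scale m).g (b ^ 1170)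
    (((scale m).I + 1) * (scale m).T - (scale m).T₀) (b ^ 489) (h.one_le_pow _) hw
  rw [← hT₀', Nat.add_sub_cancel' hle] at e
  refine e.trans ?_
  rw [show 1170 = 2 * 585 by norm_num, h.sqrt_pow, show (scale m).g = 400 * m from rfl, h.half_pow]
  have e2 : (2 : ℝ) ^ (400 * m) = (b : ℝ) ^ 400 := by exact_mod_cast h.two_pow 400
  rw [e2]
  push_cast
  have i1 : (1 : ℝ) ≤ (b : ℝ) ^ 489 := one_le_pow₀ (by linarith)
  have i2 : (m : ℝ) ≤ (b : ℝ) ^ 489 := by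
    calc (m : ℝ) ≤ b := by exact_mod_cast h.le
      _ = (b : ℝ) ^ 1 := (pow_one _).symm
      _ ≤ _ := pow_le_pow_right₀ (by linarith) (by norm_num)
  have i3 : (b : ℝ) ^ 400 ≤ (b : ℝ) ^ 489 := pow_le_pow_right₀ (by linarith) (by norm_num)
  calc 2 * (2 * (b : ℝ) ^ 489 + 1) * (1 / (b : ℝ) ^ 400 *
        ((2 * ((b : ℝ) ^ 489 + 400 * m) + 4 * (b : ℝ) ^ 400) / (b : ℝ) ^ 585))
      ≤ 2 * (3 * (b : ℝ) ^ 489) * (1 / (b : ℝ) ^ 400 *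
        ((806 * (b : ℝ) ^ 489) / (b : ℝ) ^ 585)) := by
        gcongr
        · linarith
        · linarith
    _ = 4836 / (b : ℝ) ^ 7 := by field_simp; norm_num
    _ ≤ 1 / (b : ℝ) := by
      rw [div_le_div_iff₀ (by positivity) hb]
      have : (b : ℝ) * 4836 ≤ b * (b : ℝ) ^ 6 := by
        gcongr
        calc (4836 : ℝ) ≤ b := by linarith
          _ = (b : ℝ) ^ 1 := (pow_one _).symm
          _ ≤ _ := pow_le_pow_right₀ (by linarith) (by norm_num)
      calc (4836 : ℝ) * b ≤ b * (b : ℝ) ^ 6 := by linarith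
        _ = 1 * (b : ℝ) ^ 7 := by ring

/-- `Q` and the exponent 9l + 1 are at most 2^(b^26) and b^26, so the power is at most 2^(b^52). -/
theorem visits_bound (h : LargeScale m b) :
    (scale m).Q ^ (9 * (scale m).l + 1) + (scale m).I₀ ≤ 2 ^ b ^ 53 := by
  have hl : (scale m).l ≤ b ^ 25 := h.length_le
  have hbig := h.big
  have i0 : b ^ 1 ≤ b ^ 25 := h.pow_le_pow (by norm_num)
  have i1 := h.one_le_pow 25
  have i2 : 27 * b ^ 25 ≤ b ^ 26 := h.mul_pow_le _ (by norm_num)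
  have hM : 2 * (scale m).M + 1 ≤ 2 ^ b := by
    rw [show (scale m).M = b ^ 1200 from h.radius_eq]
    have j1 := h.one_le_pow 1200
    have j2 : 3 * b ^ 1200 ≤ b ^ 1201 := h.mul_pow_le _ (by norm_num)
    have j3 : b ^ 1201 ≤ b ^ 10000 := h.pow_le_pow (by norm_num)
    have := h.pow_le
    linarith
  have hQ : (scale m).Q ≤ 2 ^ b ^ 26 := by
    calc (scale m).Q = 2 ^ (16 * (scale m).l + 1) * (2 * (scale m).M + 1) := rfl
      _ ≤ 2 ^ (16 * (scale m).l + 1) * 2 ^ b := Nat.mul_le_mul_left _ hM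
      _ = 2 ^ (16 * (scale m).l + 1 + b) := (pow_add _ _ _).symm
      _ ≤ _ := Nat.pow_le_pow_right (by norm_num) (by linarith)
  have hQk : (scale m).Q ^ (9 * (scale m).l + 1) ≤ 2 ^ b ^ 52 := by
    calc (scale m).Q ^ (9 * (scale m).l + 1) ≤ (2 ^ b ^ 26) ^ (9 * (scale m).l + 1) :=
          Nat.pow_le_pow_left hQ _
      _ = 2 ^ (b ^ 26 * (9 * (scale m).l + 1)) := (pow_mul _ _ _).symm
      _ ≤ 2 ^ (b ^ 26 * b ^ 26) := Nat.pow_le_pow_right (by norm_num)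
          (Nat.mul_le_mul_left _ (by linarith))
      _ = 2 ^ b ^ 52 := by rw [← pow_add]
  have hI : (scale m).I₀ ≤ 2 ^ b ^ 52 := by
    rw [h.sel_eq.2.2.1]
    calc b ^ 194 ≤ b ^ 10000 := h.pow_le_pow (by norm_num)
      _ ≤ 2 ^ b := h.pow_le
      _ ≤ _ := Nat.pow_le_pow_right (by norm_num)
          (by simpa using h.pow_le_pow (show 1 ≤ 52 by norm_num))
  calc _ ≤ 2 ^ b ^ 52 + 2 ^ b ^ 52 := add_le_add hQk hI
    _ = 2 ^ (b ^ 52 + 1) := by rw [pow_succ]; ring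
    _ ≤ _ := by
      refine Nat.pow_le_pow_right (by norm_num) ?_
      have j1 := h.one_le_pow 52
      have j2 : 2 * b ^ 52 ≤ b ^ 53 := h.mul_pow_le _ (by norm_num)
      linarith

theorem loop (h : LargeScale m b) :
    1 / (4 * (b : ℝ) ^ 488) ≤ Pr (scale m).T (Loop (b ^ 489)) := by
  have hb := h.pos
  rw [h.sel_eq.1]
  refine le_trans ?_ (le_Pr_loop (b ^ 489) (b ^ 976) (h.one_le_pow _))
  have hs : Real.sqrt ((b ^ 976 : ℕ) : ℝ) = (b : ℝ) ^ 488 := by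
    rw [show 976 = 2 * 488 by norm_num, h.sqrt_pow]
  rw [hs]
  push_cast
  rw [show ((b : ℝ) ^ 489) ^ 2 / (4 * (b : ℝ) ^ 976) = (b : ℝ) ^ 2 / 4 by field_simp]
  have h1 : 2 * (2 * b ^ 976 + 1) * (4 * b ^ 488) ≤ b ^ 9999 := by
    have i1 := h.one_le_pow 976
    calc 2 * (2 * b ^ 976 + 1) * (4 * b ^ 488) ≤ 2 * (2 * b ^ 976 + b ^ 976) * (4 * b ^ 488) := by
          gcongr
      _ = 24 * b ^ 1464 := by ring
      _ ≤ b ^ 1465 := h.mul_pow_le _ (by norm_num)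
      _ ≤ _ := h.pow_le_pow (by norm_num)
  have h2 := h.mul_half_pow_le h1
  push_cast at h2
  have h3 : 1 / (b : ℝ) ≤ 1 := by
    rw [div_le_one hb]; exact_mod_cast (by have := h.big; omega : 1 ≤ b)
  have h4 : 2 * (2 * (b : ℝ) ^ 976 + 1) * Real.exp (-((b : ℝ) ^ 2 / 4)) ≤
      1 / (4 * (b : ℝ) ^ 488) := by
    rw [le_div_iff₀ (by positivity)]
    calc _ ≤ 2 * (2 * (b : ℝ) ^ 976 + 1) * (1 / 2) ^ b * (4 * (b : ℝ) ^ 488) := by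
          gcongr; exact h.exp_sq_le
      _ = 2 * (2 * (b : ℝ) ^ 976 + 1) * (4 * (b : ℝ) ^ 488) * (1 / 2) ^ b := by ring
      _ ≤ 1 := h2.trans h3
  have h5 : 1 / (2 * (b : ℝ) ^ 488) = 1 / (4 * (b : ℝ) ^ 488) + 1 / (4 * (b : ℝ) ^ 488) := by
    field_simp; norm_num
  linarith

/-- The expected number of loops is 2^(b^54) divided by a power of b, against at most 2^(b^53)
demanded. -/
theorem loops (h : LargeScale m b) : Pr (((scale m).I + 1) * (scale m).T)
    (fun u => loopCount (b ^ 489) (scale m).T (scale m).I u <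
      ((scale m).Q ^ (9 * (scale m).l + 1) + (scale m).I₀ : ℕ)) ≤ 1 / b := by
  have hb := h.pos
  set k := (scale m).Q ^ (9 * (scale m).l + 1) + (scale m).I₀ with hk
  obtain ⟨hT, -, -, hI⟩ := h.sel_eq
  have e := Pr_loopCount_lt_mul_le (b ^ 489) (scale m).T (scale m).I k
  have e1 := h.loop
  have e2 := le_sum_Pr_pos_eq_zero_blocks (b ^ 976) (scale m).I (h.one_le_pow _)
    (by have := h.first_block_lt; omega)
  rw [← hT, show 976 = 2 * 488 by norm_num, h.sqrt_pow] at e2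
  have hs : Real.sqrt ((scale m).I : ℝ) = 2 ^ b ^ 54 := by
    rw [hI]; push_cast
    rw [show (4 : ℝ) = 2 ^ 2 by norm_num, ← pow_mul, mul_comm, pow_mul]
    exact Real.sqrt_sq (by positivity)
  rw [hs] at e2
  set p := Pr ((scale m).I * (scale m).T)
    (fun u => loopCount (b ^ 489) (scale m).T (scale m).I u < k) with hp
  have hp0 : 0 ≤ p := Pr_nonneg _ _
  have hfull : Pr (((scale m).I + 1) * (scale m).T)
      (fun u => loopCount (b ^ 489) (scale m).T (scale m).I u < k) = p := by
    rw [Nat.succ_mul, hp, ← Pr_prefix ((scale m).I * (scale m).T) (scale m).T]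
    refine Pr_congr _ fun u _ => ?_
    have : loopCount (b ^ 489) (scale m).T (scale m).I u = loopCount (b ^ 489) (scale m).T
        (scale m).I (u.take ((scale m).I * (scale m).T)) := by
      refine Finset.sum_congr rfl fun i hi => ?_
      have hi' : i * (scale m).T + (scale m).T ≤ (scale m).I * (scale m).T := by
        have := Nat.mul_le_mul_right (scale m).T (Finset.mem_range.1 hi)
        rwa [Nat.succ_mul] at this
      rw [stp_take _ _ _ (by omega), List.drop_take, List.take_take, min_eq_left (by omega)]
    rw [this]
  rw [hfull]
  have e3 : p * (1 / (4 * (b : ℝ) ^ 488) * (2 ^ b ^ 54 / (2 * (b : ℝ) ^ 488))) ≤ k := by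
    refine le_trans ?_ e
    gcongr
    exact le_trans (by positivity) e1
  have hk2 : (k : ℝ) ≤ 2 ^ b ^ 53 := by exact_mod_cast h.visits_bound
  have hX : (2 : ℝ) ^ b ^ 53 * 2 ^ b ≤ 2 ^ b ^ 54 := by
    rw [← pow_add]
    refine pow_le_pow_right₀ (by norm_num) ?_
    have i1 : b ^ 1 ≤ b ^ 53 := h.pow_le_pow (by norm_num)
    have i2 : 2 * b ^ 53 ≤ b ^ 54 := h.mul_pow_le _ (by norm_num)
    linarith
  have h1 : 8 * b ^ 976 ≤ b ^ 9999 := (h.mul_pow_le 976 (by norm_num)).trans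
    (h.pow_le_pow (by norm_num))
  refine le_trans ?_ (h.mul_half_pow_le h1)
  push_cast
  generalize (2 : ℝ) ^ b ^ 54 = X at *
  have hY : (0 : ℝ) < 2 ^ b ^ 53 := by positivity
  generalize (2 : ℝ) ^ b ^ 53 = Y at *
  have h2b : (0 : ℝ) < 2 ^ b := by positivity
  rw [one_div_pow, mul_one_div, le_div_iff₀ h2b]
  have e4 : p * X ≤ 8 * (b : ℝ) ^ 976 * Y := by
    have : p * (1 / (4 * (b : ℝ) ^ 488) * (X / (2 * (b : ℝ) ^ 488))) =
        p * X / (8 * (b : ℝ) ^ 976) := by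
      field_simp; ring
    rw [this, div_le_iff₀ (by positivity)] at e3
    calc p * X ≤ k * (8 * (b : ℝ) ^ 976) := e3
      _ ≤ Y * (8 * (b : ℝ) ^ 976) := by gcongr
      _ = _ := mul_comm _ _
  have e5 : (p * 2 ^ b) * Y ≤ 8 * (b : ℝ) ^ 976 * Y := by
    calc (p * 2 ^ b) * Y = p * (Y * 2 ^ b) := by ring
      _ ≤ p * X := by gcongr
      _ ≤ _ := e4
  exact le_of_mul_le_mul_right e5 hY

/-- `Q` is 2^(16l) times a factor of order b^1200, and this factor, in the exponent, outweighs the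
2^(16l) words of the union bound. -/
theorem frequent (h : LargeScale m b) (ξ : ℤ → Bool) : Pr (((scale m).I + 1) * (scale m).T)
    (fun u => ¬ Frequent ((scale m).sel (record ξ u)) (scale m).T (16 * (scale m).l) (scale m).M
      (scale m).Q u) ≤ 1 / b := by
  have hb := h.pos
  have hl : (scale m).l ≤ b ^ 25 := h.length_le
  have i2 : 17 * b ^ 25 ≤ b ^ 26 := h.mul_pow_le _ (by norm_num)
  have hT1 : 1 ≤ (scale m).T := by rw [h.sel_eq.1]; have := h.one_le_pow 976; omega
  have hWT : 16 * (scale m).l ≤ (scale m).T := by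
    rw [h.sel_eq.1]
    have : b ^ 26 ≤ b ^ 976 := h.pow_le_pow (by norm_num)
    linarith
  refine (Pr_not_frequent_le _ _ _ _ _ _ _ _ hT1 hWT h.first_block.le ξ).trans ?_
  have hM : (scale m).M = b ^ 1200 := h.radius_eq
  have hQ : (1 / 2 : ℝ) ^ (16 * (scale m).l) * (scale m).Q / 8 = (2 * (b : ℝ) ^ 1200 + 1) / 4 := by
    have : ((scale m).Q : ℝ) = 2 ^ (16 * (scale m).l) * 2 * (2 * (b : ℝ) ^ 1200 + 1) := by
      rw [← pow_succ]
      have : (scale m).Q = 2 ^ (16 * (scale m).l + 1) * (2 * (scale m).M + 1) := rfl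
      rw [this, hM]; push_cast; rfl
    rw [this, one_div_pow]
    field_simp; norm_num
  rw [hQ, hM]
  have h1 : 2 * b ^ 1200 + 1 ≤ b ^ 9999 := by
    have j1 := h.one_le_pow 1200
    have j2 : 3 * b ^ 1200 ≤ b ^ 1201 := h.mul_pow_le _ (by norm_num)
    have j3 : b ^ 1201 ≤ b ^ 9999 := h.pow_le_pow (by norm_num)
    linarith
  refine le_trans ?_ (h.mul_half_pow_le h1)
  have h2 : Real.exp (-((2 * (b : ℝ) ^ 1200 + 1) / 4)) ≤ (1 / 2) ^ (16 * (scale m).l + b) := by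
    refine exp_neg_le_half_pow ?_
    have j0 : b ^ 1 ≤ b ^ 25 := h.pow_le_pow (by norm_num)
    have j1 : 4 * (16 * (scale m).l + b) ≤ 2 * b ^ 1200 + 1 := by
      have j2 : 4 * b ^ 26 ≤ b ^ 27 := h.mul_pow_le _ (by norm_num)
      have j3 : b ^ 27 ≤ b ^ 1200 := h.pow_le_pow (by norm_num)
      linarith
    have j2 : (4 * (16 * (scale m).l + b) : ℝ) ≤ 2 * (b : ℝ) ^ 1200 + 1 := by exact_mod_cast j1
    push_cast; linarith
  push_cast
  calc _ ≤ (2 * (b : ℝ) ^ 1200 + 1) * 2 ^ (16 * (scale m).l) *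
        (1 / 2) ^ (16 * (scale m).l + b) := by gcongr
    _ = (2 * (b : ℝ) ^ 1200 + 1) * (1 / 2) ^ b := by
      rw [pow_add, mul_assoc, ← mul_assoc (2 ^ (16 * (scale m).l)), ← mul_pow]; norm_num

theorem typical (h : LargeScale m b) : PrJ (scaleWidth m) (((scale m).I + 1) * (scale m).T)
    (fun ξ u => ¬ Typical (scale m) ξ u) ≤ 9 * (1 / b) :=
  PrJ_not_typical_le (scale m) (scaleWidth m) (b ^ 586) (b ^ 489) ((b : ℝ) ^ 190) (1 / b)
    h.first_block.le h.nonRepetitive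
    (h.distinctive _ (by rw [abs_neg, abs_of_nonneg (by positivity)]))
    (h.distinctive _ (by rw [abs_of_nonneg (by positivity)])) h.confined h.card_runLevels h.far
    h.allRead h.loops h.frequent

end LargeScale

/-! ### Gluing the scales: uniqueness for infinite sceneries -/

theorem eventually_largeScale : ∀ᶠ m : ℕ in Filter.atTop, LargeScale m (2 ^ m) := by
  have ht : Filter.Tendsto (fun m : ℕ => 2 ^ m) Filter.atTop Filter.atTop :=
    tendsto_pow_atTop_atTop_of_one_lt (by norm_num)
  filter_upwards [ht.eventually (eventually_pow_le_two_pow 10000),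
    ht.eventually (Filter.eventually_ge_atTop 1000000), Filter.eventually_ge_atTop 1] with m h1 h2 h3
  exact ⟨rfl, h3, Nat.lt_two_pow_self.le, h2, h1⟩

/-- The first `n` bits of a sequence. -/
def stepList (s : ℕ → Bool) (n : ℕ) : List Bool := List.ofFn fun i : Fin n => s i

/-- The colors of the sites from `-N` to `N`. -/
def colorList (ξ : ℤ → Bool) (N : ℕ) : List Bool :=
  List.ofFn fun i : Fin (2 * N + 1) => ξ (-(N : ℤ) + (i : ℕ))

@[simp] theorem length_stepList (s : ℕ → Bool) (n : ℕ) : (stepList s n).length = n := by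
  simp [stepList]

@[simp] theorem length_colorList (ξ : ℤ → Bool) (N : ℕ) :
    (colorList ξ N).length = 2 * N + 1 := by simp [colorList]

theorem take_stepList (s : ℕ → Bool) {t n : ℕ} (h : t ≤ n) :
    (stepList s n).take t = stepList s t := by
  apply List.ext_getElem
  · simp; omega
  · intro k h1 h2; simp [stepList]

theorem colorOf_colorList (ξ : ℤ → Bool) (N : ℕ) {x : ℤ} (hx : |x| ≤ N) :
    colorOf N (colorList ξ N) x = ξ x := by
  rw [abs_le] at hx
  obtain ⟨k, rfl⟩ : ∃ k : ℕ, x = -(N : ℤ) + k := ⟨(x + N).toNat, by omega⟩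
  unfold colorOf
  rw [overwrite_add (by simp; omega), List.getD_eq_getElem _ _ (by simp; omega)]
  simp only [colorList, List.getElem_ofFn]

/-- The position at time `t` of the walk with the steps `s`. -/
def walk (s : ℕ → Bool) (t : ℕ) : ℤ := pos (stepList s t)

theorem abs_walk_le (s : ℕ → Bool) (t : ℕ) : |walk s t| ≤ t := by
  have := abs_pos_le (stepList s t)
  rwa [length_stepList] at this

theorem stp_stepList (s : ℕ → Bool) {t n : ℕ} (h : t ≤ n) : stp (stepList s n) t = walk s t := by
  unfold stp walk; rw [take_stepList s h]

/-- The number of steps that matter at scale `m`. -/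
def scaleTime (m : ℕ) : ℕ := ((scale m).I + 1) * (scale m).T

/-- A scenery and a walk are typical at scale `m`. -/
def TypicalAt (m : ℕ) (ξ : ℤ → Bool) (s : ℕ → Bool) : Prop :=
  Typical (scale m) (colorOf (scaleWidth m) (colorList ξ (scaleWidth m)))
    (stepList s (scaleTime m))

theorem record_window (m : ℕ) (ξ : ℤ → Bool) (s : ℕ → Bool) {t : ℕ} (ht : t ≤ scaleTime m) :
    record (colorOf (scaleWidth m) (colorList ξ (scaleWidth m))) (stepList s (scaleTime m)) t =
      ξ (walk s t) := by
  unfold record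
  rw [stp_stepList s ht, colorOf_colorList]
  have := abs_walk_le s t
  have h2 : scaleTime m ≤ scaleWidth m := by unfold scaleTime scaleWidth; omega
  omega

theorem scaleLength_le_succ (m : ℕ) : scaleLength m ≤ scaleLength (m + 1) := by
  have h : 2 ^ m ≤ 2 ^ (m + 1) := Nat.pow_le_pow_right (by norm_num) (by omega)
  unfold scaleLength
  gcongr
  omega

theorem range_mono (m : ℕ) : 2 * ((scale m).M + 16 * (scale m).l) ≤ (scale m).D := by
  change 2 * (scaleRadius m + 16 * scaleLength m) ≤
    2 * (scaleRadius (m + 1) + 16 * scaleLength (m + 1))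
  have h1 : scaleRadius m ≤ scaleRadius (m + 1) :=
    Nat.pow_le_pow_left (Nat.pow_le_pow_right (by norm_num) (by omega)) _
  have h2 := scaleLength_le_succ m
  omega

theorem nonRepetitive_window {m : ℕ} {ξ : ℤ → Bool} {s : ℕ → Bool} (h : TypicalAt m ξ s) :
    NonRepetitive (scale m).l (scale m).D ξ := by
  have hN : (scale m).D + (scale m).l + 1 ≤ scaleWidth m := by unfold scaleWidth; omega
  obtain ⟨h1, h2⟩ := h.nonRepetitive
  refine ⟨fun s s' hs hs' hlt => ?_, fun s s' hs hs' hlt => ?_⟩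
  · obtain ⟨k, hk, hne⟩ := h1 s s' hs hs' hlt
    rw [abs_le] at hs hs'
    rw [colorOf_colorList _ _ (abs_le.2 (by omega)), colorOf_colorList _ _ (abs_le.2 (by omega))]
      at hne
    exact ⟨k, hk, hne⟩
  · obtain ⟨k, hk, hne⟩ := h2 s s' hs hs' hlt
    rw [abs_le] at hs hs'
    rw [colorOf_colorList _ _ (abs_le.2 (by omega)), colorOf_colorList _ _ (abs_le.2 (by omega))]
      at hne
    exact ⟨k, hk, hne⟩

/-- Typical pairs with the same color record agree near the origin up to an isometry. -/
theorem TypicalAt.agree {m : ℕ} (hm : LargeScale m (2 ^ m)) {ξ ξ' : ℤ → Bool} {s s' : ℕ → Bool}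
    (h : TypicalAt m ξ s) (h' : TypicalAt m ξ' s')
    (hrec : ∀ t, ξ (walk s t) = ξ' (walk s' t)) :
    ∃ a β : ℤ, (β = 1 ∨ β = -1) ∧ |a| ≤ 2 * ((scale m).M + 16 * (scale m).l) ∧
      ∀ x : ℤ, |x| ≤ (scale m).l → ξ x = ξ' (a + β * x) := by
  have hN : (scale m).D + (scale m).l + 1 ≤ scaleWidth m := by unfold scaleWidth; omega
  set η := colorOf (scaleWidth m) (colorList ξ (scaleWidth m)) with hη
  set η' := colorOf (scaleWidth m) (colorList ξ' (scaleWidth m)) with hη'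
  set u := stepList s (scaleTime m) with hu
  set u' := stepList s' (scaleTime m) with hu'
  -- The selection is a function of the record, which the two pairs share.
  have hsel : (scale m).sel (record η' u') = (scale m).sel (record η u) := by
    ext i
    unfold Scale.sel
    rw [mem_selected, mem_selected]
    refine and_congr_right fun hi => test_congr ?_ fun t ht => ?_
    · rw [hm.first_block]
      exact (Nat.mul_le_mul_right _ hi.1).trans (by omega)
    · have hle : i * (scale m).T + (scale m).T ≤ scaleTime m := by
        unfold scaleTime
        rw [← Nat.succ_mul]; exact Nat.mul_le_mul_right _ (by omega)
      rw [record_window m ξ' s' (by omega), record_window m ξ s (by omega), hrec]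
  have hl1 : 1 ≤ (scale m).l := le_trans Nat.one_le_two_pow hm.le_length
  have hWT : 16 * (scale m).l ≤ (scale m).T := by
    have hl : (scale m).l ≤ (2 ^ m) ^ 25 := hm.length_le
    have i2 : 16 * (2 ^ m) ^ 25 ≤ (2 ^ m) ^ 26 := hm.mul_pow_le _ (by norm_num)
    have i3 : (2 ^ m) ^ 26 ≤ (2 ^ m) ^ 976 := hm.pow_le_pow (by norm_num)
    rw [hm.sel_eq.1]
    linarith
  obtain ⟨a, β, hβ, ha, hagree⟩ := agree_of_same_record (A := (scale m).sel (record η u))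
    (T := (scale m).T) (M := (scale m).M) (Q := (scale m).Q) (N := scaleTime m)
    (l := (scale m).l) (u := u) (u' := u') (ξ := η) (ξ' := η') (χ := record η u) hl1 le_rfl
    h.localized h.frequent (hsel ▸ h'.localized) (hsel ▸ h'.frequent) (fun t _ => rfl)
    (fun t ht => by
      change _ = record η' u' t
      rw [record_window m ξ s ht, record_window m ξ' s' ht, hrec])
    (by simp [hu]) (by simp [hu'])
    (fun i hi => by
      have hi' := (mem_selected.1 hi).1.2
      unfold scaleTime
      have := Nat.mul_le_mul_right (scale m).T (show i + 1 + 1 ≤ (scale m).I + 1 by omega)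
      rw [Nat.succ_mul] at this
      omega)
    h.le_visits h.distinctive_left h.distinctive_right
  have ha' : |a| ≤ (scale m).D := ha.trans (by exact_mod_cast range_mono m)
  refine ⟨a, β, hβ, ha, fun x hx => ?_⟩
  have := hagree x hx
  rw [abs_le] at hx ha'
  rwa [hη, hη', colorOf_colorList _ _ (abs_le.2 (by omega)), colorOf_colorList _ _ (abs_le.2 ?_)]
    at this
  rcases hβ with rfl | rfl <;> omega

/-- Equal orientations with different shifts would repeat a word, and opposite orientations would
produce a mirrored copy of one. -/
theorem NonRepetitive.isometry_unique {l D : ℕ} {ξ : ℤ → Bool} (h : NonRepetitive l D ξ)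
    {a a' β β' : ℤ} (hβ : β = 1 ∨ β = -1) (hβ' : β' = 1 ∨ β' = -1) (ha : |a| ≤ D) (ha' : |a'| ≤ D)
    (heq : ∀ x : ℤ, |x| ≤ l → ξ (a + β * x) = ξ (a' + β' * x)) : a = a' ∧ β = β' := by
  have shift : ∀ {a a' : ℤ}, |a| ≤ D → |a'| ≤ D →
      (∀ x : ℤ, |x| ≤ l → ξ (a + x) = ξ (a' + x)) → ¬ a < a' := by
    intro a a' ha ha' heq hlt
    obtain ⟨k, hk, hne⟩ := h.shift a a' ha ha' hlt
    exact hne (heq k (by rw [Nat.abs_cast]; omega)).symm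
  have refl : ∀ {a a' : ℤ}, |a| ≤ D → |a'| ≤ D →
      (∀ x : ℤ, |x| ≤ l → ξ (a + x) = ξ (a' - x)) → ¬ a ≤ a' := by
    intro a a' ha ha' heq hle
    obtain ⟨k, hk, hne⟩ := h.reflect a a' ha ha' hle
    have := heq (-1 - k) (abs_le.2 (by omega))
    apply hne
    rw [show a' + 1 + k = a' - (-1 - k) by ring, ← this]
    congr 1; ring
  have flip : ∀ {a a' : ℤ}, (∀ x : ℤ, |x| ≤ l → ξ (a + x) = ξ (a' - x)) →
      ∀ x : ℤ, |x| ≤ l → ξ (a' + x) = ξ (a - x) := by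
    intro a a' heq x hx
    have := heq (-x) (by rwa [abs_neg])
    rw [sub_neg_eq_add, ← sub_eq_add_neg] at this
    exact this.symm
  have noRefl : ∀ {a a' : ℤ}, |a| ≤ D → |a'| ≤ D →
      (∀ x : ℤ, |x| ≤ l → ξ (a + x) = ξ (a' - x)) → False := by
    intro a a' ha ha' heq
    rcases le_total a a' with hle | hle
    · exact refl ha ha' heq hle
    · exact refl ha' ha (flip heq) hle
  have noShift : ∀ {a a' : ℤ}, |a| ≤ D → |a'| ≤ D →
      (∀ x : ℤ, |x| ≤ l → ξ (a + x) = ξ (a' + x)) → a = a' := by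
    intro a a' ha ha' heq
    have h1 := shift ha ha' heq
    have h2 := shift ha' ha (fun x hx => (heq x hx).symm)
    omega
  rcases hβ with rfl | rfl <;> rcases hβ' with rfl | rfl
  · refine ⟨noShift ha ha' fun x hx => ?_, rfl⟩
    simpa using heq x hx
  · exact (noRefl ha ha' fun x hx => by simpa [sub_eq_add_neg] using heq x hx).elim
  · exact (noRefl ha' ha fun x hx => by simpa [sub_eq_add_neg] using (heq x hx).symm).elim
  · refine ⟨noShift ha ha' fun x hx => ?_, rfl⟩
    simpa using heq (-x) (by rwa [abs_neg])

/-- Eventually typical pairs with the same color record have equivalent sceneries. -/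
theorem equivalent_of_typical {ξ ξ' : ℤ → Bool} {s s' : ℕ → Bool}
    (h : ∀ᶠ m in Filter.atTop, TypicalAt m ξ s) (h' : ∀ᶠ m in Filter.atTop, TypicalAt m ξ' s')
    (hrec : ∀ t, ξ (walk s t) = ξ' (walk s' t)) :
    ∃ a β : ℤ, (β = 1 ∨ β = -1) ∧ ∀ x : ℤ, ξ x = ξ' (a + β * x) := by
  obtain ⟨m₀, hm₀⟩ := Filter.eventually_atTop.1 ((h.and h').and eventually_largeScale)
  have key : ∀ k : ℕ, ∃ a β : ℤ, (β = 1 ∨ β = -1) ∧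
      |a| ≤ 2 * ((scale (m₀ + k)).M + 16 * (scale (m₀ + k)).l) ∧
      ∀ x : ℤ, |x| ≤ (scale (m₀ + k)).l → ξ x = ξ' (a + β * x) := fun k =>
    let hk := hm₀ (m₀ + k) (by omega)
    hk.1.1.agree hk.2 hk.1.2 hrec
  choose a β hβ ha hagree using key
  -- Both isometries carry the smaller piece of `ξ` to the same colours of `ξ'`, and the range `D`
  -- at the smaller scale covers both.
  have hstep : ∀ k : ℕ, a k = a (k + 1) ∧ β k = β (k + 1) := by
    intro k
    refine (nonRepetitive_window (hm₀ (m₀ + k) (by omega)).1.2).isometry_unique (hβ k)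
      (hβ (k + 1)) ((ha k).trans (by exact_mod_cast range_mono (m₀ + k)))
      ((ha (k + 1)).trans (le_of_eq ?_)) fun x hx => ?_
    · have : (scale (m₀ + k)).D = 2 * ((scale (m₀ + (k + 1))).M + 16 * (scale (m₀ + (k + 1))).l) :=
        rfl
      rw [this]; push_cast; rfl
    · rw [← hagree k x hx, ← hagree (k + 1) x (hx.trans (by exact_mod_cast scaleLength_le_succ (m₀ + k)))]
  have hconst : ∀ k : ℕ, a k = a 0 ∧ β k = β 0 := by
    intro k
    induction k with
    | zero => exact ⟨rfl, rfl⟩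
    | succ k ih => rw [← (hstep k).1, ← (hstep k).2]; exact ih
  refine ⟨a 0, β 0, hβ 0, fun x => ?_⟩
  have hx := hagree x.natAbs x (by
    rw [Int.abs_eq_natAbs]
    have h1 : 2 ^ (m₀ + x.natAbs) ≤ (scale (m₀ + x.natAbs)).l :=
      (hm₀ (m₀ + x.natAbs) (by omega)).2.le_length
    have h2 : m₀ + x.natAbs < 2 ^ (m₀ + x.natAbs) := Nat.lt_two_pow_self
    omega)
  rwa [(hconst _).1, (hconst _).2] at hx

/-! ### Measurable selection on a compact set -/

section Selection

variable {X : Type*} (K : Set X) (χ ζ : X → ℕ → Bool)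

/-- The values of `χ` at the points of `K` where `ζ` starts with `w`. -/
def valuesAbove (w : List Bool) : Set (ℕ → Bool) :=
  χ '' (K ∩ {x | ∀ i < w.length, ζ x i = w.getD i false})

open Classical in
/-- The first `n` bits of the lexicographically largest `ζ x` with `x ∈ K` and `χ x = c`. -/
noncomputable def greedy (c : ℕ → Bool) : ℕ → List Bool
  | 0 => []
  | n + 1 => greedy c n ++ [decide (c ∈ valuesAbove K χ ζ (greedy c n ++ [true]))]

theorem length_greedy (c : ℕ → Bool) (n : ℕ) : (greedy K χ ζ c n).length = n := by
  induction n with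
  | zero => rfl
  | succ n ih => simp [greedy, ih]

variable {K χ ζ}

theorem mem_valuesAbove_greedy {c : ℕ → Bool} (hc : c ∈ χ '' K) (n : ℕ) :
    c ∈ valuesAbove K χ ζ (greedy K χ ζ c n) := by
  classical
  induction n with
  | zero =>
    obtain ⟨x, hx, rfl⟩ := hc
    exact ⟨x, ⟨hx, by simp [greedy]⟩, rfl⟩
  | succ n ih =>
    by_cases h : c ∈ valuesAbove K χ ζ (greedy K χ ζ c n ++ [true])
    · simp [greedy, h]
    · obtain ⟨x, ⟨hxK, hx⟩, hxc⟩ := ih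
      have hl := length_greedy K χ ζ c n
      have hgr : greedy K χ ζ c (n + 1) = greedy K χ ζ c n ++ [false] := by simp [greedy, h]
      rw [hgr]
      have ext : ∀ b, ζ x n = b → c ∈ valuesAbove K χ ζ (greedy K χ ζ c n ++ [b]) := by
        intro b hb
        refine ⟨x, ⟨hxK, fun i hi => ?_⟩, hxc⟩
        rw [List.length_append, hl, List.length_singleton] at hi
        rcases Nat.lt_or_ge i n with h1 | h1
        · rw [List.getD_append _ _ _ _ (by omega)]; exact hx i (by omega)
        · obtain rfl : i = n := by omega
          rw [List.getD_append_right _ _ _ _ (by omega), hl, hb]; simp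
      cases hb : ζ x n
      · exact ext false hb
      · exact (h (ext true hb)).elim

variable [TopologicalSpace X]

theorem isClosed_startsWith (hζ : Continuous ζ) (w : List Bool) :
    IsClosed {x | ∀ i < w.length, ζ x i = w.getD i false} := by
  simp only [Set.ofPred_forall]
  exact isClosed_iInter fun i => isClosed_iInter fun _ =>
    isClosed_eq ((continuous_apply i).comp hζ) continuous_const

/-- A continuous image of a compact set, hence closed; general measurable images need not be Borel.
-/
theorem measurableSet_valuesAbove (hK : IsCompact K) (hχ : Continuous χ) (hζ : Continuous ζ)
    (w : List Bool) : MeasurableSet (valuesAbove K χ ζ w) :=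
  ((hK.inter_right (isClosed_startsWith hζ w)).image hχ).isClosed.measurableSet

theorem measurableSet_greedy_eq (hK : IsCompact K) (hχ : Continuous χ) (hζ : Continuous ζ)
    (n : ℕ) (w : List Bool) : MeasurableSet {c | greedy K χ ζ c n = w} := by
  classical
  induction n generalizing w with
  | zero => simp [greedy]
  | succ n ih =>
    have : {c | greedy K χ ζ c (n + 1) = w} = ⋃ v : List Bool, {c | greedy K χ ζ c n = v} ∩
        ((valuesAbove K χ ζ (v ++ [true]) ∩ {_c | w = v ++ [true]}) ∪
          ((valuesAbove K χ ζ (v ++ [true]))ᶜ ∩ {_c | w = v ++ [false]})) := by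
      ext c
      simp only [Set.mem_ofPred_eq, Set.mem_iUnion, Set.mem_inter_iff, Set.mem_union,
        Set.mem_compl_iff, greedy]
      by_cases hc : c ∈ valuesAbove K χ ζ (greedy K χ ζ c n ++ [true])
      · constructor
        · intro h; exact ⟨_, rfl, Or.inl ⟨hc, by rw [← h]; simp [hc]⟩⟩
        · rintro ⟨v, rfl, ⟨-, h⟩ | ⟨h, -⟩⟩
          · rw [h]; simp [hc]
          · exact (h hc).elim
      · constructor
        · intro h; exact ⟨_, rfl, Or.inr ⟨hc, by rw [← h]; simp [hc]⟩⟩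
        · rintro ⟨v, rfl, ⟨h, -⟩ | ⟨-, h⟩⟩
          · exact (hc h).elim
          · rw [h]; simp [hc]
    rw [this]
    refine MeasurableSet.iUnion fun v => (ih v).inter (MeasurableSet.union ?_ ?_)
    · exact (measurableSet_valuesAbove hK hχ hζ _).inter (MeasurableSet.const _)
    · exact (measurableSet_valuesAbove hK hχ hζ _).compl.inter (MeasurableSet.const _)

/-- A measurable selection for the fibers of a continuous map on a compact set. -/
theorem exists_measurable_selection (hK : IsCompact K) (hKc : IsClosed K) (hχ : Continuous χ)
    (hζ : Continuous ζ) :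
    ∃ A : (ℕ → Bool) → ℕ → Bool, Measurable A ∧ ∀ c ∈ χ '' K, ∃ x ∈ K, χ x = c ∧ ζ x = A c := by
  classical
  refine ⟨fun c n => decide (c ∈ valuesAbove K χ ζ (greedy K χ ζ c n ++ [true])), ?_, ?_⟩
  · refine measurable_pi_iff.2 fun n => measurable_to_bool ?_
    have : (fun c => decide (c ∈ valuesAbove K χ ζ (greedy K χ ζ c n ++ [true]))) ⁻¹' {true} =
        ⋃ v : List Bool, {c | greedy K χ ζ c n = v} ∩ valuesAbove K χ ζ (v ++ [true]) := by
      ext c; simp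
    rw [this]
    exact MeasurableSet.iUnion fun v => (measurableSet_greedy_eq hK hχ hζ n v).inter
      (measurableSet_valuesAbove hK hχ hζ _)
  · intro c hc
    -- Nested nonempty compact sets: the points of the fibre that follow the first `n` greedy bits.
    -- A common point realises the whole greedy sequence.
    set Z : ℕ → Set X := fun n => K ∩ ({x | ∀ i < (greedy K χ ζ c n).length,
      ζ x i = (greedy K χ ζ c n).getD i false} ∩ χ ⁻¹' {c}) with hZ
    have hcl : ∀ n, IsClosed (Z n) := fun n => hKc.inter
      ((isClosed_startsWith hζ _).inter (isClosed_singleton.preimage hχ))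
    have hne := IsCompact.nonempty_iInter_of_sequence_nonempty_isCompact_isClosed Z
      (fun n x hx => by
        obtain ⟨h1, h2, h3⟩ := hx
        refine ⟨h1, fun i hi => ?_, h3⟩
        have := h2 i (by rw [length_greedy] at hi ⊢; omega)
        rw [this, greedy, List.getD_append _ _ _ _ hi])
      (fun n => by
        obtain ⟨x, ⟨h1, h2⟩, h3⟩ := mem_valuesAbove_greedy hc n
        exact ⟨x, h1, h2, h3⟩)
      (hK.of_isClosed_subset (hcl 0) Set.inter_subset_left) hcl
    obtain ⟨x, hx⟩ := hne
    rw [Set.mem_iInter] at hx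
    refine ⟨x, (hx 0).1, (hx 0).2.2, funext fun n => ?_⟩
    have := (hx (n + 1)).2.1 n (by rw [length_greedy]; omega)
    rw [this, greedy, List.getD_append_right _ _ _ _ (by rw [length_greedy]), length_greedy]
    simp

end Selection

/-! ### The reconstruction map -/

/-- The coordinates of a scenery and a walk that matter up to width `N` and time `n`. -/
def coordinates (N n : ℕ) (x : (ℤ → Bool) × (ℕ → Bool)) :
    (Fin (2 * N + 1) → Bool) × (Fin n → Bool) :=
  (fun i => x.1 (-(N : ℤ) + (i : ℕ)), fun i => x.2 i)

theorem continuous_coordinates (N n : ℕ) : Continuous (coordinates N n) := by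
  unfold coordinates; fun_prop

/-- The color record of a scenery and a walk. -/
def colorsAlong (x : (ℤ → Bool) × (ℕ → Bool)) (t : ℕ) : Bool := x.1 (walk x.2 t)

theorem continuous_colorsAlong : Continuous colorsAlong := by
  refine continuous_pi fun t => ?_
  have : (fun x => colorsAlong x t) =
      (fun p : (Fin (2 * t + 1) → Bool) × (Fin t → Bool) =>
        colorOf t (List.ofFn p.1) (pos (List.ofFn p.2))) ∘ coordinates t t := by
    funext x
    exact (colorOf_colorList x.1 t (abs_walk_le x.2 t)).symm
  rw [this]
  exact continuous_of_discreteTopology.comp (continuous_coordinates t t)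

/-- The pairs that are typical at all scales from `m₀` on. -/
def typicalFrom (m₀ : ℕ) : Set ((ℤ → Bool) × (ℕ → Bool)) :=
  {x | ∀ m, m₀ ≤ m → TypicalAt m x.1 x.2}

/-- Typicality at one scale depends on finitely many bits, so it is a clopen condition. -/
theorem isClosed_typicalFrom (m₀ : ℕ) : IsClosed (typicalFrom m₀) := by
  unfold typicalFrom
  simp only [Set.ofPred_forall]
  refine isClosed_iInter fun m => isClosed_iInter fun _ => ?_
  exact (isClosed_discrete {p : (Fin (2 * scaleWidth m + 1) → Bool) × (Fin (scaleTime m) → Bool) |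
    Typical (scale m) (colorOf (scaleWidth m) (List.ofFn p.1)) (List.ofFn p.2)}).preimage
    (continuous_coordinates (scaleWidth m) (scaleTime m))

/-- There is a measurable reconstruction that works for all eventually typical pairs. -/
theorem exists_reconstruction : ∃ A : (ℕ → Bool) → ℤ → Bool, Measurable A ∧
    ∀ (ξ : ℤ → Bool) (s : ℕ → Bool), (∀ᶠ m in Filter.atTop, TypicalAt m ξ s) →
      ∃ a β : ℤ, (β = 1 ∨ β = -1) ∧ ∀ x : ℤ, A (fun t => ξ (walk s t)) x = ξ (a + β * x) := by
  classical
  have hζ : Continuous fun (x : (ℤ → Bool) × (ℕ → Bool)) (n : ℕ) =>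
      x.1 (Equiv.intEquivNat.symm n) := by fun_prop
  choose A hA hsel using fun m₀ => exists_measurable_selection (K := typicalFrom m₀)
    (isClosed_typicalFrom m₀).isCompact (isClosed_typicalFrom m₀) continuous_colorsAlong hζ
  -- The second alternative only makes a scale exist for every record; records of eventually typical
  -- pairs satisfy the first.
  set p : ℕ → (ℕ → Bool) → Prop := fun m₀ c => c ∈ colorsAlong '' typicalFrom m₀ ∨
    ∀ k, c ∉ colorsAlong '' typicalFrom k with hp
  have hmeas : ∀ k, MeasurableSet (colorsAlong '' typicalFrom k) := fun k =>
    ((isClosed_typicalFrom k).isCompact.image continuous_colorsAlong).isClosed.measurableSet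
  have hpm : ∀ m₀, MeasurableSet {c | p m₀ c} := by
    intro m₀
    have : {c | p m₀ c} = colorsAlong '' typicalFrom m₀ ∪
        ⋂ k, (colorsAlong '' typicalFrom k)ᶜ := by
      ext c; simp [hp]
    rw [this]
    exact (hmeas m₀).union (MeasurableSet.iInter fun k => (hmeas k).compl)
  have hex : ∀ c, ∃ m₀, p m₀ c := by
    intro c
    by_cases h : ∃ k, c ∈ colorsAlong '' typicalFrom k
    · obtain ⟨k, hk⟩ := h; exact ⟨k, Or.inl hk⟩
    · push Not at h; exact ⟨0, Or.inr h⟩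
  have hB := Measurable.find hA hpm hex
  refine ⟨fun c x => A (Nat.find (hex c)) c (Equiv.intEquivNat x),
    measurable_pi_iff.2 fun x => (measurable_pi_iff.1 hB) _, fun ξ s hs => ?_⟩
  obtain ⟨k, hk⟩ := Filter.eventually_atTop.1 hs
  set c : ℕ → Bool := fun t => ξ (walk s t) with hc
  have hck : c ∈ colorsAlong '' typicalFrom k := ⟨(ξ, s), hk, rfl⟩
  have hfind : c ∈ colorsAlong '' typicalFrom (Nat.find (hex c)) := by
    rcases Nat.find_spec (hex c) with h | h
    · exact h
    · exact (h k hck).elim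
  -- The chosen pair need not be the true one, but it is typical with the same record, so uniqueness
  -- makes its scenery equivalent.
  obtain ⟨x, hx, hxc, hxA⟩ := hsel (Nat.find (hex c)) c hfind
  obtain ⟨a, β, hβ, heq⟩ := equivalent_of_typical
    (Filter.eventually_atTop.2 ⟨Nat.find (hex c), hx⟩) hs (fun t => congrFun hxc t)
  refine ⟨a, β, hβ, fun y => ?_⟩
  rw [← heq y]
  change A (Nat.find (hex c)) c (Equiv.intEquivNat y) = _
  rw [← hxA]; simp

/-! ### Transfer to the given probability space -/

theorem Ex_eq_sum (n : ℕ) (f : List Bool → ℝ) :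
    Ex n f = ∑ v ∈ bitLists n, (1 / 2) ^ n * f v := by
  have h : ∀ u : List Bool, u.length = n → f u = ∑ v ∈ bitLists n, f v * ind (u = v) := by
    intro u hu
    rw [Finset.sum_eq_single u]
    · rw [ind_of_true rfl, mul_one]
    · intro v _ hv
      rw [ind_of_false (Ne.symm hv), mul_zero]
    · exact fun h => (h (mem_bitLists hu)).elim
  rw [Ex_congr n h, Ex_sum]
  refine Finset.sum_congr rfl fun v hv => ?_
  have := Pr_eq n v (length_of_mem_bitLists hv)
  unfold Pr at this
  rw [Ex_mul_left, this, mul_comm]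

theorem PrJ_eq_sum (N n : ℕ) (p : (ℤ → Bool) → List Bool → Prop) :
    PrJ N n p = ∑ w ∈ bitLists (2 * N + 1), ∑ v ∈ bitLists n,
      (1 / 2) ^ (2 * N + 1) * ((1 / 2) ^ n * ind (p (colorOf N w) v)) := by
  unfold PrJ ExS Pr
  rw [Ex_eq_sum]
  refine Finset.sum_congr rfl fun w _ => ?_
  beta_reduce
  rw [Ex_eq_sum, Finset.mul_sum]

section Transfer

variable {Ω : Type*} [MeasurableSpace Ω] {P : Measure Ω} [IsProbabilityMeasure P]

/-- Independent fair bits take every pattern of values with the uniform probability. -/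
theorem measure_forall_decide_eq {ι : Type*} {E : Type*} [MeasurableSpace E]
    [MeasurableSingletonClass E] [DecidableEq E]
    {X : ι → Ω → E} {e : E} (hX : ∀ i, Measurable (X i)) (hind : iIndepFun X P)
    (hhalf : ∀ i, P {ω | X i ω = e} = 1 / 2) {n : ℕ} (j : Fin n → ι)
    (hj : Function.Injective j) (w : Fin n → Bool) :
    P {ω | ∀ i, decide (X (j i) ω = e) = w i} = (1 / 2) ^ n := by
  have hind' := hind.precomp hj
  have hset : ∀ b : Bool, MeasurableSet {x : E | decide (x = e) = b} := by
    intro b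
    cases b
    · rw [show {x : E | decide (x = e) = false} = {e}ᶜ by ext; simp]
      exact (measurableSet_singleton e).compl
    · rw [show {x : E | decide (x = e) = true} = {e} by ext; simp]
      exact measurableSet_singleton e
  have h1 : ∀ i (b : Bool), P (X i ⁻¹' {x : E | decide (x = e) = b}) = 1 / 2 := by
    intro i b
    cases b
    · have e1 : X i ⁻¹' {x : E | decide (x = e) = false} = {ω | X i ω = e}ᶜ := by
        ext ω; simp
      have hm : MeasurableSet {ω | X i ω = e} := hX i (measurableSet_singleton e)
      rw [e1, prob_compl_eq_one_sub hm, hhalf]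
      simp
    · rw [← hhalf i]; congr 1; ext ω; simp
  have := hind'.measure_inter_preimage_eq_mul Finset.univ
    (sets := fun i => {x : E | decide (x = e) = w i}) (fun i _ => hset _)
  have e2 : {ω | ∀ i, decide (X (j i) ω = e) = w i} =
      ⋂ i ∈ Finset.univ, (X ∘ j) i ⁻¹' {x : E | decide (x = e) = w i} := by
    ext ω; simp
  rw [e2]
  refine this.trans ?_
  rw [Finset.prod_congr rfl fun i _ => h1 (j i) (w i)]
  simp

/-- The steps of a walk, encoded as bits. -/
def stepBits (S : ℕ → ℤ) (k : ℕ) : Bool := decide (S (k + 1) - S k = 1)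

/-- The colors of a scenery, encoded as bits. -/
def colorBits (ξ : ℤ → Fin 2) (x : ℤ) : Bool := decide (ξ x = 1)

theorem measurable_stepBits : Measurable stepBits := by
  refine measurable_pi_iff.2 fun k => ?_
  exact (measurable_from_top (f := fun z : ℤ => decide (z = 1))).comp
    ((measurable_pi_apply (k + 1)).sub (measurable_pi_apply k))

theorem measurable_colorBits : Measurable colorBits :=
  measurable_pi_iff.2 fun x =>
    (measurable_from_top (f := fun z : Fin 2 => decide (z = 1))).comp (measurable_pi_apply x)

theorem measurableSet_stepList_eq (n : ℕ) (v : List Bool) :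
    MeasurableSet {S : ℕ → ℤ | stepList (stepBits S) n = v} := by
  have h : Measurable fun S : ℕ → ℤ => fun i : Fin n => stepBits S i :=
    measurable_pi_iff.2 fun i => measurable_pi_iff.1 measurable_stepBits i
  exact h (MeasurableSet.of_discrete (s := {f : Fin n → Bool | List.ofFn f = v}))

theorem measurableSet_colorList_eq (N : ℕ) (w : List Bool) :
    MeasurableSet {ξ : ℤ → Fin 2 | colorList (colorBits ξ) N = w} := by
  have h : Measurable fun ξ : ℤ → Fin 2 => fun i : Fin (2 * N + 1) =>
      colorBits ξ (-(N : ℤ) + (i : ℕ)) :=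
    measurable_pi_iff.2 fun i => measurable_pi_iff.1 measurable_colorBits _
  exact h (MeasurableSet.of_discrete (s := {f : Fin (2 * N + 1) → Bool | List.ofFn f = w}))

variable {S : ℕ → Ω → ℤ} {ξ : ℤ → Ω → Fin 2}

theorem IsSimpleRandomWalk.measure_stepList_eq (hS : IsSimpleRandomWalk P S) {n : ℕ}
    {v : List Bool} (hv : v.length = n) :
    P {ω | stepList (stepBits fun k => S k ω) n = v} = (1 / 2) ^ n := by
  obtain ⟨f, rfl⟩ : ∃ f : Fin n → Bool, v = List.ofFn f := by
    obtain ⟨f, -, h⟩ := Finset.mem_image.1 (mem_bitLists hv)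
    exact ⟨f, h.symm⟩
  rw [← measure_forall_decide_eq (fun k => (hS.measurable (k + 1)).sub (hS.measurable k)) hS.indep
    hS.up (fun i : Fin n => (i : ℕ)) Fin.val_injective f]
  congr 1; ext ω
  rw [Set.mem_ofPred_eq, stepList, List.ofFn_inj]
  simp [funext_iff, stepBits]

theorem IsBernoulliHalfScenery.measure_colorList_eq (hξ : IsBernoulliHalfScenery P ξ) {N : ℕ}
    {w : List Bool} (hw : w.length = 2 * N + 1) :
    P {ω | colorList (colorBits fun k => ξ k ω) N = w} = (1 / 2) ^ (2 * N + 1) := by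
  obtain ⟨f, rfl⟩ : ∃ f : Fin (2 * N + 1) → Bool, w = List.ofFn f := by
    obtain ⟨f, -, h⟩ := Finset.mem_image.1 (mem_bitLists hw)
    exact ⟨f, h.symm⟩
  rw [← measure_forall_decide_eq hξ.measurable hξ.indep hξ.prob_one
    (fun i : Fin (2 * N + 1) => -(N : ℤ) + (i : ℕ)) (fun i j h => Fin.ext (by simpa using h)) f]
  congr 1; ext ω
  rw [Set.mem_ofPred_eq, colorList, List.ofFn_inj]
  simp [funext_iff, colorBits]

/-- The event is split by the finitely many values of the window of colours and of the steps;
independence gives each value its uniform weight. -/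
theorem measure_le_PrJ (hS : IsSimpleRandomWalk P S) (hξ : IsBernoulliHalfScenery P ξ)
    (hSξ : IndepFun (fun ω k => S k ω) (fun ω k => ξ k ω) P) (N n : ℕ)
    (p : (ℤ → Bool) → List Bool → Prop) :
    P {ω | p (colorOf N (colorList (colorBits fun k => ξ k ω) N))
      (stepList (stepBits fun k => S k ω) n)} ≤ ENNReal.ofReal (PrJ N n p) := by
  classical
  set B : List Bool → List Bool → Set Ω := fun w v =>
    {ω | stepList (stepBits fun k => S k ω) n = v ∧ colorList (colorBits fun k => ξ k ω) N = w ∧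
      p (colorOf N w) v} with hB
  have hPB : ∀ w ∈ bitLists (2 * N + 1), ∀ v ∈ bitLists n, P (B w v) ≤
      ENNReal.ofReal ((1 / 2) ^ (2 * N + 1) * ((1 / 2) ^ n * ind (p (colorOf N w) v))) := by
    intro w hw v hv
    by_cases h : p (colorOf N w) v
    · have e : B w v = (fun ω k => S k ω) ⁻¹' {s | stepList (stepBits s) n = v} ∩
          (fun ω k => ξ k ω) ⁻¹' {x | colorList (colorBits x) N = w} := by
        ext ω; simp [hB, h]
      rw [e, hSξ.measure_inter_preimage_eq_mul _ _ (measurableSet_stepList_eq n v)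
        (measurableSet_colorList_eq N w)]
      change P {ω | stepList (stepBits fun k => S k ω) n = v} *
        P {ω | colorList (colorBits fun k => ξ k ω) N = w} ≤ _
      rw [hS.measure_stepList_eq (length_of_mem_bitLists hv),
        hξ.measure_colorList_eq (length_of_mem_bitLists hw), ind_of_true h, mul_one,
        ENNReal.ofReal_mul (by positivity), ENNReal.ofReal_pow (by norm_num),
        ENNReal.ofReal_pow (by norm_num), mul_comm]
      rw [ENNReal.ofReal_div_of_pos (by norm_num)]
      simp
    · have e : B w v = ∅ := by ext ω; simp [hB, h]
      rw [e]; simp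
  calc _ ≤ P (⋃ w ∈ bitLists (2 * N + 1), ⋃ v ∈ bitLists n, B w v) := by
        refine measure_mono fun ω hω => ?_
        simp only [Set.mem_iUnion]
        exact ⟨_, mem_bitLists (by simp [colorList]), _, mem_bitLists (length_stepList _ _),
          rfl, rfl, hω⟩
    _ ≤ ∑ w ∈ bitLists (2 * N + 1), ∑ v ∈ bitLists n, P (B w v) :=
        (measure_biUnion_finset_le _ _).trans
          (Finset.sum_le_sum fun w _ => measure_biUnion_finset_le _ _)
    _ ≤ ∑ w ∈ bitLists (2 * N + 1), ∑ v ∈ bitLists n,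
        ENNReal.ofReal ((1 / 2) ^ (2 * N + 1) * ((1 / 2) ^ n * ind (p (colorOf N w) v))) :=
        Finset.sum_le_sum fun w hw => Finset.sum_le_sum fun v hv => hPB w hw v hv
    _ = _ := by
        have h0 : ∀ w v, (0 : ℝ) ≤
            (1 / 2) ^ (2 * N + 1) * ((1 / 2) ^ n * ind (p (colorOf N w) v)) := fun w v =>
          mul_nonneg (by positivity) (mul_nonneg (by positivity) (ind_nonneg _))
        rw [PrJ_eq_sum, ENNReal.ofReal_sum_of_nonneg fun w _ => Finset.sum_nonneg fun v _ => h0 w v]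
        exact Finset.sum_congr rfl fun w _ =>
          (ENNReal.ofReal_sum_of_nonneg fun v _ => h0 w v).symm

/-- Almost surely the scenery and the walk are typical at all large scales. -/
theorem ae_eventually_typicalAt (hS : IsSimpleRandomWalk P S) (hξ : IsBernoulliHalfScenery P ξ)
    (hSξ : IndepFun (fun ω k => S k ω) (fun ω k => ξ k ω) P) :
    ∀ᵐ ω ∂P, ∀ᶠ m in Filter.atTop,
      TypicalAt m (colorBits fun k => ξ k ω) (stepBits fun k => S k ω) := by
  obtain ⟨m₁, hm₁⟩ := Filter.eventually_atTop.1 eventually_largeScale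
  have hle : ∀ m, P {ω | ¬ TypicalAt (m + m₁) (colorBits fun k => ξ k ω)
      (stepBits fun k => S k ω)} ≤ ENNReal.ofReal (9 * (1 / 2) ^ m) := by
    intro m
    refine (measure_le_PrJ hS hξ hSξ (scaleWidth (m + m₁)) (scaleTime (m + m₁))
      (fun x u => ¬ Typical (scale (m + m₁)) x u)).trans (ENNReal.ofReal_le_ofReal ?_)
    refine (hm₁ (m + m₁) (by omega)).typical.trans ?_
    push_cast
    rw [← one_div_pow]
    gcongr 9 * ?_
    exact pow_le_pow_of_le_one (by norm_num) (by norm_num) (by omega)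
  have hsum : ∑' m, P {ω | ¬ TypicalAt (m + m₁) (colorBits fun k => ξ k ω)
      (stepBits fun k => S k ω)} ≠ ⊤ := by
    refine ne_top_of_le_ne_top ?_ (ENNReal.tsum_le_tsum hle)
    rw [← ENNReal.ofReal_tsum_of_nonneg (fun m => by positivity)
      (summable_geometric_two.mul_left 9)]
    exact ENNReal.ofReal_ne_top
  filter_upwards [ae_eventually_notMem hsum] with ω hω
  obtain ⟨m₂, hm₂⟩ := Filter.eventually_atTop.1 hω
  refine Filter.eventually_atTop.2 ⟨m₂ + m₁, fun m hm => ?_⟩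
  have := hm₂ (m - m₁) (by omega)
  rwa [not_not, Nat.sub_add_cancel (by omega)] at this

/-- The two step probabilities add up to one, so almost surely every step is 1 or -1 and the bits
encode the whole path. -/
theorem IsSimpleRandomWalk.ae_eq_walk (hS : IsSimpleRandomWalk P S) :
    ∀ᵐ ω ∂P, ∀ k, S k ω = walk (stepBits fun k => S k ω) k := by
  have hstep : ∀ᵐ ω ∂P, ∀ k, S (k + 1) ω - S k ω = 1 ∨ S (k + 1) ω - S k ω = -1 := by
    refine ae_all_iff.2 fun k => ?_
    have hm : ∀ z : ℤ, MeasurableSet {ω | S (k + 1) ω - S k ω = z} := fun z =>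
      ((hS.measurable (k + 1)).sub (hS.measurable k)) (measurableSet_singleton z)
    have hu : P ({ω | S (k + 1) ω - S k ω = 1} ∪ {ω | S (k + 1) ω - S k ω = -1}) = 1 := by
      rw [measure_union _ (hm _), hS.up, hS.down, ENNReal.add_halves]
      refine Set.disjoint_left.2 fun ω h1 h2 => ?_
      simp only [Set.mem_ofPred_eq] at h1 h2
      omega
    exact (mem_ae_iff_prob_eq_one ((hm _).union (hm _))).2 hu
  filter_upwards [hS.start, hstep] with ω h0 h k
  induction k with
  | zero => simpa [walk, stepList] using h0
  | succ k ih =>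
    have e : stepList (stepBits fun k => S k ω) (k + 1) =
        stepList (stepBits fun k => S k ω) k ++ [stepBits (fun k => S k ω) k] := by
      simp only [stepList, List.ofFn_succ_last]
      simp
    rw [walk, e, pos_append, ← walk, ← ih]
    rcases h k with h | h <;> simp [stepBits, h, sg] <;> omega

end Transfer

theorem theorem1 {Ω : Type*} [MeasurableSpace Ω] (P : Measure Ω) [IsProbabilityMeasure P]
    (S : ℕ → Ω → ℤ) (ξ : ℤ → Ω → Fin 2)
    (hS : IsSimpleRandomWalk P S) (hξ : IsBernoulliHalfScenery P ξ)
    (hSξ : IndepFun (fun ω k => S k ω) (fun ω k => ξ k ω) P) :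
    ∃ A : (ℕ → Fin 2) → Scenery, Measurable A ∧
      P {ω | Scenery.Equivalent (A (colorRecord ξ S ω)) (fun k => ξ k ω)} = 1 := by
  obtain ⟨A, hA, hrec⟩ := exists_reconstruction
  refine ⟨fun c x => if A (fun t => decide (c t = 1)) x then 1 else 0, ?_, ?_⟩
  · have h : Measurable fun (c : ℕ → Fin 2) (t : ℕ) => decide (c t = 1) :=
      measurable_pi_iff.2 fun t =>
        (measurable_from_top (f := fun z : Fin 2 => decide (z = 1))).comp (measurable_pi_apply t)
    exact measurable_pi_iff.2 fun x =>
      (measurable_from_top (f := fun b : Bool => if b then (1 : Fin 2) else 0)).comp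
        (measurable_pi_iff.1 (hA.comp h) x)
  · refine le_antisymm prob_le_one ?_
    rw [← measure_univ (μ := P)]
    refine measure_mono_ae ?_
    filter_upwards [ae_eventually_typicalAt hS hξ hSξ, hS.ae_eq_walk] with ω ht hw _
    obtain ⟨a, β, hβ, heq⟩ := hrec _ _ ht
    refine ⟨a, β, hβ, fun x => ?_⟩
    have e : (fun t => decide (colorRecord ξ S ω t = 1)) = fun t =>
        colorBits (fun k => ξ k ω) (walk (stepBits fun k => S k ω) t) := by
      funext t
      rw [← hw t]; rfl
    simp only [e]
    rw [heq x, colorBits]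
    generalize ξ (a + β * x) ω = z
    fin_cases z <;> rfl
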